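/- There are a deterministic data structure and constants $c, C\in\mathbb N$ such that the following holds for every unweighted directed graph $G$ with vertex set $\{0,\dots,n-1\}$ (any $n$, any number $m$ of initial edges), undergoing an online sequence of deletions of existing edges, interspersed with queries. The data structure consists of four fixed programs (initialization, deletion, distance query, shortest path query), independent of $n$ and $G$, for a unit-cost random access machine with words of $O(\log n)$ bits (all numbers are less than $(n+2)^c$); the initial graph is given by its adjacency matrix. Let $d_G(u,v)$ denote the distance (minimum number of edges of a directed path) from $u$ to $v$ in the current graph $G$, with a fixed code word for $d_G(u,v)=\infty$. 1. After the initialization and after each operation, the $n\times n$ distance matrix $(d_G(u,v))_{u,v}$ of the current graph is stored explicitly in memory. 2. The total time of the initialization and of all edge deletions together is $O(n^3\log^3 n)$; precisely, it is at most $C\,(n^3(\ln n)^3+1)$. 3. At any point, a query for $d_G(u,v)$ is answered in constant time (at most $C$ steps). 4. At any point, for any pair $(u,v)$, the data structure can report a shortest path from $u$ to $v$ in the current graph, as the sequence of its vertices, in time proportional to its length $\ell=d_G(u,v)$ (at most $C(\ell+1)$ steps); if there is no path from $u$ to $v$, this is reported in at most $C$ steps. -/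

import Mathlib

/-! ### Dynamic unweighted directed graphs -/

namespace DecAPSP

/-- `p 0, p 1, …, p k` is a directed walk with `k` edges from `u` to `v` in `G`. -/
def IsWalk {V : Type*} (G : Digraph V) (u v : V) (k : ℕ) (p : ℕ → V) : Prop :=
  p 0 = u ∧ p k = v ∧ ∀ i < k, G.Adj (p i) (p (i + 1))

/-- The distance from `u` to `v` in `G`: the least number of edges of a directed walk from `u`
to `v`, and `⊤` if there is none. -/
noncomputable def dist {V : Type*} (G : Digraph V) (u v : V) : ℕ∞ :=
  ⨅ (k : ℕ) (_ : ∃ p, IsWalk G u v k p), (k : ℕ∞)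

/-- The graph `G` without the edge `(u, v)`. -/
def deleteEdge {V : Type*} (G : Digraph V) (u v : V) : Digraph V where
  Adj a b := G.Adj a b ∧ ¬ (a = u ∧ b = v)

/-! ### A random access machine with bounded words

The machine has registers and a constant number of memory arrays, each indexed by words. A word is
a natural number below the bound `W`; a computation that produces a number `≥ W` gets stuck.
Programs are finite pieces of syntax that know nothing about `W`. -/

/-- The contents of the registers and of the memory arrays. -/
structure State where
  /-- the content of a register -/
  reg : ℕ → ℕ
  /-- the content of a cell of a memory array -/
  arr : ℕ → ℕ → ℕ

/-- The binary word operations. -/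
inductive BinOp where
  | add | sub | mul | div | lt | eq

/-- The value of a binary operation: subtraction is truncated at `0`, division is rounded down
(with value `0` for divisor `0`), and comparisons return `1` for true and `0` for false. -/
def BinOp.apply : BinOp → ℕ → ℕ → ℕ
  | .add, a, b => a + b
  | .sub, a, b => a - b
  | .mul, a, b => a * b
  | .div, a, b => a / b
  | .lt, a, b => if a < b then 1 else 0
  | .eq, a, b => if a = b then 1 else 0

/-- Expressions: a constant, the content of register `r`, the cell of the array `a` whose index is
the value of `e`, a binary operation. -/
inductive Expr where
  | const (k : ℕ)
  | reg (r : ℕ)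
  | load (a : ℕ) (e : Expr)
  | bin (op : BinOp) (e₁ e₂ : Expr)

/-- Only numbers below `W` are words. -/
def toWord (W k : ℕ) : Option ℕ := if k < W then some k else none

/-- The value of an expression; `none` if a number that is not a word occurs. -/
def Expr.eval (W : ℕ) (s : State) : Expr → Option ℕ
  | .const k => toWord W k
  | .reg r => some (s.reg r)
  | .load a e => (e.eval W s).map (s.arr a)
  | .bin op e₁ e₂ =>
      (e₁.eval W s).bind fun x => (e₂.eval W s).bind fun y => toWord W (op.apply x y)

/-- The time to evaluate an expression: one step for each constant, register access, memory access
and word operation in it. -/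
def Expr.cost : Expr → ℕ
  | .const _ => 1
  | .reg _ => 1
  | .load _ e => e.cost + 1
  | .bin _ e₁ e₂ => e₁.cost + e₂.cost + 1

/-- Programs. `assign r e` writes the value of `e` to register `r`, and `store a e₁ e₂` writes the
value of `e₂` to the cell of the array `a` whose index is the value of `e₁`. -/
inductive Cmd where
  | skip
  | assign (r : ℕ) (e : Expr)
  | store (a : ℕ) (e₁ e₂ : Expr)
  | seq (c₁ c₂ : Cmd)
  | ite (e : Expr) (c₁ c₂ : Cmd)
  | while (e : Expr) (c : Cmd)

/-- Write `x` to register `r`. -/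
def State.setReg (s : State) (r x : ℕ) : State :=
  { s with reg := Function.update s.reg r x }

/-- Write `x` to cell `i` of the array `a`. -/
def State.setCell (s : State) (a i x : ℕ) : State :=
  { s with arr := Function.update s.arr a (Function.update (s.arr a) i x) }

/-- `Exec W c s t s'`: on a machine with word bound `W`, the program `c` started in state `s` halts
after exactly `t` steps in state `s'`, without ever getting stuck. A condition is true when its
value is not `0`. -/
inductive Exec (W : ℕ) : Cmd → State → ℕ → State → Prop
  | skip (s : State) : Exec W .skip s 1 s
  | assign {s : State} {r : ℕ} {e : Expr} {x : ℕ} (he : e.eval W s = some x) :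
      Exec W (.assign r e) s (e.cost + 1) (s.setReg r x)
  | store {s : State} {a : ℕ} {e₁ e₂ : Expr} {i x : ℕ}
      (h₁ : e₁.eval W s = some i) (h₂ : e₂.eval W s = some x) :
      Exec W (.store a e₁ e₂) s (e₁.cost + e₂.cost + 1) (s.setCell a i x)
  | seq {s s₁ s₂ : State} {c₁ c₂ : Cmd} {t₁ t₂ : ℕ}
      (h₁ : Exec W c₁ s t₁ s₁) (h₂ : Exec W c₂ s₁ t₂ s₂) :
      Exec W (.seq c₁ c₂) s (t₁ + t₂) s₂
  | ite_true {s s' : State} {e : Expr} {c₁ c₂ : Cmd} {x t : ℕ}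
      (he : e.eval W s = some x) (hx : x ≠ 0) (h : Exec W c₁ s t s') :
      Exec W (.ite e c₁ c₂) s (e.cost + 1 + t) s'
  | ite_false {s s' : State} {e : Expr} {c₁ c₂ : Cmd} {t : ℕ}
      (he : e.eval W s = some 0) (h : Exec W c₂ s t s') :
      Exec W (.ite e c₁ c₂) s (e.cost + 1 + t) s'
  | while_true {s s₁ s₂ : State} {e : Expr} {c : Cmd} {x t₁ t₂ : ℕ}
      (he : e.eval W s = some x) (hx : x ≠ 0)
      (h₁ : Exec W c s t₁ s₁) (h₂ : Exec W (.while e c) s₁ t₂ s₂) :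
      Exec W (.while e c) s (e.cost + 1 + t₁ + t₂) s₂
  | while_false {s : State} {e : Expr} {c : Cmd} (he : e.eval W s = some 0) :
      Exec W (.while e c) s (e.cost + 1) s

/-- The machine is deterministic. -/
theorem Exec.deterministic {W : ℕ} {c : Cmd} {s : State} {t t' : ℕ} {s₁ s₂ : State}
    (h : Exec W c s t s₁) (h' : Exec W c s t' s₂) : t = t' ∧ s₁ = s₂ := by
  induction h generalizing t' s₂ with
  | skip => cases h'; simp
  | assign he => cases h'; simp_all
  | store h₁ h₂ => cases h'; simp_all
  | seq h₁ h₂ ih₁ ih₂ =>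
    cases h' with
    | seq k₁ k₂ =>
      obtain ⟨rfl, rfl⟩ := ih₁ k₁
      obtain ⟨rfl, rfl⟩ := ih₂ k₂
      simp
  | ite_true he hx h ih =>
    cases h' with
    | ite_true ke kx k => obtain ⟨rfl, rfl⟩ := ih k; simp
    | ite_false ke k => simp_all
  | ite_false he h ih =>
    cases h' with
    | ite_true ke kx k => simp_all
    | ite_false ke k => obtain ⟨rfl, rfl⟩ := ih k; simp
  | while_true he hx h₁ h₂ ih₁ ih₂ =>
    cases h' with
    | while_true ke kx k₁ k₂ =>
      obtain ⟨rfl, rfl⟩ := ih₁ k₁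
      obtain ⟨rfl, rfl⟩ := ih₂ k₂
      simp
    | while_false ke => simp_all
  | while_false he =>
    cases h' with
    | while_true ke kx k₁ k₂ => simp_all
    | while_false ke => simp

/-! ### Data structures for decremental all-pairs shortest paths -/

/-- A data structure consists of four programs: the initialization and one program for each
operation. They communicate through the registers and the memory. -/
structure DataStructure where
  /-- builds the data structure for the initial graph -/
  init : Cmd
  /-- processes the deletion of an edge -/
  delete : Cmd
  /-- answers a distance query -/
  dist : Cmd
  /-- answers a shortest path query -/
  path : Cmd

/-- The operations on a dynamic graph with vertex set `{0, …, n - 1}`. -/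
inductive Op (n : ℕ) where
  | delete (u v : Fin n)
  | dist (u v : Fin n)
  | path (u v : Fin n)

/-- Every deletion in the sequence deletes an edge of the graph that is current at that time. -/
def Legal {n : ℕ} : Digraph (Fin n) → List (Op n) → Prop
  | _, [] => True
  | G, .delete u v :: ops => G.Adj u v ∧ Legal (deleteEdge G u v) ops
  | G, .dist _ _ :: ops => Legal G ops
  | G, .path _ _ :: ops => Legal G ops

open Classical in
/-- The input: register `0` holds `n`, array `0` holds the adjacency matrix of the initial graph in
row-major order, and all other registers and cells hold `0`. -/
noncomputable def inputState {n : ℕ} (G : Digraph (Fin n)) : State where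
  reg := fun r => if r = 0 then n else 0
  arr := fun a i =>
    if a = 0 ∧ ∃ u v : Fin n, i = (u : ℕ) * n + v ∧ G.Adj u v then 1 else 0

/-- The arguments `u`, `v` of an operation are passed in the registers `0` and `1`; everything
else is as the previous operation left it. -/
def State.call {n : ℕ} (s : State) (u v : Fin n) : State :=
  (s.setReg 0 u).setReg 1 v

/-- The distance from `u` to `v` as a machine word: the distance itself if it is finite (it is then
smaller than `n`), and `n` if there is no path from `u` to `v`. -/
noncomputable def distWord {n : ℕ} (G : Digraph (Fin n)) (u v : Fin n) : ℕ :=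
  if dist G u v = ⊤ then n else (dist G u v).toNat

/-- Array `1` holds the `n × n` distance matrix of `G` in row-major order. -/
def StoresDistances {n : ℕ} (G : Digraph (Fin n)) (s : State) : Prop :=
  ∀ u v : Fin n, s.arr 1 ((u : ℕ) * n + v) = distWord G u v

/-- Register `0` holds the distance from `u` to `v`, and if there is a path from `u` to `v` at all,
then array `2` holds, from cell `0` on, the consecutive vertices of a shortest one. -/
def ReportsPath {n : ℕ} (G : Digraph (Fin n)) (u v : Fin n) (s : State) : Prop :=
  s.reg 0 = distWord G u v ∧
    ∀ k : ℕ, dist G u v = k →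
      ∃ p : ℕ → Fin n, IsWalk G u v k p ∧ ∀ i ≤ k, s.arr 2 i = p i

/-- `Serves A W C G s ops T`: when the current graph is `G` and the machine (with word bound `W`)
is in state `s`, the data structure `A` processes the operations `ops` one after the other, each
of them halts, the distance matrix of the current graph is stored after each of them, every
distance query is answered correctly in at most `C` steps, every path query is answered correctly
in at most `C * (ℓ + 1)` steps where `ℓ` is the length of the reported path (in at most `C` steps if
there is no path), and the deletions take exactly `T` steps in total. -/
inductive Serves {n : ℕ} (A : DataStructure) (W C : ℕ) :
    Digraph (Fin n) → State → List (Op n) → ℕ → Prop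
  | nil (G : Digraph (Fin n)) (s : State) : Serves A W C G s [] 0
  | delete {G : Digraph (Fin n)} {s s' : State} {u v : Fin n} {ops : List (Op n)} {t T : ℕ}
      (run : Exec W A.delete (s.call u v) t s')
      (stores : StoresDistances (deleteEdge G u v) s')
      (rest : Serves A W C (deleteEdge G u v) s' ops T) :
      Serves A W C G s (.delete u v :: ops) (t + T)
  | dist {G : Digraph (Fin n)} {s s' : State} {u v : Fin n} {ops : List (Op n)} {t T : ℕ}
      (run : Exec W A.dist (s.call u v) t s')
      (time : t ≤ C)
      (answer : s'.reg 0 = distWord G u v)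
      (stores : StoresDistances G s')
      (rest : Serves A W C G s' ops T) :
      Serves A W C G s (.dist u v :: ops) T
  | path {G : Digraph (Fin n)} {s s' : State} {u v : Fin n} {ops : List (Op n)} {t T : ℕ}
      (run : Exec W A.path (s.call u v) t s')
      (time : t ≤ C * ((DecAPSP.dist G u v).toNat + 1))
      (answer : ReportsPath G u v s')
      (stores : StoresDistances G s')
      (rest : Serves A W C G s' ops T) :
      Serves A W C G s (.path u v :: ops) T

end DecAPSP

namespace DecAPSP

/-! ### Symbolic execution of programs with bounded memory -/

/-! For each pair the structure keeps a number `D u v` that never exceeds the distance and never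
decreases; the value `n` stands for infinity. A value is explained by an edge, or by a witness `w`
with `D u w + D w v ≤ D u v` and both summands positive. Induction on the value shows that explained
values are lengths of walks, hence distances (`Pairs.connects`). The work is to restore
explanations. Pairs that may have lost theirs wait in buckets indexed by their value, and the
buckets are emptied in increasing order. An unexplained pair of value `K` tries one candidate
witness after the other. When none is left, its value rises to `K + 1`, and the pairs registered as
depending on it are put into their buckets.

The cost is governed by the number of candidates. For `K` of order `2 ^ j * log n` with `j ≥ 1`, the
source `u` has a list of at most `n / 2 ^ j` candidates and a set of flagged vertices such that
every edge entering the flagged set starts at a candidate. A walk from `u` to a flagged `v`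
therefore passes through a candidate, so once all candidates have failed, the distance exceeds `K`
(`Lists.lt_connects`). If `v` is not flagged yet, a ball is grown backwards from `v` until its
boundary layer has at most `2 ^ (-j)` times its size. Until then the ball grows by a factor `1 + 2 ^
(-j)` per round, so the radius stays below `2 ^ j * size n < K` (`Search.radius_lt`) and `u` is not
reached. The layer joins the candidates and the ball is flagged (`Search.separate`). Each candidate
is charged to `2 ^ j` flagged vertices, which bounds the list, and deletions of edges cannot destroy
a separator. On level `0` all vertices are candidates.

A pair restarts its list whenever its value grows, so over all time it examines at most the sum over
`k` of `n / 2 ^ lev n k + 1` candidates. This is a harmonic sum of order `n * log² n`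
(`weight_zero_le_log`). A search costs `O(n)` per vertex of its ball, and each vertex is flagged at
most once per level and source, which gives `O(n³ log n)` in total. A potential collects these
amounts, together with the stack lengths and a reserve per edge for the scan over all values that a
deletion triggers; every step is paid by a drop of the potential (`Inv.runs_step`,
`Inv.runs_settle`, `Inv.runs_delete`). The initialization is the same process, started from the
values of the complete graph. A shortest path is reported by unfolding witnesses (`Inv.runs_path`).

The programs are verified with total correctness rules that track time. All stored numbers are below
`(n + 2) ^ 40` and no expression has more than `24` leaves, so words below `(n + 2) ^ 960` suffice.
-/

instance : Add Expr := ⟨.bin .add⟩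
instance : Sub Expr := ⟨.bin .sub⟩
instance : Mul Expr := ⟨.bin .mul⟩
instance : Div Expr := ⟨.bin .div⟩
instance (k : ℕ) : OfNat Expr k := ⟨.const k⟩

/-- The comparison `<` as an expression. -/
def Expr.less (e f : Expr) : Expr := .bin .lt e f

/-- The comparison `=` as an expression. -/
def Expr.same (e f : Expr) : Expr := .bin .eq e f

infixr:60 " ;; " => Cmd.seq

/-- The value of an expression on a machine without word bound. -/
def Expr.val (s : State) : Expr → ℕ
  | .const k => k
  | .reg r => s.reg r
  | .load a e => s.arr a (e.val s)
  | .bin op e₁ e₂ => op.apply (e₁.val s) (e₂.val s)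

/-- The number of leaves of an expression. -/
def Expr.weight : Expr → ℕ
  | .const _ => 1
  | .reg _ => 1
  | .load _ e => e.weight
  | .bin _ e₁ e₂ => e₁.weight + e₂.weight

/-- All constants are at most `2`. -/
def Expr.plain : Expr → Bool
  | .const k => k ≤ 2
  | .reg _ => true
  | .load _ e => e.plain
  | .bin _ e₁ e₂ => e₁.plain && e₂.plain

section simplification

variable (s : State) (e f : Expr) (a r k : ℕ)

@[simp] theorem Expr.val_add : (e + f).val s = e.val s + f.val s := rfl
@[simp] theorem Expr.val_sub : (e - f).val s = e.val s - f.val s := rfl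
@[simp] theorem Expr.val_mul : (e * f).val s = e.val s * f.val s := rfl
@[simp] theorem Expr.val_div : (e / f).val s = e.val s / f.val s := rfl
@[simp] theorem Expr.val_less :
    (e.less f).val s = if e.val s < f.val s then 1 else 0 := rfl
@[simp] theorem Expr.val_same :
    (e.same f).val s = if e.val s = f.val s then 1 else 0 := rfl
@[simp] theorem Expr.val_reg : (Expr.reg r).val s = s.reg r := rfl
@[simp] theorem Expr.val_load : (Expr.load a e).val s = s.arr a (e.val s) := rfl
@[simp] theorem Expr.val_zero : (0 : Expr).val s = 0 := rfl
@[simp] theorem Expr.val_one : (1 : Expr).val s = 1 := rfl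
@[simp] theorem Expr.val_two : (2 : Expr).val s = 2 := rfl

@[simp] theorem Expr.cost_add : (e + f).cost = e.cost + f.cost + 1 := rfl
@[simp] theorem Expr.cost_sub : (e - f).cost = e.cost + f.cost + 1 := rfl
@[simp] theorem Expr.cost_mul : (e * f).cost = e.cost + f.cost + 1 := rfl
@[simp] theorem Expr.cost_div : (e / f).cost = e.cost + f.cost + 1 := rfl
@[simp] theorem Expr.cost_less : (e.less f).cost = e.cost + f.cost + 1 := rfl
@[simp] theorem Expr.cost_same : (e.same f).cost = e.cost + f.cost + 1 := rfl
@[simp] theorem Expr.cost_reg : (Expr.reg r).cost = 1 := rfl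
@[simp] theorem Expr.cost_load : (Expr.load a e).cost = e.cost + 1 := rfl
@[simp] theorem Expr.cost_zero : (0 : Expr).cost = 1 := rfl
@[simp] theorem Expr.cost_one : (1 : Expr).cost = 1 := rfl
@[simp] theorem Expr.cost_two : (2 : Expr).cost = 1 := rfl

@[simp] theorem State.setReg_reg (x r' : ℕ) :
    (s.setReg r x).reg r' = if r' = r then x else s.reg r' := by
  simp [State.setReg, Function.update_apply]
@[simp] theorem State.setReg_arr (x : ℕ) : (s.setReg r x).arr = s.arr := rfl
@[simp] theorem State.setCell_reg (i x : ℕ) : (s.setCell a i x).reg = s.reg := rfl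
@[simp] theorem State.setCell_arr (i x a' : ℕ) :
    (s.setCell a i x).arr a' = if a' = a then Function.update (s.arr a) i x else s.arr a' := by
  by_cases h : a' = a
  · subst h; simp [State.setCell]
  · simp [State.setCell, h]

end simplification

/-- All registers and all memory cells hold numbers below `S`. -/
structure Bounded (S : ℕ) (s : State) : Prop where
  reg : ∀ r, s.reg r < S
  arr : ∀ a i, s.arr a i < S

/-- The word bound `W` leaves room for all expressions with at most `24` leaves over numbers
below `S`. -/
structure Fits (S W : ℕ) : Prop where
  two_lt : 2 < S
  pow_le : S ^ 24 ≤ W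

theorem Bounded.setReg {S : ℕ} {s : State} (h : Bounded S s) {r x : ℕ} (hx : x < S) :
    Bounded S (s.setReg r x) := by
  refine ⟨fun r' => ?_, h.arr⟩
  simp only [State.setReg_reg]
  split_ifs
  exacts [hx, h.reg _]

theorem Bounded.setCell {S : ℕ} {s : State} (h : Bounded S s) {a i x : ℕ} (hx : x < S) :
    Bounded S (s.setCell a i x) := by
  refine ⟨h.reg, fun a' i' => ?_⟩
  simp only [State.setCell_arr]
  split_ifs
  · rw [Function.update_apply]
    split_ifs
    exacts [hx, h.arr _ _]
  · exact h.arr _ _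

theorem Expr.weight_pos (e : Expr) : 1 ≤ e.weight := by
  induction e with
  | const | reg => exact le_rfl
  | load _ _ ih => exact ih
  | bin _ _ _ ih₁ ih₂ => exact ih₁.trans (Nat.le_add_right _ _)

theorem BinOp.apply_lt {S x y a b : ℕ} (hS : 2 < S) (ha : 1 ≤ a) (hb : 1 ≤ b)
    (hx : x < S ^ a) (hy : y < S ^ b) (op : BinOp) : op.apply x y < S ^ (a + b) := by
  have ha' : S ≤ S ^ a := by simpa using Nat.pow_le_pow_right (by omega : 0 < S) ha
  have hb' : S ≤ S ^ b := by simpa using Nat.pow_le_pow_right (by omega : 0 < S) hb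
  rw [pow_add]
  set A := S ^ a
  set B := S ^ b
  have hAB : A ≤ A * B := Nat.le_mul_of_pos_right _ (by omega)
  cases op with
  | add => show x + y < _; nlinarith
  | sub => show x - y < _; omega
  | mul => exact Nat.mul_lt_mul'' hx hy
  | div => exact lt_of_le_of_lt (Nat.div_le_self x y) (by omega)
  | lt => show (if x < y then 1 else 0) < _; split_ifs <;> omega
  | eq => show (if x = y then 1 else 0) < _; split_ifs <;> omega

/-- Every leaf is below `S`, and an operation yields a number below the product of the bounds of its
arguments. A load resets the bound to `S`, since the memory is bounded. Hence no intermediate result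
reaches the word bound. -/
theorem Expr.eval_eq {S W : ℕ} {s : State} (hS : 2 < S) (hs : Bounded S s) (e : Expr)
    (he : e.plain = true) (hW : S ^ e.weight ≤ W) :
    e.eval W s = some (e.val s) ∧ e.val s < S ^ e.weight := by
  induction e with
  | const k =>
    have hk : k ≤ 2 := by simpa [Expr.plain] using he
    simp only [Expr.weight, pow_one] at hW ⊢
    simp [Expr.eval, Expr.val, toWord]
    omega
  | reg r => simpa [Expr.eval, Expr.weight] using hs.reg r
  | load a e ih =>
    obtain ⟨h₁, h₂⟩ := ih he hW
    refine ⟨by simp [Expr.eval, h₁], lt_of_lt_of_le (hs.arr _ _) ?_⟩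
    simpa using Nat.pow_le_pow_right (by omega : 0 < S) (Expr.load a e).weight_pos
  | bin op e f ihe ihf =>
    simp only [Expr.plain, Bool.and_eq_true] at he
    simp only [Expr.weight] at hW ⊢
    obtain ⟨h₁, h₂⟩ := ihe he.1
      (le_trans (Nat.pow_le_pow_right (by omega) (Nat.le_add_right _ _)) hW)
    obtain ⟨h₃, h₄⟩ := ihf he.2
      (le_trans (Nat.pow_le_pow_right (by omega) (Nat.le_add_left _ _)) hW)
    have h := BinOp.apply_lt hS e.weight_pos f.weight_pos h₂ h₄ op
    refine ⟨?_, h⟩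
    simp [Expr.eval, h₁, h₃, toWord, Expr.val, lt_of_lt_of_le h hW]

/-- The expression can be evaluated on every machine with `Fits S W`. -/
def Expr.small (e : Expr) : Bool := e.plain && e.weight ≤ 24

theorem Expr.eval_small {S W : ℕ} {s : State} (hF : Fits S W) (hs : Bounded S s) {e : Expr}
    (he : e.small = true) : e.eval W s = some (e.val s) := by
  simp only [Expr.small, Bool.and_eq_true, decide_eq_true_eq] at he
  exact (e.eval_eq hF.two_lt hs he.1
    ((Nat.pow_le_pow_right (by have := hF.two_lt; omega) he.2).trans hF.pow_le)).1

/-- The program halts, and the number of steps and the final state satisfy `Q`. -/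
def Runs (W : ℕ) (c : Cmd) (s : State) (Q : ℕ → State → Prop) : Prop :=
  ∃ t s', Exec W c s t s' ∧ Q t s'

/-! ### Total correctness rules with running times. -/

section rules

variable {S W : ℕ} {s : State} {Q : ℕ → State → Prop}

theorem Runs.mono {c : Cmd} {Q' : ℕ → State → Prop} (h : Runs W c s Q)
    (hQ : ∀ t s', Q t s' → Q' t s') : Runs W c s Q' := by
  obtain ⟨t, s', h₁, h₂⟩ := h
  exact ⟨t, s', h₁, hQ _ _ h₂⟩

theorem Runs.seq {c₁ c₂ : Cmd}
    (h : Runs W c₁ s fun t₁ s₁ => Runs W c₂ s₁ fun t₂ s₂ => Q (t₁ + t₂) s₂) :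
    Runs W (c₁ ;; c₂) s Q := by
  obtain ⟨t₁, s₁, h₁, t₂, s₂, h₂, hQ⟩ := h
  exact ⟨_, _, .seq h₁ h₂, hQ⟩

theorem Runs.assign (hF : Fits S W) (hs : Bounded S s) {r : ℕ} {e : Expr} {x : ℕ}
    (he : e.small = true) (hv : e.val s = x) (hx : x < S)
    (h : Bounded S (s.setReg r x) → Q (e.cost + 1) (s.setReg r x)) :
    Runs W (.assign r e) s Q :=
  ⟨_, _, .assign (hv ▸ Expr.eval_small hF hs he), h (hs.setReg hx)⟩

theorem Runs.store (hF : Fits S W) (hs : Bounded S s) {a : ℕ} {e f : Expr} {i x : ℕ}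
    (he : e.small = true) (hf : f.small = true) (hi : e.val s = i) (hv : f.val s = x) (hx : x < S)
    (h : Bounded S (s.setCell a i x) → Q (e.cost + f.cost + 1) (s.setCell a i x)) :
    Runs W (.store a e f) s Q :=
  ⟨_, _, .store (hi ▸ Expr.eval_small hF hs he) (hv ▸ Expr.eval_small hF hs hf),
    h (hs.setCell hx)⟩

theorem Runs.ite (hF : Fits S W) (hs : Bounded S s) {e : Expr} {c₁ c₂ : Cmd} (P : Prop)
    (he : e.small = true) (hP : e.val s ≠ 0 ↔ P)
    (h₁ : P → Runs W c₁ s fun t s' => Q (e.cost + 1 + t) s')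
    (h₂ : ¬ P → Runs W c₂ s fun t s' => Q (e.cost + 1 + t) s') :
    Runs W (.ite e c₁ c₂) s Q := by
  have hv := Expr.eval_small hF hs he
  by_cases h : e.val s = 0
  · obtain ⟨t, s', h, hQ⟩ := h₂ (fun hp => hP.2 hp h)
    rw [‹e.val s = 0›] at hv
    exact ⟨_, _, .ite_false hv h, hQ⟩
  · obtain ⟨t, s', h', hQ⟩ := h₁ (hP.1 h)
    exact ⟨_, _, .ite_true hv h h', hQ⟩

/-- The invariant takes the elapsed time as an argument, so amortized time bounds are ordinary
invariants. Termination comes separately from the measure `μ`. -/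
theorem Runs.while (hF : Fits S W) {e : Expr} {c : Cmd} (he : e.small = true)
    (I : ℕ → State → Prop) (μ : State → ℕ) (hI : I 0 s)
    (step : ∀ τ s, I τ s → Bounded S s ∧ (e.val s = 0 → Q (τ + (e.cost + 1)) s) ∧
      (e.val s ≠ 0 → Runs W c s fun t s' => I (τ + (e.cost + 1) + t) s' ∧ μ s' < μ s)) :
    Runs W (.while e c) s Q := by
  suffices H : ∀ N τ s, μ s ≤ N → I τ s → Runs W (.while e c) s fun t s' => Q (τ + t) s' by
    simpa using H _ 0 s le_rfl hI
  intro N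
  induction N with
  | zero =>
    intro τ s hN hI
    obtain ⟨hs, h₀, h₁⟩ := step τ s hI
    have hv := Expr.eval_small hF hs he
    by_cases h : e.val s = 0
    · rw [h] at hv
      exact ⟨_, _, .while_false hv, h₀ h⟩
    · obtain ⟨t, s', _, _, h⟩ := h₁ h
      omega
  | succ N ih =>
    intro τ s hN hI
    obtain ⟨hs, h₀, h₁⟩ := step τ s hI
    have hv := Expr.eval_small hF hs he
    by_cases h : e.val s = 0
    · rw [h] at hv
      exact ⟨_, _, .while_false hv, h₀ h⟩
    · obtain ⟨t, s', hc, hI', hμ⟩ := h₁ h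
      obtain ⟨t', s'', hc', hQ⟩ := ih _ s' (by omega) hI'
      refine ⟨_, _, .while_true hv h hc hc', ?_⟩
      simpa only [add_assoc] using hQ

end rules

end DecAPSP

namespace DecAPSP

/-! ### Walks, stacks in memory, levels -/

/-- There is a walk with `k` edges from `u` to `v`. -/
def Connects (E : ℕ → ℕ → Prop) : ℕ → ℕ → ℕ → Prop
  | 0, u, v => u = v
  | k + 1, u, v => ∃ w, E u w ∧ Connects E k w v

theorem Connects.trans {E : ℕ → ℕ → Prop} {k l u v w : ℕ} (h : Connects E k u v)
    (h' : Connects E l v w) : Connects E (k + l) u w := by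
  induction k generalizing u with
  | zero => cases h; simpa using h'
  | succ k ih =>
    obtain ⟨x, hx, h⟩ := h
    rw [Nat.add_right_comm]
    exact ⟨x, hx, ih h⟩

theorem Connects.mono {E E' : ℕ → ℕ → Prop} (hE : ∀ x y, E x y → E' x y) {k u v : ℕ}
    (h : Connects E k u v) : Connects E' k u v := by
  induction k generalizing u with
  | zero => exact h
  | succ k ih =>
    obtain ⟨x, hx, h⟩ := h
    exact ⟨x, hE _ _ hx, ih h⟩

/-- A walk from outside a set to inside it crosses its boundary. -/
theorem Connects.exists_crossing {E : ℕ → ℕ → Prop} {P : ℕ → Prop} {k u v : ℕ}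
    (h : Connects E k u v) (hu : ¬ P u) (hv : P v) :
    ∃ i j x y, i + j = k ∧ Connects E i u x ∧ Connects E j x v ∧ E x y ∧ ¬ P x ∧ P y := by
  induction k generalizing u with
  | zero => cases h; exact absurd hv hu
  | succ k ih =>
    obtain ⟨w, hw, h⟩ := h
    by_cases hPw : P w
    · exact ⟨0, k + 1, u, w, by omega, rfl, ⟨w, hw, h⟩, hw, hu, hPw⟩
    · obtain ⟨i, j, x, y, hij, h₁, h₂, h₃⟩ := ih h hPw
      exact ⟨i + 1, j, x, y, by omega, ⟨w, hw, h₁⟩, h₂, h₃⟩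

theorem code_div {n u v : ℕ} (hv : v < n) : (u * n + v) / n = u := by
  rw [Nat.mul_comm, Nat.mul_add_div (by omega), Nat.div_eq_of_lt hv, Nat.add_zero]

theorem code_mod {n u v : ℕ} (hv : v < n) : (u * n + v) % n = v := by
  rw [Nat.mul_add_mod', Nat.mod_eq_of_lt hv]

theorem code_inj {n u v a b : ℕ} (hv : v < n) (hb : b < n) :
    u * n + v = a * n + b ↔ u = a ∧ v = b := by
  refine ⟨fun h => ?_, fun h => by rw [h.1, h.2]⟩
  have h₁ : u = a := by rw [← code_div (u := u) hv, h, code_div hb]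
  subst h₁
  exact ⟨rfl, by omega⟩

theorem code_lt {n l u v : ℕ} (hu : u < l) (hv : v < n) : u * n + v < l * n := by
  calc u * n + v < u * n + n := by omega
    _ = (u + 1) * n := by ring
    _ ≤ l * n := Nat.mul_le_mul_right _ hu

theorem exists_code {n l c : ℕ} (hc : c < l * n) : ∃ u v, u < l ∧ v < n ∧ c = u * n + v := by
  have hn : 0 < n := Nat.pos_of_ne_zero (by rintro rfl; simp at hc)
  exact ⟨c / n, c % n, Nat.div_lt_of_lt_mul (by rwa [Nat.mul_comm] at hc), Nat.mod_lt _ hn,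
    (Nat.div_add_mod' c n).symm⟩

/-- `e` is on the stack with number `x`, where stacks are stored with the given stride. -/
def OnStack (items len : ℕ → ℕ) (stride x e : ℕ) : Prop :=
  ∃ i < len x, items (x * stride + i) = e

/-- The length bounds guarantee that the written cell belongs to no other stack. -/
theorem onStack_push {items len : ℕ → ℕ} {stride x e x' e' : ℕ} (hx : len x < stride)
    (hx' : len x' ≤ stride) :
    OnStack (Function.update items (x * stride + len x) e) (Function.update len x (len x + 1))
      stride x' e' ↔ OnStack items len stride x' e' ∨ x' = x ∧ e' = e := by
  unfold OnStack
  constructor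
  · rintro ⟨i, hi, h⟩
    by_cases hxx : x' = x
    · subst hxx
      simp only [Function.update_self] at hi
      rcases Nat.lt_succ_iff_lt_or_eq.1 hi with hi | rfl
      · rw [Function.update_of_ne (by omega)] at h
        exact .inl ⟨i, hi, h⟩
      · rw [Function.update_self] at h
        exact .inr ⟨rfl, h.symm⟩
    · rw [Function.update_of_ne hxx] at hi
      rw [Function.update_of_ne] at h
      · exact .inl ⟨i, hi, h⟩
      · rw [Ne, code_inj (by omega) hx]
        exact fun h => hxx h.1
  · rintro (⟨i, hi, h⟩ | ⟨rfl, rfl⟩)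
    · refine ⟨i, ?_, ?_⟩
      · rw [Function.update_apply]
        split_ifs with h
        · subst h; omega
        · exact hi
      · rwa [Function.update_of_ne]
        rw [Ne, code_inj (by omega) hx]
        rintro ⟨rfl, rfl⟩
        omega
    · exact ⟨len x', by simp, by simp⟩

theorem onStack_pop {items len : ℕ → ℕ} {stride x x' e' : ℕ}
    (h : OnStack items len stride x' e') :
    OnStack items (Function.update len x (len x - 1)) stride x' e' ∨
      x' = x ∧ e' = items (x * stride + (len x - 1)) := by
  obtain ⟨i, hi, rfl⟩ := h
  by_cases hx : x' = x
  · subst hx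
    by_cases hi' : i < len x' - 1
    · exact .inl ⟨i, by simpa using hi', rfl⟩
    · exact .inr ⟨rfl, by congr; omega⟩
  · exact .inl ⟨i, by rwa [Function.update_of_ne hx], rfl⟩

theorem OnStack.of_pop {items len : ℕ → ℕ} {stride x x' e' : ℕ}
    (h : OnStack items (Function.update len x (len x - 1)) stride x' e') :
    OnStack items len stride x' e' := by
  obtain ⟨i, hi, rfl⟩ := h
  refine ⟨i, ?_, rfl⟩
  rw [Function.update_apply] at hi
  split_ifs at hi with h
  · subst h; omega
  · exact hi

/-- The level of the distance `k`. -/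
def lev (n k : ℕ) : ℕ := Nat.size ((k - 1) / (Nat.size n * 2))

theorem lev_le {n k : ℕ} (hk : k ≤ n) : lev n k ≤ Nat.size n :=
  Nat.size_le_size ((Nat.div_le_self _ _).trans (by omega))

/-- This leaves room for a ball: the radius at which growth must have stopped is smaller than the
distance, so the ball misses the source. -/
theorem lt_of_one_le_lev {n k : ℕ} (h : 1 ≤ lev n k) : 2 ^ lev n k * Nat.size n < k := by
  obtain ⟨j, hj⟩ : ∃ j, lev n k = j + 1 := ⟨lev n k - 1, by omega⟩
  have h₁ : 2 ^ j ≤ (k - 1) / (Nat.size n * 2) := Nat.lt_size.1 (by unfold lev at hj; omega)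
  have h₂ := (Nat.mul_le_mul_right _ h₁).trans (Nat.div_mul_le_self (k - 1) (Nat.size n * 2))
  rw [hj, pow_succ]
  have hk : 1 ≤ k := by
    by_contra hk
    have : k = 0 := by omega
    subst this
    simp [lev] at h
  have : 2 ^ j * 2 * Nat.size n = 2 ^ j * (Nat.size n * 2) := by ring
  omega

/-- The converse estimate, by which a list of length `n / 2 ^ lev n k` has only `O(n log n / k)`
entries. -/
theorem le_lev {n k : ℕ} (hn : 1 ≤ n) : k ≤ 2 ^ lev n k * (Nat.size n * 2) := by
  have h₀ : 0 < Nat.size n := Nat.size_pos.2 hn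
  have h : (k - 1) / (Nat.size n * 2) < 2 ^ lev n k := Nat.lt_size_self _
  rw [Nat.div_lt_iff_lt_mul (by omega)] at h
  omega

/-! ### The invariants of the data structure -/

/-- The distance between the cells of consecutive stacks. -/
def stride (n : ℕ) : ℕ := (n + 2) ^ 32

/-- The arrays of the data structure: adjacency matrix, distances, current witnesses, positions in
the candidate lists, stacks of dependent pairs, buckets of pairs to be examined, candidate lists,
and flags of the vertices that were separated from a source. -/
@[ext] structure Mem where
  adj : ℕ → ℕ
  D : ℕ → ℕ
  wit : ℕ → ℕ
  ptr : ℕ → ℕ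
  dep : ℕ → ℕ
  dlen : ℕ → ℕ
  bk : ℕ → ℕ
  blen : ℕ → ℕ
  lst : ℕ → ℕ
  llen : ℕ → ℕ
  rem : ℕ → ℕ

namespace Mem

variable (m : Mem) (n : ℕ)

/-- The edges of the stored graph. -/
def E (u v : ℕ) : Prop := u < n ∧ v < n ∧ m.adj (u * n + v) ≠ 0

/-- The pair with code `e` is a dependent of the pair with code `c`. -/
def Dep (c e : ℕ) : Prop := OnStack m.dep m.dlen (stride n) c e

/-- The pair with code `e` is in the bucket `k`. -/
def Bk (k e : ℕ) : Prop := OnStack m.bk m.blen (stride n) k e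

/-- `w` is on the candidate list with number `x`. -/
def Cand (x w : ℕ) : Prop := OnStack m.lst m.llen n x w

/-- `w` explains the value stored for `(u, v)`. -/
def Good (u v w : ℕ) : Prop :=
  0 < m.D (u * n + w) ∧ 0 < m.D (w * n + v) ∧
    m.D (u * n + w) + m.D (w * n + v) ≤ m.D (u * n + v)

/-- The value stored for `(u, v)` is explained by an edge or the current witness. -/
def Valid (u v : ℕ) : Prop := m.adj (u * n + v) ≠ 0 ∨ m.Good n u v (m.wit (u * n + v))

end Mem

/-- The invariants of the candidate lists. -/
structure Lists (n : ℕ) (m : Mem) : Prop where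
  lt : ∀ j ≤ Nat.size n, ∀ u < n, ∀ w, m.Cand n (j * n + u) w → w < n
  card : ∀ j ≤ Nat.size n, ∀ u < n, m.llen (j * n + u) * 2 ^ j ≤ n
  base : ∀ u < n, ∀ w < n, m.Cand n u w
  base_rem : ∀ u < n, ∀ v < n, m.rem (u * n + v) ≠ 0
  size : ∀ j, 1 ≤ j → j ≤ Nat.size n → ∀ u < n, m.llen (j * n + u) * 2 ^ j ≤
    ((Finset.range n).filter fun v => m.rem ((j * n + u) * n + v) ≠ 0).card
  self_rem : ∀ j, 1 ≤ j → j ≤ Nat.size n → ∀ u < n, m.rem ((j * n + u) * n + u) = 0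
  self_cand : ∀ j, 1 ≤ j → j ≤ Nat.size n → ∀ u < n, ¬ m.Cand n (j * n + u) u
  sep : ∀ j, 1 ≤ j → j ≤ Nat.size n → ∀ u < n, ∀ x y, m.E n x y →
    m.rem ((j * n + u) * n + x) = 0 → m.rem ((j * n + u) * n + y) ≠ 0 → m.Cand n (j * n + u) x

/-- The invariants of the pairs, when the pairs with stored distance less than `K` are settled. -/
structure Pairs (n K : ℕ) (m : Mem) : Prop where
  lower : ∀ k, ∀ u < n, ∀ v < n, Connects (m.E n) k u v → m.D (u * n + v) ≤ k
  diag : ∀ u < n, m.D (u * n + u) = 0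
  pos : ∀ u < n, ∀ v < n, u ≠ v → 1 ≤ m.D (u * n + v)
  le : ∀ u < n, ∀ v < n, m.D (u * n + v) ≤ n
  wit_lt : ∀ u < n, ∀ v < n, m.wit (u * n + v) < n
  valid : ∀ u < n, ∀ v < n, u ≠ v → m.D (u * n + v) < n →
    m.Valid n u v ∨ K ≤ m.D (u * n + v) ∧ m.Bk n (m.D (u * n + v)) (u * n + v)
  dep : ∀ u < n, ∀ v < n, ∀ w, m.wit (u * n + v) = w → w ≠ u → w ≠ v →
    m.D (u * n + v) < m.D (u * n + w) + m.D (w * n + v) ∨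
    m.D (u * n + v) = m.D (u * n + w) + m.D (w * n + v) ∧
      m.Dep n (u * n + w) (u * n + v) ∧ m.Dep n (w * n + v) (u * n + v)
  ptr_le : ∀ u < n, ∀ v < n, m.ptr (u * n + v) ≤ m.llen (lev n (m.D (u * n + v)) * n + u)
  scanned : ∀ u < n, ∀ v < n, ∀ i < m.ptr (u * n + v), ∀ w,
    m.lst ((lev n (m.D (u * n + v)) * n + u) * n + i) = w →
      w = m.wit (u * n + v) ∨ ¬ m.Good n u v w
  bk_lt : ∀ k e, m.Bk n k e → e < n * n
  dep_lt : ∀ c e, m.Dep n c e → e < n * n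

/-! ### Correctness of the settled values and preservation of the invariants. -/

variable {n K : ℕ} {m : Mem}

/-- Settled distances are correct. -/
theorem Pairs.connects (h : Pairs n K m) {u v : ℕ} (hu : u < n) (hv : v < n)
    (hK : m.D (u * n + v) < K) (hn : m.D (u * n + v) < n) :
    Connects (m.E n) (m.D (u * n + v)) u v := by
  obtain ⟨k, hk⟩ : ∃ k, m.D (u * n + v) = k := ⟨_, rfl⟩
  induction k using Nat.strong_induction_on generalizing u v with
  | _ k ih =>
    by_cases huv : u = v
    · subst huv
      rw [h.diag u hu]
      rfl
    rcases h.valid u hu v hv huv hn with hval | hb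
    · rcases hval with ha | ⟨h₁, h₂, h₃⟩
      · have hc : Connects (m.E n) 1 u v := ⟨v, ⟨hu, hv, ha⟩, rfl⟩
        have := h.lower _ u hu v hv hc
        have := h.pos u hu v hv huv
        rwa [show m.D (u * n + v) = 1 by omega]
      · have hw := h.wit_lt u hu v hv
        set w := m.wit (u * n + v)
        -- Both parts are positive, so both are smaller than the value and induction applies. The
        -- concatenated walk then turns the inequality in `Good` into an equality through `lower`.
        have hc := (ih (m.D (u * n + w)) (by omega) hu hw (by omega) (by omega) rfl).trans
          (ih (m.D (w * n + v)) (by omega) hw hv (by omega) (by omega) rfl)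
        have := h.lower _ u hu v hv hc
        rwa [show m.D (u * n + v) = m.D (u * n + w) + m.D (w * n + v) by omega]
    · omega

/-- This justifies raising a value. A walk with exactly `K` edges would enter the flagged set
through a candidate different from `u` and `v`. The lower bounds on its two halves make that
candidate good, although every scanned candidate is bad. -/
theorem Lists.lt_connects (hL : Lists n m) (h : Pairs n K m) {u v : ℕ} (hu : u < n) (hv : v < n)
    (hK : m.D (u * n + v) = K) (hK₁ : 1 ≤ K) (hn : K ≤ n) (hval : ¬ m.Valid n u v)
    (hptr : m.llen (lev n K * n + u) ≤ m.ptr (u * n + v))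
    (hrem : m.rem ((lev n K * n + u) * n + v) ≠ 0) {k : ℕ} (hk : Connects (m.E n) k u v) :
    K < k := by
  have hle := h.lower _ u hu v hv hk
  by_contra hlt
  have hkK : k = K := by omega
  have key : ∀ w i j, m.Cand n (lev n K * n + u) w → w < n → i + j = K → Connects (m.E n) i u w →
      Connects (m.E n) j w v → w ≠ u → w ≠ v → False := by
    intro w i j hw hwn hij h₁ h₂ hwu hwv
    have hg : m.Good n u v w := by
      have := h.lower _ u hu w hwn h₁
      have := h.lower _ w hwn v hv h₂
      exact ⟨h.pos u hu w hwn hwu.symm, h.pos w hwn v hv hwv, by omega⟩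
    obtain ⟨t, ht, htw⟩ := hw
    have := h.scanned u hu v hv t (lt_of_lt_of_le ht hptr) w (by rw [hK, htw])
    rcases this with rfl | hng
    · exact hval (.inr hg)
    · exact hng hg
  by_cases hj : 1 ≤ lev n K
  · obtain ⟨i, j, x, y, hij, h₁, h₂, h₃, h₄, h₅⟩ := hk.exists_crossing
      (P := fun x => m.rem ((lev n K * n + u) * n + x) ≠ 0)
      (by simpa using hL.self_rem _ hj (lev_le hn) u hu) hrem
    have hx := hL.sep _ hj (lev_le hn) u hu x y h₃ (by simpa using h₄) h₅
    refine key x i j hx h₃.1 (by omega) h₁ h₂ ?_ ?_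
    · rintro rfl
      exact hL.self_cand _ hj (lev_le hn) x hu hx
    · rintro rfl
      exact h₄ hrem
  -- On level `0` every vertex is a candidate, so the second vertex of the walk serves as the
  -- crossing point.
  · have hj0 : lev n K = 0 := by omega
    obtain ⟨k', rfl⟩ : ∃ k', k = k' + 1 := ⟨k - 1, by omega⟩
    obtain ⟨w, hw, hc⟩ := hk
    have hwu : w ≠ u := by
      rintro rfl
      have := h.lower _ w hu v hv hc
      omega
    have hwv : w ≠ v := by
      rintro rfl
      exact hval (.inl hw.2.2)
    refine key w 1 k' ?_ hw.2.1 (by omega) ⟨w, hw, rfl⟩ hc hwu hwv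
    simpa [hj0] using hL.base u hu w hw.2.1

theorem Pairs.succ (h : Pairs n K m) (hb : m.blen K = 0) : Pairs n (K + 1) m := by
  refine { h with valid := fun u hu v hv huv hn => ?_ }
  rcases h.valid u hu v hv huv hn with h₁ | ⟨h₁, h₂⟩
  · exact .inl h₁
  · refine .inr ⟨?_, h₂⟩
    rcases h₁.lt_or_eq with h₃ | h₃
    · exact h₃
    · obtain ⟨i, hi, _⟩ := h₂
      rw [← h₃, hb] at hi
      omega

/-- Buckets may contain outdated entries, whose pair has meanwhile another value; these are dropped
without further examination. -/
theorem Pairs.pop (h : Pairs n K m) (hc : ∀ u < n, ∀ v < n,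
    m.bk (K * stride n + (m.blen K - 1)) = u * n + v → m.D (u * n + v) = K → m.Valid n u v) :
    Pairs n K { m with blen := Function.update m.blen K (m.blen K - 1) } := by
  refine { h with
    valid := fun u hu v hv huv hn => ?_
    bk_lt := fun k e he => h.bk_lt k e he.of_pop }
  rcases h.valid u hu v hv huv hn with h₁ | ⟨h₁, h₂⟩
  · exact .inl h₁
  · rcases onStack_pop (x := K) h₂ with h₃ | ⟨h₃, h₄⟩
    · exact .inr ⟨h₁, h₃⟩
    · exact .inl (hc u hu v hv h₄.symm h₃)

/-- The candidate becomes the witness before it is tested, and the pair stays in its bucket, so the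
next step performs the test. The dependence is registered even if the candidate turns out to be bad;
superfluous registrations only cost time. -/
theorem Pairs.advance (h : Pairs n K m) {u v w : ℕ} (hu : u < n) (hv : v < n)
    (hw : w < n) (hKn : K < n) (hK : m.D (u * n + v) = K) (hval : ¬ m.Valid n u v)
    (hptr : m.ptr (u * n + v) < m.llen (lev n K * n + u))
    (hwl : m.lst ((lev n K * n + u) * n + m.ptr (u * n + v)) = w) {dep' dlen' : ℕ → ℕ}
    (hdep : ∀ c e, OnStack dep' dlen' (stride n) c e ↔
      m.Dep n c e ∨ (c = u * n + w ∨ c = w * n + v) ∧ e = u * n + v)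
    (hb : m.Bk n K (u * n + v)) :
    Pairs n K { m with
      wit := Function.update m.wit (u * n + v) w
      ptr := Function.update m.ptr (u * n + v) (m.ptr (u * n + v) + 1)
      dep := dep'
      dlen := dlen' } := by
  refine { lower := h.lower, diag := h.diag, pos := h.pos, le := h.le, bk_lt := h.bk_lt, wit_lt :=
           ?_, valid := ?_, dep := ?_, ptr_le := ?_, scanned := ?_, dep_lt := ?_ }
  · intro a ha b hb
    simp only [Function.update_apply]
    split_ifs
    exacts [hw, h.wit_lt a ha b hb]
  · intro a ha b hb' hab hn
    by_cases hc : a * n + b = u * n + v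
    · dsimp only at hn ⊢
      rw [hc, hK]
      exact .inr ⟨le_rfl, hb⟩
    · simpa [Mem.Valid, Mem.Good, Mem.Bk, Function.update_of_ne hc] using h.valid a ha b hb' hab hn
  · intro a ha b hb' x hx hxa hxb
    dsimp only [Mem.Dep] at hx ⊢
    simp only [hdep]
    by_cases hc : a * n + b = u * n + v
    · obtain ⟨rfl, rfl⟩ := (code_inj hb' hv).1 hc
      rw [Function.update_self] at hx
      subst hx
      by_cases hlt : m.D (a * n + b) < m.D (a * n + w) + m.D (w * n + b)
      · exact .inl hlt
      -- Both parts are positive with sum at most `K`, hence less than `K` and settled. Their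
      -- concatenated walk excludes a sum below the stored value.
      · refine .inr ⟨?_, by simp, by simp⟩
        have h₁ := h.pos a ha w hw hxa.symm
        have h₂ := h.pos w hw b hb' hxb
        have hc := (h.connects ha hw (by omega) (by omega)).trans
          (h.connects hw hb' (by omega) (by omega))
        have := h.lower _ a ha b hb' hc
        omega
    · rw [Function.update_of_ne hc] at hx
      rcases h.dep a ha b hb' x hx hxa hxb with h₁ | ⟨h₁, h₂, h₃⟩
      · exact .inl h₁
      · exact .inr ⟨h₁, .inl h₂, .inl h₃⟩
  · intro a ha b hb'
    dsimp only
    by_cases hc : a * n + b = u * n + v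
    · obtain ⟨rfl, rfl⟩ := (code_inj hb' hv).1 hc
      rw [Function.update_self, hK]
      exact hptr
    · rw [Function.update_of_ne hc]
      exact h.ptr_le a ha b hb'
  · intro a ha b hb' i hi x hx
    dsimp only [Mem.Good] at hi hx ⊢
    by_cases hc : a * n + b = u * n + v
    · obtain ⟨rfl, rfl⟩ := (code_inj hb' hv).1 hc
      rw [Function.update_self] at hi ⊢
      rcases Nat.lt_succ_iff_lt_or_eq.1 hi with hi | rfl
      · refine .inr ?_
        -- The old witness loses its exemption from being bad, but it is bad because the pair is not
        -- valid.
        rcases h.scanned a ha b hb' i hi x hx with rfl | h₁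
        · exact fun hg => hval (.inr hg)
        · exact h₁
      · rw [hK, hwl] at hx
        exact .inl hx.symm
    · rw [Function.update_of_ne hc] at hi ⊢
      exact h.scanned a ha b hb' i hi x hx
  · intro c e hce
    rcases (hdep c e).1 hce with h₁ | ⟨_, rfl⟩
    · exact h.dep_lt c e h₁
    · exact code_lt hu hv

/-- Raising one value keeps all lower bounds by `Lists.lt_connects`, and bad candidates of other
pairs stay bad because values only grow. Only pairs whose witness uses `(u, v)` can lose their
explanation, and these are registered as dependents. The witness is reset to `u`, which means none:
it is never good because `D u u = 0`. -/
theorem Pairs.bump (h : Pairs n K m) (hL : Lists n m) {u v : ℕ} (hu : u < n) (hv : v < n)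
    (hKn : K < n) (hK₁ : 1 ≤ K) (hK : m.D (u * n + v) = K) (hval : ¬ m.Valid n u v)
    (hptr : m.llen (lev n K * n + u) ≤ m.ptr (u * n + v))
    (hrem : m.rem ((lev n K * n + u) * n + v) ≠ 0) {bk' blen' dep' dlen' : ℕ → ℕ}
    (hbk : ∀ k e, m.Bk n k e → OnStack bk' blen' (stride n) k e)
    (hself : OnStack bk' blen' (stride n) (K + 1) (u * n + v))
    (hflush : ∀ e, e ≠ u * n + v → m.Dep n (u * n + v) e →
      OnStack bk' blen' (stride n) (m.D e) e)
    (hbk_lt : ∀ k e, OnStack bk' blen' (stride n) k e → e < n * n)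
    (hdep : ∀ c e, c ≠ u * n + v → m.Dep n c e → OnStack dep' dlen' (stride n) c e)
    (hdep_lt : ∀ c e, OnStack dep' dlen' (stride n) c e → e < n * n) :
    Pairs n K { m with
      D := Function.update m.D (u * n + v) (K + 1)
      wit := Function.update m.wit (u * n + v) u
      ptr := Function.update m.ptr (u * n + v) 0
      bk := bk'
      blen := blen'
      dep := dep'
      dlen := dlen' } := by
  have huv : u ≠ v := by
    rintro rfl
    rw [h.diag u hu] at hK
    omega
  have hmono : ∀ c, m.D c ≤ Function.update m.D (u * n + v) (K + 1) c := by
    intro c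
    by_cases hc : c = u * n + v
    · subst hc; simp [hK]
    · simp [hc]
  refine { bk_lt := hbk_lt, dep_lt := hdep_lt, lower := ?_, diag := ?_, pos := ?_, le := ?_, wit_lt
           := ?_, valid := ?_, dep := ?_, ptr_le := ?_, scanned := ?_ }
  · intro k a ha b hb hc
    dsimp only
    by_cases hcode : a * n + b = u * n + v
    · obtain ⟨rfl, rfl⟩ := (code_inj hb hv).1 hcode
      rw [Function.update_self]
      exact hL.lt_connects h hu hv hK hK₁ hKn.le hval hptr hrem hc
    · rw [Function.update_of_ne hcode]
      exact h.lower k a ha b hb hc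
  · intro a ha
    dsimp only
    rw [Function.update_of_ne]
    · exact h.diag a ha
    · rw [Ne, code_inj ha hv]
      rintro ⟨rfl, rfl⟩
      exact huv rfl
  · intro a ha b hb hab
    exact (h.pos a ha b hb hab).trans (hmono _)
  · intro a ha b hb
    simp only [Function.update_apply]
    split_ifs
    exacts [hKn, h.le a ha b hb]
  · intro a ha b hb
    simp only [Function.update_apply]
    split_ifs
    exacts [hu, h.wit_lt a ha b hb]
  · intro a ha b hb hab hn
    dsimp only [Mem.Valid, Mem.Good, Mem.Bk] at hn ⊢
    by_cases hcode : a * n + b = u * n + v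
    · obtain ⟨rfl, rfl⟩ := (code_inj hb hv).1 hcode
      simp only [Function.update_self]
      exact .inr ⟨le_rfl.trans (Nat.le_succ K), hself⟩
    · simp only [Function.update_of_ne hcode] at hn ⊢
      rcases h.valid a ha b hb hab hn with hv' | ⟨h₁, h₂⟩
      · rcases hv' with h₁ | h₁
        · exact .inl (.inl h₁)
        · have hw := h.wit_lt a ha b hb
          obtain ⟨w, hwe⟩ : ∃ w, m.wit (a * n + b) = w := ⟨_, rfl⟩
          rw [hwe] at h₁ hw ⊢
          have hwa : w ≠ a := by
            rintro rfl
            have := h₁.1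
            rw [h.diag w hw] at this
            omega
          have hwb : w ≠ b := by
            rintro rfl
            have := h₁.2.1
            rw [h.diag w hw] at this
            omega
          have hsum := h₁.2.2
          -- A good witness has sum at most the value, which excludes the strict alternative of
          -- `dep`. So the pair is a registered dependent with sum equal to its value, and that
          -- value is at least its part `K`.
          by_cases hx : a * n + w = u * n + v ∨ w * n + b = u * n + v
          · refine .inr ?_
            rcases h.dep a ha b hb w hwe hwa hwb with h₂ | ⟨h₂, h₃, h₄⟩
            · omega
            · have hd : m.Dep n (u * n + v) (a * n + b) := by
                rcases hx with hx | hx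
                · rwa [← hx]
                · rwa [← hx]
              refine ⟨?_, hflush _ hcode hd⟩
              rcases hx with hx | hx <;> rw [hx] at h₂ <;> omega
          · rw [not_or] at hx
            rw [Function.update_of_ne hx.1, Function.update_of_ne hx.2]
            exact .inl (.inr h₁)
      · exact .inr ⟨h₁, hbk _ _ h₂⟩
  · intro a ha b hb w hw hwa hwb
    dsimp only [Mem.Dep] at hw ⊢
    by_cases hcode : a * n + b = u * n + v
    · obtain ⟨rfl, rfl⟩ := (code_inj hb hv).1 hcode
      rw [Function.update_self] at hw
      exact absurd hw.symm hwa
    · rw [Function.update_of_ne hcode] at hw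
      simp only [Function.update_of_ne hcode]
      have h₁ := hmono (a * n + w)
      have h₂ := hmono (w * n + b)
      rcases h.dep a ha b hb w hw hwa hwb with h₃ | ⟨h₃, h₄, h₅⟩
      · exact .inl (by omega)
      · by_cases hx : a * n + w = u * n + v
        · refine .inl ?_
          rw [hx, hK] at h₃
          rw [hx, Function.update_self]
          omega
        · by_cases hy : w * n + b = u * n + v
          · refine .inl ?_
            rw [hy, hK] at h₃
            rw [hy, Function.update_self]
            omega
          · rw [Function.update_of_ne hx, Function.update_of_ne hy]
            exact .inr ⟨h₃, hdep _ _ hx h₄, hdep _ _ hy h₅⟩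
  · intro a ha b hb
    dsimp only
    by_cases hcode : a * n + b = u * n + v
    · rw [hcode, Function.update_self]
      exact Nat.zero_le _
    · rw [Function.update_of_ne hcode, Function.update_of_ne hcode]
      exact h.ptr_le a ha b hb
  · intro a ha b hb i hi w hw
    dsimp only [Mem.Good] at hi hw ⊢
    by_cases hcode : a * n + b = u * n + v
    · rw [hcode, Function.update_self] at hi
      omega
    · rw [Function.update_of_ne hcode] at hi hw ⊢
      rw [Function.update_of_ne hcode]
      rcases h.scanned a ha b hb i hi w hw with h₁ | h₁
      · exact .inl h₁
      · refine .inr fun hg => ?_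
        have hwn : m.D (a * n + w) + m.D (w * n + b) ≤ m.D (a * n + b) :=
          (add_le_add (hmono _) (hmono _)).trans hg.2.2
        have hwlt : w < n := by
          have := h.ptr_le a ha b hb
          exact hL.lt _ (lev_le (h.le a ha b hb)) a ha w ⟨i, by omega, hw⟩
        -- The raised pair is off the diagonal, so a part that is positive now was positive before.
        refine h₁ ⟨h.pos a ha w hwlt ?_, h.pos w hwlt b hb ?_, hwn⟩
        · rintro rfl
          have := hg.1
          rw [Function.update_of_ne, h.diag a ha] at this
          · omega
          · rw [Ne, code_inj ha hv]
            rintro ⟨rfl, rfl⟩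
            exact huv rfl
        · rintro rfl
          have := hg.2.1
          rw [Function.update_of_ne, h.diag w hwlt] at this
          · omega
          · rw [Ne, code_inj hb hv]
            rintro ⟨rfl, rfl⟩
            exact huv rfl

/-- The pairs do not depend on the separated vertices, and lists may grow. -/
theorem Pairs.grow (h : Pairs n K m) {lst' llen' rem' : ℕ → ℕ}
    (hlen : ∀ x, m.llen x ≤ llen' x)
    (hlst : ∀ j ≤ Nat.size n, ∀ u < n, ∀ i < m.llen (j * n + u),
      lst' ((j * n + u) * n + i) = m.lst ((j * n + u) * n + i)) :
    Pairs n K { m with lst := lst', llen := llen', rem := rem' } := by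
  refine { h with
    ptr_le := fun u hu v hv => (h.ptr_le u hu v hv).trans (hlen _)
    scanned := fun u hu v hv i hi w hw => ?_ }
  refine h.scanned u hu v hv i hi w ?_
  dsimp only at hi hw
  rwa [hlst _ (lev_le (h.le u hu v hv)) u hu i
    (lt_of_lt_of_le hi (h.ptr_le u hu v hv))] at hw

/-- The deletion of an edge, after which its pair has to be examined. -/
theorem Pairs.delete (h : Pairs n n m) {u v : ℕ} (hu : u < n) (hv : v < n)
    {bk' blen' : ℕ → ℕ}
    (hbk : ∀ k e, OnStack bk' blen' (stride n) k e ↔ m.Bk n k e ∨ k = 1 ∧ e = u * n + v) :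
    Pairs n 1 { m with
      adj := Function.update m.adj (u * n + v) 0
      bk := bk'
      blen := blen' } := by
  have hE : ∀ x y, Mem.E { m with
      adj := Function.update m.adj (u * n + v) 0
      bk := bk'
      blen := blen' } n x y → m.E n x y := by
    rintro x y ⟨hx, hy, hxy⟩
    refine ⟨hx, hy, fun h0 => hxy ?_⟩
    simp only [Function.update_apply]
    split_ifs
    · rfl
    · exact h0
  refine { h with
    lower := fun k a ha b hb hc => h.lower k a ha b hb (hc.mono hE)
    valid := fun a ha b hb hab hn => ?_
    bk_lt := fun k e he => ?_ }
  · rcases h.valid a ha b hb hab hn with hv' | ⟨h₁, _⟩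
    · rcases hv' with h₁ | h₁
      · by_cases hcode : a * n + b = u * n + v
        -- An edge between different vertices forces the value `1`, so bucket `1` is the right one.
        · refine .inr ?_
          have h₂ := h.lower 1 a ha b hb ⟨b, ⟨ha, hb, h₁⟩, rfl⟩
          have h₃ := h.pos a ha b hb hab
          dsimp only [Mem.Bk]
          rw [hbk]
          exact ⟨h₃, .inr ⟨by omega, hcode⟩⟩
        · refine .inl (.inl ?_)
          dsimp only
          rwa [Function.update_of_ne hcode]
      · exact .inl (.inr h₁)
    · dsimp only at hn
      omega
  · rcases (hbk k e).1 he with h₁ | ⟨_, rfl⟩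
    · exact h.bk_lt k e h₁
    · exact code_lt hu hv

theorem Lists.delete (h : Lists n m) {c : ℕ} {bk' blen' : ℕ → ℕ} :
    Lists n { m with adj := Function.update m.adj c 0, bk := bk', blen := blen' } := by
  refine { h with sep := fun j hj hj' u hu x y hxy => h.sep j hj hj' u hu x y ?_ }
  obtain ⟨hx, hy, hxy⟩ := hxy
  refine ⟨hx, hy, fun h0 => hxy ?_⟩
  simp only [Function.update_apply]
  split_ifs
  · rfl
  · exact h0

end DecAPSP

namespace DecAPSP

/-! ### Backward search for a thin layer -/

/-- The search from `v` among the vertices that are not flagged in the row `x` of `m.rem`: the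
queue holds the vertices of the ball of radius `i` in its first `hi` cells, and vertices at
distance `i + 1` in the further cells below `tail`; the first `z` pairs of a ball vertex and a
potential predecessor were examined. -/
structure Search (n : ℕ) (m : Mem) (x v q : ℕ) (rem Q : ℕ → ℕ) (hi tail z i : ℕ) : Prop where
  hi_pos : 1 ≤ hi
  hi_le : hi ≤ tail
  z_le : z ≤ hi * n
  lt : ∀ t < tail, Q t < n
  inj : ∀ t < tail, ∀ t' < tail, Q t = Q t' → t = t'
  fresh : ∀ t < tail, m.rem (x * n + Q t) = 0
  queued : ∀ t < tail, rem (x * n + Q t) ≠ 0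
  other : ∀ y, (∀ t < tail, y ≠ x * n + Q t) → rem y = m.rem y
  near : ∀ t < tail, ∃ l ≤ i + 1, Connects (m.E n) l (Q t) v
  near_hi : ∀ t < hi, ∃ l ≤ i, Connects (m.E n) l (Q t) v
  ball : (q + 1) ^ i ≤ q ^ i * hi
  explored : ∀ z' < z, m.E n (z' % n) (Q (z' / n)) → rem (x * n + z' % n) ≠ 0

namespace Search

variable {n : ℕ} {m : Mem} {x v q : ℕ} {rem Q : ℕ → ℕ} {hi tail z i : ℕ}

theorem start (hv : v < n) (hrem : m.rem (x * n + v) = 0) (Q : ℕ → ℕ) :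
    Search n m x v q (Function.update m.rem (x * n + v) 1) (Function.update Q 0 v) 1 1 0 0 where
  hi_pos := le_rfl
  hi_le := le_rfl
  z_le := Nat.zero_le _
  lt t ht := by simpa [Nat.lt_one_iff.1 ht] using hv
  inj t ht t' ht' _ := by omega
  fresh t ht := by simpa [Nat.lt_one_iff.1 ht] using hrem
  queued t ht := by simp [Nat.lt_one_iff.1 ht]
  other y hy := by
    rw [Function.update_of_ne]
    simpa using hy 0 one_pos
  near t ht := ⟨0, Nat.zero_le _, by simp [Nat.lt_one_iff.1 ht, Connects]⟩
  near_hi t ht := ⟨0, le_rfl, by simp [Nat.lt_one_iff.1 ht, Connects]⟩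
  ball := by simp
  explored _ h := absurd h (Nat.not_lt_zero _)

theorem skip (h : Search n m x v q rem Q hi tail z i) (hz : z < hi * n)
    (hskip : m.E n (z % n) (Q (z / n)) → rem (x * n + z % n) ≠ 0) :
    Search n m x v q rem Q hi tail (z + 1) i := by
  refine { h with z_le := hz, explored := fun z' hz' => ?_ }
  rcases Nat.lt_succ_iff_lt_or_eq.1 hz' with h₁ | rfl
  · exact h.explored z' h₁
  · exact hskip

theorem visit (h : Search n m x v q rem Q hi tail z i) (hz : z < hi * n)
    (hE : m.E n (z % n) (Q (z / n))) (hrem : rem (x * n + z % n) = 0) :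
    Search n m x v q (Function.update rem (x * n + z % n) 1) (Function.update Q tail (z % n))
      hi (tail + 1) (z + 1) i := by
  have hzn : z / n < hi := Nat.div_lt_of_lt_mul (by rwa [Nat.mul_comm] at hz)
  have hhi := h.hi_le
  have hnot : ∀ t < tail, Q t ≠ z % n := by
    intro t ht h₁
    exact h.queued t ht (by rw [h₁]; exact hrem)
  have hQ : ∀ t < tail, Function.update Q tail (z % n) t = Q t := fun t ht =>
    Function.update_of_ne (by omega) _ _
  have hcases : ∀ {P : ℕ → ℕ → Prop}, (∀ t < tail, P t (Q t)) → P tail (z % n) →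
      ∀ t < tail + 1, P t (Function.update Q tail (z % n) t) := by
    intro P h₁ h₂ t ht
    rcases Nat.lt_succ_iff_lt_or_eq.1 ht with h₃ | rfl
    · rw [hQ t h₃]; exact h₁ t h₃
    · rw [Function.update_self]; exact h₂
  have hne : ∀ t < tail, x * n + Q t ≠ x * n + z % n := fun t ht h₁ => hnot t ht (by omega)
  refine { hi_pos := h.hi_pos, hi_le := by omega, z_le := hz, ball := h.ball, lt := ?_, inj := ?_,
           fresh := ?_, queued := ?_, other := ?_, near := ?_, near_hi := ?_, explored := ?_ }
  · exact hcases (P := fun _ y => y < n) h.lt hE.1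
  · intro t ht t' ht' heq
    rcases Nat.lt_succ_iff_lt_or_eq.1 ht with h₁ | rfl <;>
      rcases Nat.lt_succ_iff_lt_or_eq.1 ht' with h₂ | rfl
    · rw [hQ t h₁, hQ t' h₂] at heq
      exact h.inj t h₁ t' h₂ heq
    · rw [hQ t h₁, Function.update_self] at heq
      exact absurd heq (hnot t h₁)
    · rw [hQ t' h₂, Function.update_self] at heq
      exact absurd heq.symm (hnot t' h₂)
    · rfl
  · refine hcases (P := fun _ y => m.rem (x * n + y) = 0) h.fresh ?_
    rw [← h.other _ fun t ht h₁ => hne t ht h₁.symm]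
    exact hrem
  · refine hcases (P := fun _ y => Function.update rem (x * n + z % n) 1 (x * n + y) ≠ 0) ?_ ?_
    · intro t ht
      rw [Function.update_of_ne (hne t ht)]
      exact h.queued t ht
    · simp
  · intro y hy
    rw [Function.update_of_ne]
    · refine h.other y fun t ht => ?_
      rw [← hQ t ht]
      exact hy t (by omega)
    · simpa using hy tail (by omega)
  · refine hcases (P := fun _ y => ∃ l ≤ i + 1, Connects (m.E n) l y v) h.near ?_
    obtain ⟨l, hl, hc⟩ := h.near_hi _ hzn
    exact ⟨l + 1, by omega, _, hE, hc⟩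
  · intro t ht
    rw [hQ t (by omega)]
    exact h.near_hi t ht
  · intro z' hz' hz'E
    rw [Function.update_apply]
    split_ifs with h₁
    · exact one_ne_zero
    · rcases Nat.lt_succ_iff_lt_or_eq.1 hz' with h₂ | rfl
      · have : z' / n < tail :=
          lt_of_le_of_lt (Nat.div_le_div_right h₂.le) (lt_of_lt_of_le hzn hhi)
        rw [hQ _ this] at hz'E
        exact h.explored z' h₂ hz'E
      · exact absurd rfl h₁

/-- A layer that is not thin enlarges the ball by a factor of at least `1 + 1 / q`; `ball` records
this without division. -/
theorem next (h : Search n m x v q rem Q hi tail z i) (hq : hi < (tail - hi) * q) :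
    Search n m x v q rem Q tail tail z (i + 1) := by
  have hhi := h.hi_le
  refine { h with
    hi_pos := h.hi_pos.trans hhi
    hi_le := le_rfl
    z_le := h.z_le.trans (Nat.mul_le_mul_right _ hhi)
    near := fun t ht => ?_
    near_hi := h.near
    ball := ?_ }
  · obtain ⟨l, hl, hc⟩ := h.near t ht
    exact ⟨l, by omega, hc⟩
  · obtain ⟨d, rfl⟩ := Nat.exists_eq_add_of_le hhi
    have h₁ : (q + 1) * hi ≤ q * (hi + d) := by
      rw [Nat.add_sub_cancel_left] at hq
      nlinarith
    calc (q + 1) ^ (i + 1) = (q + 1) * (q + 1) ^ i := by ring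
      _ ≤ (q + 1) * (q ^ i * hi) := Nat.mul_le_mul_left _ h.ball
      _ = q ^ i * ((q + 1) * hi) := by ring
      _ ≤ q ^ i * (q * (hi + d)) := Nat.mul_le_mul_left _ h₁
      _ = q ^ (i + 1) * (hi + d) := by ring

theorem tail_le (h : Search n m x v q rem Q hi tail z i) : tail ≤ n := by
  have := Finset.card_le_card_of_injOn (s := Finset.range tail) (t := Finset.range n) Q
    (fun t ht => by simpa using h.lt t (by simpa using ht))
    (fun t ht t' ht' => h.inj t (by simpa using ht) t' (by simpa using ht'))
  simpa using this

/-- Bernoulli's inequality for `(1 + 1 / q) ^ k`, cleared of denominators. -/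
theorem pow_mul_add_le (q k : ℕ) : q ^ k * (q + k) ≤ q * (q + 1) ^ k := by
  induction k with
  | zero => simp
  | succ k ih =>
    calc q ^ (k + 1) * (q + (k + 1)) ≤ q ^ k * (q + k) * (q + 1) := by
          rw [pow_succ, Nat.mul_assoc, Nat.mul_assoc]
          exact Nat.mul_le_mul_left _ (by nlinarith)
      _ ≤ q * (q + 1) ^ k * (q + 1) := Nat.mul_le_mul_right _ ih
      _ = q * (q + 1) ^ (k + 1) := by ring

theorem two_mul_pow_le {q : ℕ} (hq : 1 ≤ q) : 2 * q ^ q ≤ (q + 1) ^ q := by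
  refine Nat.le_of_mul_le_mul_left ?_ hq
  calc q * (2 * q ^ q) = q ^ q * (q + q) := by ring
    _ ≤ q * (q + 1) ^ q := pow_mul_add_le q q

/-- The ball at least doubles every `q` rounds by `two_mul_pow_le`, and it never has more than `n <
2 ^ size n` vertices. -/
theorem radius_lt (h : Search n m x v q rem Q hi tail z i) (hq : 1 ≤ q) :
    i < q * Nat.size n := by
  by_contra hi'
  obtain ⟨d, rfl⟩ := Nat.exists_eq_add_of_le (not_lt.1 hi')
  have h₁ := h.ball.trans (Nat.mul_le_mul_left _ (h.hi_le.trans h.tail_le))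
  have h₂ : 2 ^ Nat.size n * q ^ (q * Nat.size n) ≤ (q + 1) ^ (q * Nat.size n) := by
    rw [pow_mul, pow_mul, ← mul_pow]
    exact Nat.pow_le_pow_left (two_mul_pow_le hq) _
  have h₃ : q ^ d ≤ (q + 1) ^ d := Nat.pow_le_pow_left (by omega) _
  have h₄ : n < 2 ^ Nat.size n := Nat.lt_size_self n
  have h₅ : 0 < q ^ (q * Nat.size n + d) := by positivity
  have h₆ : q ^ (q * Nat.size n + d) * 2 ^ Nat.size n ≤ (q + 1) ^ (q * Nat.size n + d) := by
    rw [pow_add, pow_add]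
    calc _ = (2 ^ Nat.size n * q ^ (q * Nat.size n)) * q ^ d := by ring
      _ ≤ _ := Nat.mul_le_mul h₂ h₃
  exact absurd (h₆.trans h₁) (not_le.2 (Nat.mul_lt_mul_of_pos_left h₄ h₅))

end Search

/-! ### The effect of a finished search on lists and flags. -/

open Classical in
/-- The flags after the vertices with queue positions from `hi` to `y` were released. -/
noncomputable def released (n x : ℕ) (rem Q : ℕ → ℕ) (hi y c : ℕ) : ℕ :=
  if ∃ t, hi ≤ t ∧ t < y ∧ c = x * n + Q t then 0 else rem c

/-- The lists after the vertices with queue positions from `hi` to `y` were appended. -/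
def appended (a : ℕ) (lst Q : ℕ → ℕ) (hi y c : ℕ) : ℕ :=
  if a ≤ c ∧ c < a + (y - hi) then Q (hi + (c - a)) else lst c

theorem released_self (n x : ℕ) (rem Q : ℕ → ℕ) (hi : ℕ) : released n x rem Q hi hi = rem := by
  funext c
  unfold released
  rw [if_neg]
  rintro ⟨t, h₁, h₂, _⟩
  omega

theorem released_succ (n x : ℕ) (rem Q : ℕ → ℕ) {hi y : ℕ} (h : hi ≤ y) :
    Function.update (released n x rem Q hi y) (x * n + Q y) 0 =
      released n x rem Q hi (y + 1) := by
  funext c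
  rw [Function.update_apply]
  unfold released
  by_cases hc : c = x * n + Q y
  · rw [if_pos hc]
    rw [if_pos]
    exact ⟨y, h, by omega, hc⟩
  · rw [if_neg hc]
    have h₀ : (∃ t, hi ≤ t ∧ t < y ∧ c = x * n + Q t) ↔
        ∃ t, hi ≤ t ∧ t < y + 1 ∧ c = x * n + Q t := by
      constructor
      · rintro ⟨t, h₁, h₂, h₃⟩
        exact ⟨t, h₁, by omega, h₃⟩
      · rintro ⟨t, h₁, h₂, h₃⟩
        refine ⟨t, h₁, ?_, h₃⟩
        rcases Nat.lt_succ_iff_lt_or_eq.1 h₂ with h₄ | rfl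
        · exact h₄
        · exact absurd h₃ hc
    split_ifs with h₁ h₂ h₂
    exacts [rfl, absurd (h₀.1 h₁) h₂, absurd (h₀.2 h₂) h₁, rfl]

theorem appended_self (a : ℕ) (lst Q : ℕ → ℕ) (hi : ℕ) : appended a lst Q hi hi = lst := by
  funext c
  unfold appended
  exact if_neg (by omega)

theorem appended_succ (a : ℕ) (lst Q : ℕ → ℕ) {hi y : ℕ} (h : hi ≤ y) :
    Function.update (appended a lst Q hi y) (a + (y - hi)) (Q y) =
      appended a lst Q hi (y + 1) := by
  funext c
  rw [Function.update_apply]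
  unfold appended
  by_cases hc : c = a + (y - hi)
  · rw [if_pos hc, if_pos (by omega)]
    congr
    omega
  · rw [if_neg hc]
    exact if_congr (by omega) rfl rfl

/-- The lists and flags after a search has ended with a thin layer. -/
noncomputable def Mem.separate (m : Mem) (n x : ℕ) (rem Q : ℕ → ℕ) (hi tail : ℕ) : Mem :=
  { m with
    lst := appended (x * n + m.llen x) m.lst Q hi tail
    llen := Function.update m.llen x (m.llen x + (tail - hi))
    rem := released n x rem Q hi tail }

/-- The number of vertices that are not yet separated. -/
def Mem.unseparated (n : ℕ) (m : Mem) : ℕ :=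
  ((Finset.range ((Nat.size n + 1) * n * n)).filter fun c => m.rem c = 0).card

section separate

variable {n K : ℕ} {m : Mem} {u v : ℕ} {rem Q : ℕ → ℕ} {hi tail z i : ℕ}

theorem Search.rem_eq_zero {x q c : ℕ} (h : Search n m x v q rem Q hi tail z i)
    (hc : released n x rem Q hi tail c = 0) : m.rem c = 0 := by
  unfold released at hc
  split_ifs at hc with h₁
  · obtain ⟨t, _, h₂, rfl⟩ := h₁
    exact h.fresh t h₂
  · by_cases h₂ : ∃ t < tail, c = x * n + Q t
    · obtain ⟨t, ht, rfl⟩ := h₂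
      exact absurd hc (h.queued t ht)
    · push Not at h₂
      rw [← h.other c h₂]
      exact hc

theorem Search.released_ball {x q t : ℕ} (h : Search n m x v q rem Q hi tail z i) (ht : t < hi) :
    released n x rem Q hi tail (x * n + Q t) ≠ 0 := by
  unfold released
  have hhi := h.hi_le
  rw [if_neg]
  · exact h.queued t (by omega)
  · rintro ⟨t', h₁, h₂, h₃⟩
    have := h.inj t (by omega) t' h₂ (by omega)
    omega

theorem Search.released_ne {x q c : ℕ} (h : Search n m x v q rem Q hi tail z i)
    (hc : m.rem c ≠ 0) : released n x rem Q hi tail c = m.rem c := by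
  have h₁ : ∀ t < tail, c ≠ x * n + Q t := by
    rintro t ht rfl
    exact hc (h.fresh t ht)
  unfold released
  rw [if_neg, h.other c h₁]
  rintro ⟨t, _, h₂, h₃⟩
  exact h₁ t h₂ h₃

theorem Search.released_other {x q c : ℕ} (h : Search n m x v q rem Q hi tail z i)
    (hc : ∀ t < tail, c ≠ x * n + Q t) : released n x rem Q hi tail c = m.rem c := by
  unfold released
  rw [if_neg, h.other c hc]
  rintro ⟨t, _, h₂, h₃⟩
  exact hc t h₂ h₃

/-- Exactly the vertices of the ball gain a flag in row `x`, and no flag that existed before the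
search is lost. This drop pays for the search. -/
theorem Search.unseparated_add_le {x q : ℕ} (h : Search n m x v q rem Q hi tail z i)
    (hx : x < (Nat.size n + 1) * n) :
    (m.separate n x rem Q hi tail).unseparated n + hi ≤ m.unseparated n := by
  have hhi := h.hi_le
  have hcard : ((Finset.range hi).image fun t => x * n + Q t).card = hi := by
    rw [Finset.card_image_of_injOn, Finset.card_range]
    intro t ht t' ht' heq
    simp only [Finset.coe_range, Set.mem_Iio] at ht ht'
    exact h.inj t (by omega) t' (by omega) (by simpa using heq)
  rw [Mem.unseparated, Mem.unseparated]
  conv_lhs => rhs; rw [← hcard]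
  rw [← Finset.card_union_of_disjoint]
  · refine Finset.card_le_card fun c hc => ?_
    simp only [Finset.mem_union, Finset.mem_filter, Finset.mem_range, Finset.mem_image] at hc ⊢
    rcases hc with ⟨h₁, h₂⟩ | ⟨t, ht, rfl⟩
    · exact ⟨h₁, h.rem_eq_zero h₂⟩
    · exact ⟨code_lt hx (h.lt t (by omega)), h.fresh t (by omega)⟩
  · rw [Finset.disjoint_left]
    intro c hc hc'
    simp only [Finset.mem_filter, Finset.mem_image, Finset.mem_range] at hc hc'
    obtain ⟨t, ht, rfl⟩ := hc'
    exact h.released_ball ht hc.2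

theorem Lists.llen_le (h : Lists n m) {j : ℕ} (hj : j ≤ Nat.size n) (hu : u < n) :
    m.llen (j * n + u) ≤ n :=
  (Nat.le_mul_of_pos_right _ (by positivity)).trans (h.card j hj u hu)

theorem Search.card_flagged {x q : ℕ} (h : Search n m x v q rem Q hi tail z i) :
    ((Finset.range n).filter fun w => m.rem (x * n + w) ≠ 0).card + hi ≤
      ((Finset.range n).filter fun w => released n x rem Q hi tail (x * n + w) ≠ 0).card := by
  have hhi := h.hi_le
  have hcard : ((Finset.range hi).image Q).card = hi := by
    rw [Finset.card_image_of_injOn, Finset.card_range]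
    intro t ht t' ht' heq
    simp only [Finset.coe_range, Set.mem_Iio] at ht ht'
    exact h.inj t (by omega) t' (by omega) heq
  nth_rewrite 1 [← hcard]
  rw [← Finset.card_union_of_disjoint]
  · refine Finset.card_le_card fun w hw => ?_
    simp only [Finset.mem_union, Finset.mem_filter, Finset.mem_range, Finset.mem_image] at hw ⊢
    rcases hw with ⟨h₁, h₂⟩ | ⟨t, ht, rfl⟩
    · exact ⟨h₁, fun h₃ => h₂ (h.rem_eq_zero h₃)⟩
    · exact ⟨h.lt t (by omega), h.released_ball ht⟩
  · rw [Finset.disjoint_left]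
    intro w hw hw'
    simp only [Finset.mem_filter, Finset.mem_image, Finset.mem_range] at hw hw'
    obtain ⟨t, ht, rfl⟩ := hw'
    exact hw.2 (h.fresh t (by omega))

variable (hL : Lists n m) (hP : Pairs n K m) (hu : u < n) (hv : v < n) (hKn : K ≤ n)
  (hK : m.D (u * n + v) = K)
  (h : Search n m (lev n K * n + u) v (2 ^ lev n K) rem Q hi tail z i)

include hL hu h in
-- A queued vertex had no flag before the search, but on level `0` every vertex is flagged.
theorem Search.one_le_lev : 1 ≤ lev n K := by
  by_contra h₁
  have hhi := h.hi_le
  have hpos := h.hi_pos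
  have h₂ : lev n K = 0 := by omega
  have h₃ := h.fresh 0 (by omega)
  rw [h₂, Nat.zero_mul, Nat.zero_add] at h₃
  exact hL.base_rem u hu _ (h.lt 0 (by omega)) h₃

include hL hu hKn h in
-- A thin layer is charged to its own ball. Balls of the same row are disjoint, so the list stays
-- short.
theorem Search.llen_add_mul_le (hthin : (tail - hi) * 2 ^ lev n K ≤ hi) :
    (m.llen (lev n K * n + u) + (tail - hi)) * 2 ^ lev n K ≤
      ((Finset.range n).filter fun w =>
        released n (lev n K * n + u) rem Q hi tail ((lev n K * n + u) * n + w) ≠ 0).card := by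
  refine le_trans ?_ h.card_flagged
  rw [Nat.add_mul]
  exact Nat.add_le_add (hL.size _ (h.one_le_lev hL hu) (lev_le hKn) u hu) hthin

include hL hu hKn h in
theorem Search.llen_add_le (hthin : (tail - hi) * 2 ^ lev n K ≤ hi) :
    m.llen (lev n K * n + u) + (tail - hi) ≤ n :=
  (Nat.le_mul_of_pos_right _ (by positivity)).trans ((h.llen_add_mul_le hL hu hKn hthin).trans
    ((Finset.card_filter_le _ _).trans (by simp)))

include hL hP hu hv hKn hK h in
-- The layer becomes part of the list and the ball becomes flagged. The separator property persists
-- because all in-neighbours of the ball have been inspected.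
theorem Search.separate (hz : hi * n ≤ z) (hthin : (tail - hi) * 2 ^ lev n K ≤ hi) :
    Lists n (m.separate n (lev n K * n + u) rem Q hi tail) := by
  have hhi := h.hi_le
  have hj := h.one_le_lev hL hu
  have hjs := lev_le hKn
  -- Queued vertices reach `v` with at most `i + 1 ≤ 2 ^ lev n K * size n < K` edges, while `K` is a
  -- lower bound for the distance from `u`.
  have hself : ∀ t < tail, Q t ≠ u := by
    rintro t ht rfl
    obtain ⟨l, hl, hc⟩ := h.near t ht
    have h₁ := hP.lower l _ hu v hv hc
    have h₂ := h.radius_lt (Nat.one_le_two_pow)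
    have h₃ := lt_of_one_le_lev hj
    omega
  set x := lev n K * n + u with hx
  have hlen := hL.llen_le hjs hu
  have hcard := h.llen_add_mul_le hL hu hKn hthin
  rw [← hx] at hcard
  have hcard_le : (m.llen x + (tail - hi)) * 2 ^ lev n K ≤ n :=
    hcard.trans ((Finset.card_filter_le _ _).trans (by simp))
  have hlen' : m.llen x + (tail - hi) ≤ n := h.llen_add_le hL hu hKn hthin
  have hother : ∀ j' ≤ Nat.size n, ∀ a < n, (j' * n + a = x → j' = lev n K ∧ a = u) := by
    intro j' _ a ha heq
    exact (code_inj ha hu).1 heq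
  have hcand : ∀ j' ≤ Nat.size n, ∀ a < n, ∀ w,
      (m.separate n x rem Q hi tail).Cand n (j' * n + a) w ↔
        m.Cand n (j' * n + a) w ∨ j' * n + a = x ∧ ∃ t, hi ≤ t ∧ t < tail ∧ w = Q t := by
    intro j' hj' a ha w
    unfold Mem.Cand OnStack Mem.separate
    dsimp only
    by_cases hxx : j' * n + a = x
    · rw [hxx, Function.update_self]
      constructor
      · rintro ⟨y, hy, rfl⟩
        unfold appended
        split_ifs with h₁
        · exact .inr ⟨rfl, hi + (x * n + y - (x * n + m.llen x)), by omega, by omega, rfl⟩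
        · exact .inl ⟨y, by omega, rfl⟩
      · rintro (⟨y, hy, rfl⟩ | ⟨_, t, h₁, h₂, rfl⟩)
        · refine ⟨y, by omega, ?_⟩
          unfold appended
          rw [if_neg (by omega)]
        · refine ⟨m.llen x + (t - hi), by omega, ?_⟩
          unfold appended
          rw [if_pos (by omega)]
          congr
          omega
    · rw [Function.update_of_ne hxx]
      have h₀ : ∀ y < m.llen (j' * n + a),
          appended (x * n + m.llen x) m.lst Q hi tail ((j' * n + a) * n + y) =
            m.lst ((j' * n + a) * n + y) := by
        intro y hy
        unfold appended
        rw [if_neg]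
        rintro ⟨h₁, h₂⟩
        have h₃ := hL.llen_le hj' ha
        obtain ⟨d, hd⟩ := Nat.exists_eq_add_of_le h₁
        have : (j' * n + a) * n + y = x * n + (m.llen x + d) := by omega
        exact hxx ((code_inj (by omega) (by omega)).1 this).1
      constructor
      · rintro ⟨y, hy, rfl⟩
        exact .inl ⟨y, hy, (h₀ y hy).symm⟩
      · rintro (⟨y, hy, rfl⟩ | ⟨h₁, _⟩)
        · exact ⟨y, hy, h₀ y hy⟩
        · exact absurd h₁ hxx
  have hrow : ∀ j' ≤ Nat.size n, ∀ a < n, j' * n + a ≠ x → ∀ w < n,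
      released n x rem Q hi tail ((j' * n + a) * n + w) = m.rem ((j' * n + a) * n + w) := by
    intro j' _ a _ hne w hw
    refine h.released_other fun t ht heq => hne ?_
    exact ((code_inj hw (h.lt t ht)).1 heq).1
  refine { lt := ?_, card := ?_, base := ?_, base_rem := ?_, size := ?_, self_rem := ?_, self_cand
           := ?_, sep := ?_ }
  · intro j' hj' a ha w hw
    rcases (hcand j' hj' a ha w).1 hw with h₁ | ⟨_, t, _, ht, rfl⟩
    · exact hL.lt j' hj' a ha w h₁
    · exact h.lt t ht
  · intro j' hj' a ha
    dsimp only [Mem.separate]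
    by_cases hxx : j' * n + a = x
    · obtain ⟨rfl, rfl⟩ := hother j' hj' a ha hxx
      rw [hxx, Function.update_self]
      exact hcard_le
    · rw [Function.update_of_ne hxx]
      exact hL.card j' hj' a ha
  · intro a ha w hw
    have := (hcand 0 (Nat.zero_le _) a ha w).2
    rw [Nat.zero_mul, Nat.zero_add] at this
    exact this (.inl (hL.base a ha w hw))
  · intro a ha w hw
    dsimp only [Mem.separate]
    rw [h.released_ne (hL.base_rem a ha w hw)]
    exact hL.base_rem a ha w hw
  · intro j' hj1 hj' a ha
    dsimp only [Mem.separate]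
    by_cases hxx : j' * n + a = x
    · obtain ⟨rfl, rfl⟩ := hother j' hj' a ha hxx
      rw [hxx, Function.update_self]
      exact hcard
    · rw [Function.update_of_ne hxx]
      refine (hL.size j' hj1 hj' a ha).trans_eq ?_
      congr 1
      refine Finset.filter_congr fun w hw => ?_
      rw [hrow j' hj' a ha hxx w (by simpa using hw)]
  · intro j' hj1 hj' a ha
    dsimp only [Mem.separate]
    by_cases hxx : j' * n + a = x
    · obtain ⟨rfl, rfl⟩ := hother j' hj' a ha hxx
      rw [hxx, h.released_other]
      · exact hL.self_rem _ hj1 hj' a ha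
      · intro t ht heq
        exact hself t ht (by omega)
    · rw [hrow j' hj' a ha hxx a ha]
      exact hL.self_rem _ hj1 hj' a ha
  · intro j' hj1 hj' a ha hc
    rcases (hcand j' hj' a ha a).1 hc with h₁ | ⟨hxx, t, _, ht, h₂⟩
    · exact hL.self_cand j' hj1 hj' a ha h₁
    · obtain ⟨rfl, rfl⟩ := hother j' hj' a ha hxx
      exact hself t ht h₂.symm
  · intro j' hj1 hj' a ha b c hbc hb hc
    rw [hcand j' hj' a ha b]
    dsimp only [Mem.separate] at hb hc
    have hbc' : m.E n b c := hbc
    by_cases hxx : j' * n + a = x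
    · obtain ⟨rfl, rfl⟩ := hother j' hj' a ha hxx
      rw [hxx] at hb hc ⊢
      -- If `c` is newly flagged, it lies in the ball, so its in-neighbour `b` carried a flag when
      -- the search ended. As `b` has none now, it was released, that is, it lies in the layer. If
      -- `c` was flagged before, the old separator already contains `b`.
      by_cases hc0 : m.rem (x * n + c) = 0
      · have hcQ : ∃ t < hi, c = Q t := by
          by_contra hno
          push Not at hno
          refine hc ?_
          unfold released
          split_ifs with h₁
          · rfl
          · rw [h.other, hc0]
            intro t ht heq
            have hct : c = Q t := by omega
            by_cases hth : t < hi
            · exact hno t hth hct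
            · exact h₁ ⟨t, by omega, ht, heq⟩
        obtain ⟨t, ht, rfl⟩ := hcQ
        have hbn := hbc'.1
        have hz' : t * n + b < z := lt_of_lt_of_le (code_lt ht hbn) hz
        have h₁ := h.explored _ hz'
        rw [code_div hbn, code_mod hbn] at h₁
        have h₂ := h₁ hbc'
        refine .inr ⟨rfl, ?_⟩
        by_contra hno
        refine h₂ ?_
        unfold released at hb
        rwa [if_neg] at hb
        rintro ⟨t', h₃, h₄, h₅⟩
        exact hno ⟨t', h₃, h₄, by omega⟩
      · exact .inl (hL.sep _ hj1 hj' a ha b c hbc' (h.rem_eq_zero hb) hc0)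
    · rw [hrow j' hj' a ha hxx b hbc'.1] at hb
      rw [hrow j' hj' a ha hxx c hbc'.2.1] at hc
      exact .inl (hL.sep j' hj1 hj' a ha b c hbc' hb hc)

include hL hP hu hKn h in
-- New candidates are appended behind the old ones, so the part of a list that a pair has already
-- scanned does not change.
theorem Search.pairs_separate (hthin : (tail - hi) * 2 ^ lev n K ≤ hi) :
    Pairs n K (m.separate n (lev n K * n + u) rem Q hi tail) := by
  have hlen := h.llen_add_le hL hu hKn hthin
  refine hP.grow (fun y => ?_) fun j hj a ha y hy => ?_
  · rw [Function.update_apply]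
    split_ifs with h₁
    · subst h₁; omega
    · exact le_rfl
  · unfold appended
    rw [if_neg]
    rintro ⟨h₁, h₂⟩
    have h₃ := hL.llen_le hj ha
    obtain ⟨d, hd⟩ := Nat.exists_eq_add_of_le h₁
    obtain ⟨h₄, h₅⟩ := (code_inj (by omega) (by omega)).1 (hd.trans (Nat.add_assoc _ _ _))
    rw [h₄] at hy
    omega

end separate

end DecAPSP

namespace DecAPSP

/-! ### The memory layout -/

/-- The arrays of the data structure. -/
def State.mem (s : State) : Mem where
  adj := s.arr 0
  D := s.arr 1
  wit := s.arr 3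
  ptr := s.arr 4
  dep := s.arr 5
  dlen := s.arr 6
  bk := s.arr 7
  blen := s.arr 8
  lst := s.arr 9
  llen := s.arr 10
  rem := s.arr 11

section mem

variable (s : State) (i x : ℕ)

@[simp] theorem State.mem_setReg (r : ℕ) : (s.setReg r x).mem = s.mem := rfl
@[simp] theorem State.mem_adj : s.mem.adj = s.arr 0 := rfl
@[simp] theorem State.mem_D : s.mem.D = s.arr 1 := rfl
@[simp] theorem State.mem_wit : s.mem.wit = s.arr 3 := rfl
@[simp] theorem State.mem_ptr : s.mem.ptr = s.arr 4 := rfl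
@[simp] theorem State.mem_dep : s.mem.dep = s.arr 5 := rfl
@[simp] theorem State.mem_dlen : s.mem.dlen = s.arr 6 := rfl
@[simp] theorem State.mem_bk : s.mem.bk = s.arr 7 := rfl
@[simp] theorem State.mem_blen : s.mem.blen = s.arr 8 := rfl
@[simp] theorem State.mem_lst : s.mem.lst = s.arr 9 := rfl
@[simp] theorem State.mem_llen : s.mem.llen = s.arr 10 := rfl
@[simp] theorem State.mem_rem : s.mem.rem = s.arr 11 := rfl

end mem

/-- A bound for the numbers that the programs store. -/
def cellBound (n : ℕ) : ℕ := (n + 2) ^ 40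

/-- The word bound. -/
def wordBound (n : ℕ) : ℕ := (n + 2) ^ 960

/-- The exponents match because `40 * 24 = 960`. -/
theorem fits (n : ℕ) : Fits (cellBound n) (wordBound n) where
  two_lt := by
    calc 2 < 2 ^ 40 := by norm_num
      _ ≤ (n + 2) ^ 40 := Nat.pow_le_pow_left (by omega) _
  pow_le := by rw [cellBound, wordBound, ← pow_mul]

theorem stride_lt_cellBound (n : ℕ) : stride n < cellBound n :=
  Nat.pow_lt_pow_right (by omega) (by norm_num)

theorem sq_add_lt_stride (n : ℕ) : n * n + 4 * n + 4 ≤ stride n := by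
  calc n * n + 4 * n + 4 = (n + 2) ^ 2 := by ring
    _ ≤ stride n := Nat.pow_le_pow_right (by omega) (by norm_num)

theorem two_pow_size_le (n : ℕ) : 2 ^ Nat.size n ≤ 2 * n + 1 := by
  cases h : Nat.size n with
  | zero => simp
  | succ k =>
    have : 2 ^ k ≤ n := Nat.lt_size.1 (by omega)
    rw [pow_succ]
    omega

theorem size_le (n : ℕ) : Nat.size n ≤ n := Nat.size_le.2 Nat.lt_two_pow_self

/-- The constant registers and tables: `n`, the stride, twice the number of levels, the sizes, and
the powers of two. -/
structure Ambient (n : ℕ) (s : State) : Prop where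
  reg2 : s.reg 2 = n
  reg3 : s.reg 3 = stride n
  reg4 : s.reg 4 = Nat.size n * 2
  size : ∀ i ≤ n, s.arr 12 i = Nat.size i
  pow : ∀ i ≤ n, s.arr 13 i = 2 ^ Nat.size i
  bounded : Bounded (cellBound n) s

namespace Ambient

variable {n : ℕ} {s : State} {Q : ℕ → State → Prop}

theorem setReg (h : Ambient n s) {r x : ℕ} (hr : 5 ≤ r ∨ r ≤ 1) (hx : x < cellBound n) :
    Ambient n (s.setReg r x) where
  reg2 := by rw [State.setReg_reg, if_neg (by omega), h.reg2]
  reg3 := by rw [State.setReg_reg, if_neg (by omega), h.reg3]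
  reg4 := by rw [State.setReg_reg, if_neg (by omega), h.reg4]
  size := h.size
  pow := h.pow
  bounded := h.bounded.setReg hx

theorem setCell (h : Ambient n s) {a i x : ℕ} (ha : a ≤ 11 ∨ a = 14) (hx : x < cellBound n) :
    Ambient n (s.setCell a i x) where
  reg2 := h.reg2
  reg3 := h.reg3
  reg4 := h.reg4
  size := by simpa [show 12 ≠ a by omega] using h.size
  pow := by simpa [show 13 ≠ a by omega] using h.pow
  bounded := h.bounded.setCell hx

theorem runs_assign (h : Ambient n s) {r : ℕ} {e : Expr} (x : ℕ)
    (he : e.small = true) (hr : 5 ≤ r ∨ r ≤ 1) (hv : e.val s = x) (hx : x < cellBound n)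
    (hQ : Ambient n (s.setReg r x) → Q (e.cost + 1) (s.setReg r x)) :
    Runs (wordBound n) (.assign r e) s Q :=
  Runs.assign (fits n) h.bounded he hv hx fun _ => hQ (h.setReg hr hx)

theorem runs_store (h : Ambient n s) {a : ℕ} {e f : Expr} (i x : ℕ)
    (he : (e.small && f.small) = true) (ha : a ≤ 11 ∨ a = 14) (hi : e.val s = i)
    (hv : f.val s = x) (hx : x < cellBound n)
    (hQ : Ambient n (s.setCell a i x) → Q (e.cost + f.cost + 1) (s.setCell a i x)) :
    Runs (wordBound n) (.store a e f) s Q := by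
  rw [Bool.and_eq_true] at he
  exact Runs.store (fits n) h.bounded he.1 he.2 hi hv hx fun _ => hQ (h.setCell ha hx)

theorem runs_ite (h : Ambient n s) {e : Expr} {c₁ c₂ : Cmd} (P : Prop)
    (he : e.small = true) (hP : e.val s ≠ 0 ↔ P)
    (h₁ : P → Runs (wordBound n) c₁ s fun t s' => Q (e.cost + 1 + t) s')
    (h₂ : ¬ P → Runs (wordBound n) c₂ s fun t s' => Q (e.cost + 1 + t) s') :
    Runs (wordBound n) (.ite e c₁ c₂) s Q :=
  Runs.ite (fits n) h.bounded P he hP h₁ h₂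

end Ambient

/-! ### Programs that move entries between stacks. -/

/-- Push the content of register `r'` to the stack whose number is in register `r`. -/
def pushCmd (a l r r' : ℕ) : Cmd :=
  .store a (.reg r * .reg 3 + .load l (.reg r)) (.reg r') ;;
  .store l (.reg r) (.load l (.reg r) + 1)

theorem Ambient.runs_push {n : ℕ} {s : State} {Q : ℕ → State → Prop} (h : Ambient n s)
    {a l r r' : ℕ} (ha : a ≤ 11) (hl : l ≤ 11) (hal : a ≠ l) (x e : ℕ) (hx : s.reg r = x)
    (he : s.reg r' = e) (hlen : s.arr l x + 1 < cellBound n)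
    (hQ : Ambient n ((s.setCell a (x * stride n + s.arr l x) e).setCell l x (s.arr l x + 1)) →
      Q 14 ((s.setCell a (x * stride n + s.arr l x) e).setCell l x (s.arr l x + 1))) :
    Runs (wordBound n) (pushCmd a l r r') s Q := by
  subst hx he
  refine Runs.seq (h.runs_store (s.reg r * stride n + s.arr l (s.reg r)) _ rfl (.inl ha)
    (by simp [h.reg3]) rfl (h.bounded.reg r')
    fun h' => ?_)
  refine h'.runs_store (s.reg r) (s.arr l (s.reg r) + 1) rfl (.inl hl) (by simp) ?_ hlen
    fun h'' => ?_
  · simp [hal.symm]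
  · simpa using hQ h''

/-- Move the dependents of the pair in register `6` to their buckets. -/
def flushCmd : Cmd :=
  .while (.load 6 (.reg 6)) (
    .store 6 (.reg 6) (.load 6 (.reg 6) - 1) ;;
    .assign 9 (.load 5 (.reg 6 * .reg 3 + .load 6 (.reg 6))) ;;
    .assign 15 (.load 1 (.reg 9)) ;;
    pushCmd 7 8 15 9)

theorem sum_range_update_add {N x : ℕ} (hx : x < N) (f : ℕ → ℕ) (y : ℕ) :
    ∑ i ∈ Finset.range N, Function.update f x y i + f x = ∑ i ∈ Finset.range N, f i + y := by
  rw [Finset.sum_update_of_mem (Finset.mem_range.2 hx), ← Finset.sum_sdiff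
    (Finset.singleton_subset_iff.2 (Finset.mem_range.2 hx))]
  simp
  ring

/-- The stacks in use are those of pairs and of distances up to `n`. -/
structure Stacks (n : ℕ) (m : Mem) : Prop where
  blen : ∀ k, n < k → m.blen k = 0
  dlen : ∀ c, n * n ≤ c → m.dlen c = 0

/-- Each dependent turns into one bucket entry, so the total number of entries is preserved and the
time is proportional to the emptied stack. Obsolete dependents are moved as well, without any test.
-/
theorem Ambient.runs_flush {n c : ℕ} {s : State} (h : Ambient n s) (hc : s.reg 6 = c)
    (hD : ∀ e < n * n, s.arr 1 e ≤ n) (hdep : ∀ e, s.mem.Dep n c e → e < n * n)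
    (hsup : ∀ k, n < k → s.arr 8 k = 0)
    (hlen : ∑ k ∈ Finset.range (n + 1), s.arr 8 k + s.arr 6 c < stride n) :
    Runs (wordBound n) flushCmd s fun t s' => t ≤ 100 * s.arr 6 c + 3 ∧ Ambient n s' ∧
      s'.reg 5 = s.reg 5 ∧ ∃ bk blen : ℕ → ℕ,
      s'.mem = { s.mem with bk := bk, blen := blen, dlen := Function.update s.mem.dlen c 0 } ∧
      (∀ k e, s.mem.Bk n k e → OnStack bk blen (stride n) k e) ∧
      (∀ k e, OnStack bk blen (stride n) k e → s.mem.Bk n k e ∨ e < n * n) ∧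
      (∀ e, s.mem.Dep n c e → OnStack bk blen (stride n) (s.arr 1 e) e) ∧
      (∀ k, n < k → blen k = 0) ∧
      ∑ k ∈ Finset.range (n + 1), blen k = ∑ k ∈ Finset.range (n + 1), s.arr 8 k + s.arr 6 c := by
  refine Runs.while (fits n) rfl (fun τ s' => Ambient n s' ∧ s'.reg 5 = s.reg 5 ∧ s'.reg 6 = c ∧
      ∃ bk blen : ℕ → ℕ, ∃ d ≤ s.arr 6 c, τ ≤ 100 * (s.arr 6 c - d) ∧
      s'.mem = { s.mem with bk := bk, blen := blen, dlen := Function.update s.mem.dlen c d } ∧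
      (∀ k e, s.mem.Bk n k e → OnStack bk blen (stride n) k e) ∧
      (∀ k e, OnStack bk blen (stride n) k e → s.mem.Bk n k e ∨ e < n * n) ∧
      (∀ j, d ≤ j → j < s.arr 6 c → OnStack bk blen (stride n)
        (s.arr 1 (s.arr 5 (c * stride n + j))) (s.arr 5 (c * stride n + j))) ∧
      (∀ k, n < k → blen k = 0) ∧
      ∑ k ∈ Finset.range (n + 1), blen k + d =
        ∑ k ∈ Finset.range (n + 1), s.arr 8 k + s.arr 6 c)
    (fun s' => s'.arr 6 c) ?_ ?_
  · refine ⟨h, rfl, hc, s.arr 7, s.arr 8, s.arr 6 c, le_rfl, by simp, ?_, fun _ _ => id,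
      fun _ _ => .inl, fun j h₁ h₂ => by omega, hsup, rfl⟩
    simp [State.mem]
  · rintro τ s' ⟨hA, h5, h6, bk, blen, d, hd, hτ, hm, hB, hB', hJ, hsup', hsum⟩
    have a1 : s'.arr 1 = s.arr 1 := congrArg Mem.D hm
    have a5 : s'.arr 5 = s.arr 5 := congrArg Mem.dep hm
    have a6 : s'.arr 6 = Function.update s.mem.dlen c d := congrArg Mem.dlen hm
    have a7 : s'.arr 7 = bk := congrArg Mem.bk hm
    have a8 : s'.arr 8 = blen := congrArg Mem.blen hm
    refine ⟨hA.bounded, fun h0 => ?_, fun h0 => ?_⟩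
    · have hd0 : d = 0 := by simpa [h6, a6] using h0
      subst hd0
      refine ⟨by simpa using hτ, hA, h5, bk, blen, hm, hB, hB', ?_, hsup', by simpa using hsum⟩
      rintro e ⟨j, hj, rfl⟩
      exact hJ j (Nat.zero_le _) hj
    · have hd0 : d ≠ 0 := by simpa [h6, a6] using h0
      obtain ⟨d, rfl⟩ := Nat.exists_eq_succ_of_ne_zero hd0
      have hS := stride_lt_cellBound n
      set e := s.arr 5 (c * stride n + d) with he
      have heD : s.mem.Dep n c e := ⟨d, hd, rfl⟩
      have hen := hdep e heD
      have hDe := hD e hen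
      have hblen : ∀ k, blen k < stride n := by
        intro k
        by_cases hk : n < k
        · rw [hsup' k hk]
          omega
        · have := Finset.single_le_sum (f := blen) (fun _ _ => Nat.zero_le _)
            (Finset.mem_range.2 (by omega : k < n + 1))
          omega
      have hb := hblen (s.arr 1 e)
      refine Runs.seq (hA.runs_store c d rfl (by norm_num) (by simp [h6]) (by simp [h6, a6])
        (by simp at hd; omega) fun hA => ?_)
      refine Runs.seq (hA.runs_assign e rfl (by norm_num) (by simp [hA.reg3, h6, a5, he]) ?_
        fun hA => ?_)
      · have := h.bounded.arr 5 (c * stride n + d)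
        exact this
      refine Runs.seq (hA.runs_assign (s.arr 1 e) rfl (by norm_num) (by simp [a1])
        (h.bounded.arr 1 e) fun hA => ?_)
      refine hA.runs_push (by norm_num) (by norm_num) (by norm_num) (s.arr 1 e) e (by simp)
        (by simp) (by simp [a8]; omega) fun hA => ?_
      refine ⟨⟨hA, by simpa using h5, by simpa using h6, Function.update bk (s.arr 1 e * stride n +
          blen (s.arr 1 e)) e,
        Function.update blen (s.arr 1 e) (blen (s.arr 1 e) + 1), d, by omega, ?_, ?_, ?_, ?_, ?_,
        ?_, ?_⟩, by simp [a6]⟩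
      · simp
        omega
      · ext1 <;> simp [a7, a8, a6, a5, a1, State.mem]
        · exact congrArg Mem.adj hm
        · exact congrArg Mem.wit hm
        · exact congrArg Mem.ptr hm
        · exact congrArg Mem.lst hm
        · exact congrArg Mem.llen hm
        · exact congrArg Mem.rem hm
      · exact fun k e' he' => (onStack_push hb (hblen k).le).2 (.inl (hB k e' he'))
      · intro k e' he'
        rcases (onStack_push hb (hblen k).le).1 he' with h₁ | ⟨_, rfl⟩
        · exact hB' k e' h₁
        · exact .inr hen
      · intro j hj hj'
        rw [onStack_push hb (hblen _).le]
        rcases hj.lt_or_eq with h₁ | rfl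
        · exact .inl (hJ j h₁ hj')
        · exact .inr ⟨rfl, rfl⟩
      · intro k hk
        rw [Function.update_of_ne (by omega)]
        exact hsup' k hk
      · have := sum_range_update_add (N := n + 1) (x := s.arr 1 e) (by omega) blen
          (blen (s.arr 1 e) + 1)
        omega

end DecAPSP

/-! ### Programs that find a thin layer and append it to a candidate list. -/

namespace DecAPSP

/-- Examine the next potential predecessor of a ball vertex. -/
def examineCmd : Cmd :=
  .assign 15 (.reg 14 / .reg 2) ;;
  .assign 9 (.reg 14 - .reg 15 * .reg 2) ;;
  .ite (Expr.less 0 (.load 0 (.reg 9 * .reg 2 + .load 14 (.reg 15))) *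
      Expr.same (.load 11 (.reg 10 * .reg 2 + .reg 9)) 0)
    (.store 11 (.reg 10 * .reg 2 + .reg 9) 1 ;;
      .store 14 (.reg 13) (.reg 9) ;;
      .assign 13 (.reg 13 + 1))
    .skip ;;
  .assign 14 (.reg 14 + 1)

/-- Grow the ball around the vertex in register `8` until its boundary layer is thin. -/
def searchCmd : Cmd :=
  .assign 11 (.load 13 ((.reg 5 - 1) / .reg 4)) ;;
  .store 14 0 (.reg 8) ;;
  .store 11 (.reg 10 * .reg 2 + .reg 8) 1 ;;
  .assign 12 1 ;;
  .assign 13 1 ;;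
  .assign 14 0 ;;
  .while (Expr.less (.reg 14) (.reg 12 * .reg 2) +
      Expr.less (.reg 12) ((.reg 13 - .reg 12) * .reg 11))
    (.ite (Expr.less (.reg 14) (.reg 12 * .reg 2)) examineCmd (.assign 12 (.reg 13)))

/-- Append the boundary layer to the candidate list and release its flags. -/
def separateCmd : Cmd :=
  .assign 15 (.reg 12) ;;
  .while (Expr.less (.reg 15) (.reg 13)) (
    .assign 9 (.load 14 (.reg 15)) ;;
    .store 11 (.reg 10 * .reg 2 + .reg 9) 0 ;;
    .store 9 (.reg 10 * .reg 2 + .load 10 (.reg 10)) (.reg 9) ;;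
    .store 10 (.reg 10) (.load 10 (.reg 10) + 1) ;;
    .assign 15 (.reg 15 + 1))

/-- Separate the vertex in register `8`. -/
def growCmd : Cmd := searchCmd ;; separateCmd

theorem le_cellBound {n x : ℕ} (h : x ≤ n * n + 4 * n + 4) : x < cellBound n :=
  lt_of_le_of_lt (h.trans (sq_add_lt_stride n)) (stride_lt_cellBound n)

section search

variable {n x v q K : ℕ} {m : Mem}

/-- The machine state during a search. -/
structure Searching (n : ℕ) (m : Mem) (x v q K hi tail z i : ℕ) (s : State) : Prop where
  ambient : Ambient n s
  reg5 : s.reg 5 = K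
  reg10 : s.reg 10 = x
  reg11 : s.reg 11 = q
  reg12 : s.reg 12 = hi
  reg13 : s.reg 13 = tail
  reg14 : s.reg 14 = z
  mem : s.mem = { m with rem := s.arr 11 }
  search : Search n m x v q (s.arr 11) (s.arr 14) hi tail z i

theorem Searching.examine {hi tail z i : ℕ} {s : State}
    (h : Searching n m x v q K hi tail z i s) (hz : z < hi * n) :
    Runs (wordBound n) examineCmd s fun t s' =>
      t ≤ 60 ∧ ∃ tail', Searching n m x v q K hi tail' (z + 1) i s' := by
  obtain ⟨hA, h5, h10, h11, h12, h13, h14, hm, hS⟩ := h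
  have h2 := hA.reg2
  have a0 : s.arr 0 = m.adj := congrArg Mem.adj hm
  have hhi := hS.hi_le
  have htail := hS.tail_le
  have hzn : z / n < hi := Nat.div_lt_of_lt_mul (by rwa [Nat.mul_comm] at hz)
  have hn : 0 < n := Nat.pos_of_ne_zero (by rintro rfl; simp at hz)
  have hmod : z - z / n * n = z % n := by
    have := Nat.div_add_mod' z n
    omega
  have hmodn := Nat.mod_lt z hn
  have hzz : z < n * n := lt_of_lt_of_le hz (Nat.mul_le_mul_right _ (by omega))
  refine Runs.seq (hA.runs_assign (z / n) rfl (by norm_num) (by simp [h14, h2])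
    (le_cellBound (by omega)) fun hA => ?_)
  refine Runs.seq (hA.runs_assign (z % n) rfl (by norm_num)
    (by simp [h14, h2, hmod]) (le_cellBound (by omega)) fun hA => ?_)
  refine Runs.seq (hA.runs_ite
    (m.adj (z % n * n + s.arr 14 (z / n)) ≠ 0 ∧ s.arr 11 (x * n + z % n) = 0) rfl
    (by simp [h2, h10, a0, Nat.pos_iff_ne_zero, and_comm]) ?_ ?_)
  · rintro ⟨hadj, hrem⟩
    refine Runs.seq (hA.runs_store (x * n + z % n) 1 rfl (by norm_num) (by simp [h2, h10])
      (by simp) (le_cellBound (by omega)) fun hA => ?_)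
    refine Runs.seq (hA.runs_store tail (z % n) rfl (by norm_num) (by simp [h13])
      (by simp) (le_cellBound (by omega)) fun hA => ?_)
    refine hA.runs_assign (tail + 1) rfl (by norm_num) (by simp [h13])
      (le_cellBound (by omega)) fun hA => ?_
    refine hA.runs_assign (z + 1) rfl (by norm_num) (by simp [h14])
      (le_cellBound (by omega)) fun hA => ?_
    refine ⟨by simp, tail + 1, hA, by simpa, by simpa, by simpa, by simpa, by simp, by simp, ?_, ?_⟩
    · rw [Mem.ext_iff] at hm ⊢
      simpa using hm
    · simpa using hS.visit hz ⟨hmodn, hS.lt _ (by omega), hadj⟩ hrem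
  · intro hno
    refine ⟨_, _, .skip _, ?_⟩
    refine hA.runs_assign (z + 1) rfl (by norm_num) (by simp [h14])
      (le_cellBound (by omega)) fun hA => ?_
    refine ⟨by simp, tail, hA, by simpa, by simpa, by simpa, by simpa, by simpa, by simp, ?_, ?_⟩
    · rw [Mem.ext_iff] at hm ⊢
      simpa using hm
    · simpa using hS.skip hz fun hE hrem => hno ⟨hE.2.2, hrem⟩

/-- Each round increases `z` or `hi`, so their sum measures the time. The loop ends only when the
whole ball is explored and its layer is thin. -/
theorem Ambient.runs_search {s : State} (h : Ambient n s) {k : ℕ} (hk : s.reg 5 = k) (hkn : k ≤ n)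
    (hx : s.reg 10 = x) (hv : s.reg 8 = v) (hvn : v < n) (hrem : s.arr 11 (x * n + v) = 0) :
    Runs (wordBound n) searchCmd s fun t s' => ∃ hi tail z i, t ≤ 100 * (z + hi) ∧
      hi * n ≤ z ∧ (tail - hi) * 2 ^ lev n k ≤ hi ∧
      Searching n s.mem x v (2 ^ lev n k) k hi tail z i s' := by
  have hq : s.arr 13 ((k - 1) / (Nat.size n * 2)) = 2 ^ lev n k :=
    h.pow _ ((Nat.div_le_self _ _).trans (by omega))
  have hq1 : 1 ≤ 2 ^ lev n k := Nat.one_le_two_pow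
  refine Runs.seq (h.runs_assign (2 ^ lev n k) rfl (by norm_num) (by simp [hk, h.reg4, hq])
    (by rw [← hq]; exact h.bounded.arr _ _) fun hA => ?_)
  refine Runs.seq (hA.runs_store 0 v rfl (by norm_num) (by simp) (by simp [hv])
    (le_cellBound (by omega)) fun hA => ?_)
  refine Runs.seq (hA.runs_store (x * n + v) 1 rfl (by norm_num) (by simp [hv, hx, hA.reg2])
    (by simp) (le_cellBound (by omega)) fun hA => ?_)
  refine Runs.seq (hA.runs_assign 1 rfl (by norm_num) (by simp) (le_cellBound (by omega))
    fun hA => ?_)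
  refine Runs.seq (hA.runs_assign 1 rfl (by norm_num) (by simp) (le_cellBound (by omega))
    fun hA => ?_)
  refine Runs.seq (hA.runs_assign 0 rfl (by norm_num) (by simp) (le_cellBound (by omega))
    fun hA => ?_)
  refine Runs.while (fits n) rfl (fun τ s' => ∃ hi tail z i, τ + 80 ≤ 80 * (z + hi) ∧
    Searching n s.mem x v (2 ^ lev n k) k hi tail z i s')
    (fun s' => n * n + n - (s'.reg 14 + s'.reg 12)) ?_ ?_
  · refine ⟨1, 1, 0, 0, by simp, hA, by simpa, by simpa, by simp, by simp, by simp, by simp,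
      ?_, ?_⟩
    · ext1 <;> simp [State.mem]
    · simpa using Search.start (m := s.mem) (q := 2 ^ lev n k) hvn hrem (s.arr 14)
  · rintro τ s' ⟨hi, tail, z, i, hτ, hS⟩
    have hA := hS.ambient
    have hcond : (Expr.val s' (Expr.less (.reg 14) (.reg 12 * .reg 2) +
        Expr.less (.reg 12) ((.reg 13 - .reg 12) * .reg 11))) ≠ 0 ↔
        z < hi * n ∨ hi < (tail - hi) * 2 ^ lev n k := by
      simp only [Expr.val_add, Expr.val_less, Expr.val_reg, Expr.val_mul, Expr.val_sub, hS.reg14,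
        hS.reg12, hS.reg13, hS.reg11, hA.reg2]
      split_ifs <;> simp <;> omega
    have hhi := hS.search.hi_le
    have htail := hS.search.tail_le
    have hz_le := hS.search.z_le
    have hin : hi * n ≤ n * n := Nat.mul_le_mul_right _ (by omega)
    refine ⟨hA.bounded, fun h0 => ?_, fun h0 => ?_⟩
    · rw [← not_ne_iff, hcond] at h0
      push Not at h0
      have := hS.search.hi_pos
      exact ⟨hi, tail, z, i, by simp; omega, h0.1, h0.2, hS⟩
    · rw [hcond] at h0
      refine hA.runs_ite (z < hi * n) rfl (by simp [hS.reg14, hS.reg12, hA.reg2]) ?_ ?_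
      · intro hz
        refine (hS.examine hz).mono ?_
        rintro t s'' ⟨ht, tail', hS'⟩
        refine ⟨⟨hi, tail', z + 1, i, ?_, hS'⟩, ?_⟩
        · simp
          omega
        · rw [hS'.reg14, hS'.reg12, hS.reg14, hS.reg12]
          omega
      · intro hz
        have hlt : hi < (tail - hi) * 2 ^ lev n k := by tauto
        have hht : hi < tail := by
          by_contra hle
          rw [Nat.sub_eq_zero_of_le (not_lt.1 hle)] at hlt
          omega
        refine hA.runs_assign tail rfl (by norm_num) (by simp [hS.reg13])
          (le_cellBound (by omega)) fun hA => ?_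
        refine ⟨⟨tail, tail, z, i + 1, ?_, hA, by simp [hS.reg5], by simp [hS.reg10], by simp
            [hS.reg11], by simp, by simp [hS.reg13], by simp [hS.reg14], by simpa using hS.mem, by
            simpa using hS.search.next hlt⟩, ?_⟩
        · simp
          omega
        · simp [hS.reg14, hS.reg12]
          omega

theorem Ambient.runs_grow {s : State} (hA : Ambient n s) {u : ℕ} (hL : Lists n s.mem)
    (hP : Pairs n K s.mem) (hu : u < n) (hv : v < n) (hKn : K ≤ n)
    (hK : s.arr 1 (u * n + v) = K) (h5 : s.reg 5 = K) (h8 : s.reg 8 = v)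
    (h10 : s.reg 10 = lev n K * n + u) (hrem : s.arr 11 ((lev n K * n + u) * n + v) = 0) :
    Runs (wordBound n) growCmd s fun t s' => Ambient n s' ∧ s'.reg 5 = K ∧ Lists n s'.mem ∧
      Pairs n K s'.mem ∧ s'.mem = { s.mem with
        lst := s'.mem.lst, llen := s'.mem.llen, rem := s'.mem.rem } ∧
      t + 200 * (n + 1) * s'.mem.unseparated n ≤ 200 * (n + 1) * s.mem.unseparated n ∧
      s'.mem.unseparated n < s.mem.unseparated n := by
  refine Runs.seq ((hA.runs_search h5 hKn h10 h8 hv hrem).mono ?_)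
  rintro t₁ s₁ ⟨hi, tail, z, i, ht₁, hz, hthin, hS⟩
  have hL' := hS.search.separate hL hP hu hv hKn hK hz hthin
  have hP' := hS.search.pairs_separate hL hP hu hKn hthin
  have hx : lev n K * n + u < (Nat.size n + 1) * n := code_lt (Nat.lt_succ_of_le (lev_le hKn)) hu
  have hun := hS.search.unseparated_add_le hx
  have hlen := hS.search.llen_add_le hL hu hKn hthin
  have hhi := hS.search.hi_le
  have hpos := hS.search.hi_pos
  have htail := hS.search.tail_le
  have hz_le := hS.search.z_le
  set x := lev n K * n + u
  -- A thin layer is no larger than the ball, so copying it is also paid by the newly flagged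
  -- vertices.
  have hlayer : tail - hi ≤ hi := (Nat.le_mul_of_pos_right _ (by positivity)).trans hthin
  have hA := hS.ambient
  refine Runs.seq (hA.runs_assign hi rfl (by norm_num) (by simp [hS.reg12])
    (le_cellBound (by omega)) fun hA => ?_)
  refine Runs.while (fits n) rfl (fun τ s' => ∃ y, hi ≤ y ∧ y ≤ tail ∧ τ ≤ 40 * (y - hi) ∧
    Ambient n s' ∧ s'.reg 5 = K ∧ s'.reg 10 = x ∧ s'.reg 13 = tail ∧ s'.reg 15 = y ∧
    s'.arr 14 = s₁.arr 14 ∧ s'.mem = s.mem.separate n x (s₁.arr 11) (s₁.arr 14) hi y)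
    (fun s' => tail - s'.reg 15) ?_ ?_
  · refine ⟨hi, le_rfl, hhi, by simp, hA, by simp [hS.reg5], by simp [hS.reg10],
      by simp [hS.reg13], by simp, by simp, ?_⟩
    rw [State.mem_setReg, hS.mem]
    simp [Mem.separate, released_self, appended_self]
  · rintro τ s₂ ⟨y, hy, hyt, hτ, hA, h5, h10, h13, h15, h14, hm⟩
    have h2 := hA.reg2
    have a9 : s₂.arr 9 = appended (x * n + s.mem.llen x) s.mem.lst (s₁.arr 14) hi y :=
      congrArg Mem.lst hm
    have a10 : s₂.arr 10 = Function.update s.mem.llen x (s.mem.llen x + (y - hi)) :=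
      congrArg Mem.llen hm
    have a11 : s₂.arr 11 = released n x (s₁.arr 11) (s₁.arr 14) hi y := congrArg Mem.rem hm
    refine ⟨hA.bounded, fun h0 => ?_, fun h0 => ?_⟩
    · have hy' : y = tail := by
        simp [h15, h13] at h0
        omega
      subst hy'
      rw [hm]
      refine ⟨hA, h5, hL', hP', rfl, ?_, by omega⟩
      have h₁ := Nat.mul_le_mul_left (200 * (n + 1)) hun
      have h₂ : 200 * (n + 1) * hi = 200 * (hi * n) + 200 * hi := by ring
      rw [Nat.mul_add] at h₁
      simp
      omega
    · have hy' : y < tail := by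
        simp [h15, h13] at h0
        omega
      have hwn := hS.search.lt y hy'
      refine Runs.seq (hA.runs_assign (s₁.arr 14 y) rfl (by norm_num) (by simp [h15, h14])
        (le_cellBound (by omega)) fun hA => ?_)
      refine Runs.seq (hA.runs_store (x * n + s₁.arr 14 y) 0 rfl (by norm_num)
        (by simp [h10, h2]) (by simp) (le_cellBound (by omega)) fun hA => ?_)
      refine Runs.seq (hA.runs_store (x * n + s.mem.llen x + (y - hi)) (s₁.arr 14 y) rfl
        (by norm_num) (by simp [h10, h2, a10, Nat.add_assoc]) (by simp)
        (le_cellBound (by omega)) fun hA => ?_)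
      refine Runs.seq (hA.runs_store x (s.mem.llen x + (y + 1 - hi)) rfl
        (by norm_num) (by simp [h10]) (by simp [h10, a10]; omega)
        (le_cellBound (by omega)) fun hA => ?_)
      refine hA.runs_assign (y + 1) rfl (by norm_num) (by simp [h15])
        (le_cellBound (by omega)) fun hA => ?_
      refine ⟨⟨y + 1, by omega, by omega, ?_, hA, by simpa, by simpa, by simpa, by simp,
        by simpa, ?_⟩, ?_⟩
      · simp
        omega
      · rw [Mem.ext_iff] at hm ⊢
        simp only [Mem.separate, State.mem_adj, State.mem_D, State.mem_wit, State.mem_ptr,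
          State.mem_dep, State.mem_dlen, State.mem_bk, State.mem_blen] at hm
        simp [Mem.separate, a9, a10, a11, appended_succ _ _ _ hy, released_succ _ _ _ _ hy, hm]
      · simp [h15]
        omega

end search

end DecAPSP

namespace DecAPSP

/-! ### The potential function and the main loop -/

/-- The number of candidates that can be examined for one pair from distance `k` on. -/
def weight (n k : ℕ) : ℕ := ∑ y ∈ Finset.Ico k (n + 1), (n / 2 ^ lev n y + 1)

theorem weight_eq {n k : ℕ} (hk : k ≤ n) :
    weight n k = n / 2 ^ lev n k + 1 + weight n (k + 1) :=
  Finset.sum_eq_sum_Ico_succ_bot (Nat.lt_succ_of_le hk) _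

/-- The number of candidates that can still be examined. -/
def Mem.credit (n : ℕ) (m : Mem) : ℕ := ∑ c ∈ Finset.range (n * n), (weight n (m.D c) - m.ptr c)

/-- The number of edges. -/
def Mem.edges (n : ℕ) (m : Mem) : ℕ := ((Finset.range (n * n)).filter fun c => m.adj c ≠ 0).card

/-- The potential, which pays for all future steps. -/
def Mem.potential (n : ℕ) (m : Mem) : ℕ :=
  3000 * m.credit n + 200 * ∑ k ∈ Finset.range (n + 1), m.blen k +
    400 * ∑ c ∈ Finset.range (n * n), m.dlen c + 400 * (n + 1) * m.unseparated n +
    400 * (n + 1) * m.edges n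

/-- The invariants of the data structure when distances less than `K` are settled. -/
structure Inv (n K : ℕ) (s : State) : Prop where
  ambient : Ambient n s
  lists : Lists n s.mem
  pairs : Pairs n K s.mem
  support : Stacks n s.mem

variable {n K : ℕ}

theorem Stacks.blen_le {m : Mem} (h : Stacks n m) (k : ℕ) :
    m.blen k ≤ ∑ k ∈ Finset.range (n + 1), m.blen k := by
  by_cases hk : n < k
  · rw [h.blen k hk]
    exact Nat.zero_le _
  · exact Finset.single_le_sum (f := m.blen) (fun _ _ => Nat.zero_le _)
      (Finset.mem_range.2 (by omega))

theorem Stacks.dlen_le {m : Mem} (h : Stacks n m) (c : ℕ) :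
    m.dlen c ≤ ∑ c ∈ Finset.range (n * n), m.dlen c := by
  by_cases hk : n * n ≤ c
  · rw [h.dlen c hk]
    exact Nat.zero_le _
  · exact Finset.single_le_sum (f := m.dlen) (fun _ _ => Nat.zero_le _)
      (Finset.mem_range.2 (by omega))

theorem credit_update {N c x : ℕ} {f g : ℕ → ℕ} (hc : c < N) (hx : g c + x ≤ f c)
    (h : ∀ c' ≠ c, g c' = f c') :
    ∑ c ∈ Finset.range N, g c + x ≤ ∑ c ∈ Finset.range N, f c := by
  have h₁ : g = Function.update f c (g c) := by
    funext c'
    by_cases hc' : c' = c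
    · subst hc'; simp
    · rw [Function.update_of_ne hc', h c' hc']
  have h₂ := sum_range_update_add hc f (g c)
  rw [← h₁] at h₂
  omega

/-- Remove the top of the current bucket. -/
def popCmd : Cmd := .store 8 (.reg 5) (.load 8 (.reg 5) - 1)

/-- Try the next candidate for the current pair. -/
def advanceCmd : Cmd :=
  .assign 9 (.load 9 (.reg 10 * .reg 2 + .load 4 (.reg 6))) ;;
  .store 3 (.reg 6) (.reg 9) ;;
  .store 4 (.reg 6) (.load 4 (.reg 6) + 1) ;;
  .assign 15 (.reg 7 * .reg 2 + .reg 9) ;;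
  pushCmd 5 6 15 6 ;;
  .assign 15 (.reg 9 * .reg 2 + .reg 8) ;;
  pushCmd 5 6 15 6

/-- Increase the distance of the current pair. -/
def bumpCmd : Cmd :=
  .store 1 (.reg 6) (.reg 5 + 1) ;;
  .store 4 (.reg 6) 0 ;;
  .store 3 (.reg 6) (.reg 7) ;;
  .assign 15 (.reg 5 + 1) ;;
  pushCmd 7 8 15 6 ;;
  flushCmd

/-- Examine the pair on top of the current bucket. -/
def stepCmd : Cmd :=
  .assign 6 (.load 7 (.reg 5 * .reg 3 + (.load 8 (.reg 5) - 1))) ;;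
  .assign 7 (.reg 6 / .reg 2) ;;
  .assign 8 (.reg 6 - .reg 7 * .reg 2) ;;
  .assign 9 (.load 3 (.reg 6)) ;;
  .assign 10 (.load 12 ((.reg 5 - 1) / .reg 4) * .reg 2 + .reg 7) ;;
  .ite (Expr.same (.load 1 (.reg 6)) (.reg 5))
    (.ite (.load 0 (.reg 6) + Expr.less 0 (.load 1 (.reg 7 * .reg 2 + .reg 9)) *
        (Expr.less 0 (.load 1 (.reg 9 * .reg 2 + .reg 8)) *
          Expr.less (.load 1 (.reg 7 * .reg 2 + .reg 9) + .load 1 (.reg 9 * .reg 2 + .reg 8))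
            (.reg 5 + 1)))
      popCmd
      (.ite (Expr.less (.load 4 (.reg 6)) (.load 10 (.reg 10)))
        advanceCmd
        (.ite (Expr.same (.load 11 (.reg 10 * .reg 2 + .reg 8)) 0) growCmd bumpCmd)))
    popCmd

/-- Settle all distances from the one in register `5` on. -/
def settleCmd : Cmd :=
  .while (Expr.less (.reg 5) (.reg 2))
    (.ite (Expr.same (.load 8 (.reg 5)) 0) (.assign 5 (.reg 5 + 1)) stepCmd)

/-! ### Correctness and amortized cost of the individual steps. -/

/-- The registers hold the current pair and the number of its candidate list. -/
structure AtPair (n K u v : ℕ) (s : State) : Prop where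
  inv : Inv n K s
  one_le : 1 ≤ K
  lt : K < n
  left_lt : u < n
  right_lt : v < n
  dist : s.arr 1 (u * n + v) = K
  potential : s.mem.potential n < stride n
  reg5 : s.reg 5 = K
  reg6 : s.reg 6 = u * n + v
  reg7 : s.reg 7 = u
  reg8 : s.reg 8 = v
  reg10 : s.reg 10 = lev n K * n + u

theorem Inv.runs_pop {s : State} (h : Inv n K s) (h5 : s.reg 5 = K) (hKn : K < n)
    (hb : s.arr 8 K ≠ 0) (hpot : s.mem.potential n < stride n)
    (hc : ∀ u < n, ∀ v < n, s.arr 7 (K * stride n + (s.arr 8 K - 1)) = u * n + v →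
      s.arr 1 (u * n + v) = K → s.mem.Valid n u v) :
    Runs (wordBound n) popCmd s fun t s' => Inv n K s' ∧ s'.reg 5 = K ∧
      s'.arr 0 = s.arr 0 ∧ t + 180 + s'.mem.potential n ≤ s.mem.potential n := by
  have hS := stride_lt_cellBound n
  have hble := h.support.blen_le K
  simp only [Mem.potential, State.mem_blen] at hpot hble
  refine h.ambient.runs_store K (s.arr 8 K - 1) rfl (by norm_num) (by simp [h5]) (by simp [h5])
    (by omega) fun hA => ?_
  have hm : (s.setCell 8 K (s.arr 8 K - 1)).mem =
      { s.mem with blen := Function.update s.mem.blen K (s.mem.blen K - 1) } := by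
    ext1 <;> simp [State.mem]
  refine ⟨⟨hA, ?_, ?_, ?_⟩, by simpa, by simp, ?_⟩
  · rw [hm]
    exact { h.lists with }
  · rw [hm]
    exact h.pairs.pop hc
  · rw [hm]
    refine { h.support with blen := fun k hk => ?_ }
    dsimp only
    rw [Function.update_of_ne (by omega)]
    exact h.support.blen k hk
  · have := sum_range_update_add (N := n + 1) (x := K) (by omega) (s.arr 8) (s.arr 8 K - 1)
    rw [hm]
    simp [Mem.potential, Mem.credit, Mem.edges, Mem.unseparated]
    omega

/-- One unit of credit, worth `3000`, pays for two new dependents at `400` each and for the constant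
time. -/
theorem AtPair.runs_advance {u v : ℕ} {s : State} (h : AtPair n K u v s)
    (hval : ¬ s.mem.Valid n u v) (hb : s.mem.Bk n K (u * n + v))
    (hptr : s.arr 4 (u * n + v) < s.arr 10 (lev n K * n + u)) :
    Runs (wordBound n) advanceCmd s fun t s' => Inv n K s' ∧ s'.reg 5 = K ∧
      s'.arr 0 = s.arr 0 ∧ t + 180 + s'.mem.potential n ≤ s.mem.potential n := by
  obtain ⟨hI, hK₁, hKn, hu, hv, hK, hpot, h5, h6, h7, h8, h10⟩ := h
  have hA := hI.ambient
  have h2 := hA.reg2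
  have hS := stride_lt_cellBound n
  have hS' := sq_add_lt_stride n
  have hlev := lev_le hKn.le
  obtain ⟨w, hw⟩ : ∃ w, s.arr 9 ((lev n K * n + u) * n + s.arr 4 (u * n + v)) = w := ⟨_, rfl⟩
  have hwn : w < n := hI.lists.lt _ hlev u hu w ⟨_, hptr, hw⟩
  have hllen := hI.lists.llen_le hlev hu
  have hcode := code_lt hu hv
  have huw := code_lt hu hwn
  have hwv := code_lt hwn hv
  rw [State.mem_llen] at hllen
  have hsum : 400 * ∑ c ∈ Finset.range (n * n), s.arr 6 c < stride n := by
    simp only [Mem.potential, State.mem_dlen] at hpot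
    omega
  have hdlen : ∀ c, s.arr 6 c + 2 < stride n := by
    intro c
    have := hI.support.dlen_le c
    simp only [State.mem_dlen] at this
    omega
  have hd₁ := hdlen (u * n + w)
  have hdlen' : ∀ c, Function.update (s.arr 6) (u * n + w) (s.arr 6 (u * n + w) + 1) c + 1 <
      stride n := by
    intro c
    have := hdlen c
    rw [Function.update_apply]
    split_ifs <;> omega
  have hd₂ := hdlen' (w * n + v)
  refine Runs.seq (hA.runs_assign w rfl (by norm_num) (by simp [h10, h2, h6, hw])
    (le_cellBound (by omega)) fun hA => ?_)
  refine Runs.seq (hA.runs_store (u * n + v) w rfl (by norm_num) (by simp [h6]) (by simp)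
    (le_cellBound (by omega)) fun hA => ?_)
  refine Runs.seq (hA.runs_store (u * n + v) (s.arr 4 (u * n + v) + 1) rfl (by norm_num)
    (by simp [h6]) (by simp [h6]) (le_cellBound (by omega)) fun hA => ?_)
  refine Runs.seq (hA.runs_assign (u * n + w) rfl (by norm_num) (by simp [h7, h2])
    (le_cellBound (by omega)) fun hA => ?_)
  refine Runs.seq (hA.runs_push (by norm_num) (by norm_num) (by norm_num) (u * n + w) (u * n + v)
    (by simp) (by simp [h6]) (by simp; omega) fun hA => ?_)
  refine Runs.seq (hA.runs_assign (w * n + v) rfl (by norm_num) (by simp [h8, h2])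
    (le_cellBound (by omega)) fun hA => ?_)
  refine hA.runs_push (by norm_num) (by norm_num) (by norm_num) (w * n + v) (u * n + v)
    (by simp) (by simp [h6]) (by simp; omega) fun hA => ?_
  generalize hs' : State.setCell _ 6 (w * n + v) _ = s' at hA ⊢
  set dlen₁ := Function.update (s.arr 6) (u * n + w) (s.arr 6 (u * n + w) + 1) with hdl
  set dep₁ := Function.update (s.arr 5) ((u * n + w) * stride n + s.arr 6 (u * n + w)) (u * n + v)
    with hde
  have hm : s'.mem = { s.mem with
      wit := Function.update s.mem.wit (u * n + v) w
      ptr := Function.update s.mem.ptr (u * n + v) (s.mem.ptr (u * n + v) + 1)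
      dep := Function.update dep₁ ((w * n + v) * stride n + dlen₁ (w * n + v)) (u * n + v)
      dlen := Function.update dlen₁ (w * n + v) (dlen₁ (w * n + v) + 1) } := by
    rw [← hs']
    ext1 <;> simp [State.mem, hdl, hde]
  have hs5 : s'.reg 5 = K := by simp [← hs', h5]
  refine ⟨⟨hA, ?_, ?_, ?_⟩, hs5, congrArg Mem.adj hm, ?_⟩
  · rw [hm]
    exact { hI.lists with }
  · rw [hm]
    refine hI.pairs.advance hu hv hwn hKn hK hval hptr hw ?_ hb
    intro c e
    rw [onStack_push (by omega) (by have := hdlen' c; omega),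
      onStack_push (by omega) (by have := hdlen c; omega)]
    rw [or_and_right, or_assoc]
    rfl
  · rw [hm]
    refine { hI.support with dlen := fun c hc => ?_ }
    dsimp only
    rw [Function.update_of_ne (by omega), hdl, Function.update_of_ne (by omega)]
    exact hI.support.dlen c hc
  · have e₁ := sum_range_update_add huw (s.arr 6) (s.arr 6 (u * n + w) + 1)
    have e₂ := sum_range_update_add hwv dlen₁ (dlen₁ (w * n + v) + 1)
    rw [← hdl] at e₁
    -- The list has at most `n / 2 ^ lev n K` entries, so the position is still below the weight and
    -- the truncated difference really drops.
    have hcr : s'.mem.credit n + 1 ≤ s.mem.credit n := by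
      refine credit_update hcode ?_ ?_
      · have h₁ := weight_eq hKn.le
        have h₂ := (Nat.le_div_iff_mul_le (by positivity)).2 (hI.lists.card _ hlev u hu)
        rw [State.mem_llen] at h₂
        rw [hm]
        simp [hK]
        omega
      · intro c hc
        rw [hm]
        simp [Function.update_of_ne hc]
    have hun : s'.mem.unseparated n = s.mem.unseparated n := by
      rw [hm]
      rfl
    have hed : s'.mem.edges n = s.mem.edges n := by
      rw [hm]
      rfl
    have hbl : s'.mem.blen = s.mem.blen := by
      rw [hm]
    have hdd : s'.mem.dlen = Function.update dlen₁ (w * n + v) (dlen₁ (w * n + v) + 1) := by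
      rw [hm]
    unfold Mem.potential
    rw [hun, hed, hbl, hdd]
    simp
    omega

/-- A dependent carries `400` units, of which `200` go to its bucket entry and at most `100` to the
time of moving it. The old entry in bucket `K` remains and is discarded later as outdated. -/
theorem AtPair.runs_bump {u v : ℕ} {s : State} (h : AtPair n K u v s)
    (hval : ¬ s.mem.Valid n u v)
    (hptr : s.arr 10 (lev n K * n + u) ≤ s.arr 4 (u * n + v))
    (hrem : s.arr 11 ((lev n K * n + u) * n + v) ≠ 0) :
    Runs (wordBound n) bumpCmd s fun t s' => Inv n K s' ∧ s'.reg 5 = K ∧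
      s'.arr 0 = s.arr 0 ∧ t + 180 + s'.mem.potential n ≤ s.mem.potential n := by
  obtain ⟨hI, hK₁, hKn, hu, hv, hK, hpot, h5, h6, h7, h8, h10⟩ := h
  have hA := hI.ambient
  have hS := stride_lt_cellBound n
  have hS' := sq_add_lt_stride n
  have hcode := code_lt hu hv
  have hlev := lev_le hKn.le
  have hsum : 400 * ∑ c ∈ Finset.range (n * n), s.arr 6 c +
      200 * ∑ k ∈ Finset.range (n + 1), s.arr 8 k < stride n := by
    simp only [Mem.potential, State.mem_dlen, State.mem_blen] at hpot
    omega
  have hblen : ∀ k, s.arr 8 k + 1 < stride n := by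
    intro k
    have := hI.support.blen_le k
    simp only [State.mem_blen] at this
    omega
  have hdle := hI.support.dlen_le (u * n + v)
  simp only [State.mem_dlen] at hdle
  have hb₁ := hblen (K + 1)
  have hss := sum_range_update_add (N := n + 1) (x := K + 1) (by omega) (s.arr 8)
    (s.arr 8 (K + 1) + 1)
  refine Runs.seq (hA.runs_store (u * n + v) (K + 1) rfl (by norm_num) (by simp [h6])
    (by simp [h5]) (le_cellBound (by omega)) fun hA => ?_)
  refine Runs.seq (hA.runs_store (u * n + v) 0 rfl (by norm_num) (by simp [h6])
    (by simp) (le_cellBound (by omega)) fun hA => ?_)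
  refine Runs.seq (hA.runs_store (u * n + v) u rfl (by norm_num) (by simp [h6])
    (by simp [h7]) (le_cellBound (by omega)) fun hA => ?_)
  refine Runs.seq (hA.runs_assign (K + 1) rfl (by norm_num) (by simp [h5])
    (le_cellBound (by omega)) fun hA => ?_)
  refine Runs.seq (hA.runs_push (by norm_num) (by norm_num) (by norm_num) (K + 1) (u * n + v)
    (by simp) (by simp [h6]) (by simp; omega) fun hA => ?_)
  generalize hs₁ : State.setCell _ 8 (K + 1) _ = s₁ at hA ⊢
  set blen₁ := Function.update (s.arr 8) (K + 1) (s.arr 8 (K + 1) + 1) with hbl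
  set bk₁ := Function.update (s.arr 7) ((K + 1) * stride n + s.arr 8 (K + 1)) (u * n + v) with hbk
  have hm : s₁.mem = { s.mem with
      D := Function.update s.mem.D (u * n + v) (K + 1)
      wit := Function.update s.mem.wit (u * n + v) u
      ptr := Function.update s.mem.ptr (u * n + v) 0
      bk := bk₁
      blen := blen₁ } := by
    rw [← hs₁]
    ext1 <;> simp [State.mem, hbl, hbk]
  have hr5 : s₁.reg 5 = K := by simp [← hs₁, h5]
  have hr6 : s₁.reg 6 = u * n + v := by simp [← hs₁, h6]
  have a1 : s₁.arr 1 = Function.update (s.arr 1) (u * n + v) (K + 1) := congrArg Mem.D hm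
  have a5 : s₁.mem.dep = s.mem.dep := by rw [hm]
  have a6 : s₁.mem.dlen = s.mem.dlen := by rw [hm]
  have a6' : s₁.arr 6 = s.arr 6 := a6
  have a8 : s₁.arr 8 = blen₁ := congrArg Mem.blen hm
  have a7 : s₁.arr 7 = bk₁ := congrArg Mem.bk hm
  have hDep : ∀ c e, s₁.mem.Dep n c e ↔ s.mem.Dep n c e := by
    intro c e
    unfold Mem.Dep
    rw [a5, a6]
  have hBk : ∀ k e, s₁.mem.Bk n k e ↔ s.mem.Bk n k e ∨ k = K + 1 ∧ e = u * n + v := by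
    intro k e
    unfold Mem.Bk
    rw [State.mem_bk, State.mem_blen, a7, a8, hbl, hbk,
      onStack_push (by omega) (by have := hblen k; omega)]
    rfl
  refine (hA.runs_flush hr6 ?_ ?_ ?_ ?_).mono ?_
  · intro e he
    rw [a1, Function.update_apply]
    split_ifs
    · omega
    · obtain ⟨a, b, ha, hb, rfl⟩ := exists_code he
      exact hI.pairs.le a ha b hb
  · intro e he
    exact hI.pairs.dep_lt _ e ((hDep _ e).1 he)
  · intro k hk
    rw [a8, hbl, Function.update_of_ne (by omega)]
    exact hI.support.blen k hk
  · rw [a8, a6']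
    omega
  · rintro t s₂ ⟨ht, hA, h5', bk₂, blen₂, hm₂, hB, hB', hflush, hsup, hsum₂⟩
    rw [a6'] at ht hsum₂
    rw [a8] at hsum₂
    have hm' : s₂.mem = { s.mem with
        D := Function.update s.mem.D (u * n + v) (K + 1)
        wit := Function.update s.mem.wit (u * n + v) u
        ptr := Function.update s.mem.ptr (u * n + v) 0
        bk := bk₂
        blen := blen₂
        dep := s.mem.dep
        dlen := Function.update s.mem.dlen (u * n + v) 0 } := by
      rw [hm₂, hm]
    refine ⟨⟨hA, ?_, ?_, ?_⟩, by rw [h5', hr5], congrArg Mem.adj hm', ?_⟩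
    · rw [hm']
      exact { hI.lists with }
    · rw [hm']
      refine hI.pairs.bump hI.lists hu hv hKn hK₁ hK hval hptr hrem ?_ ?_ ?_ ?_ ?_ ?_
      · exact fun k e he => hB k e ((hBk k e).2 (.inl he))
      · exact hB _ _ ((hBk _ _).2 (.inr ⟨rfl, rfl⟩))
      · intro e hne he
        have := hflush e ((hDep _ _).2 he)
        rwa [a1, Function.update_of_ne hne] at this
      · intro k e he
        rcases hB' k e he with h₁ | h₁
        · rcases (hBk k e).1 h₁ with h₂ | ⟨_, rfl⟩
          · exact hI.pairs.bk_lt k e h₂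
          · exact hcode
        · exact h₁
      · rintro c e hc ⟨j, hj, he⟩
        exact ⟨j, by rwa [Function.update_of_ne hc], he⟩
      · rintro c e ⟨j, hj, he⟩
        refine hI.pairs.dep_lt c e ⟨j, lt_of_lt_of_le hj ?_, he⟩
        rw [Function.update_apply]
        split_ifs <;> omega
    · rw [hm']
      refine ⟨hsup, fun c hc => ?_⟩
      dsimp only
      rw [Function.update_of_ne (by omega)]
      exact hI.support.dlen c hc
    · have e₁ := sum_range_update_add hcode (s.arr 6) 0
      -- Resetting the position gives back at most `n / 2 ^ lev n K`, while the weight loses one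
      -- more than this; the extra unit pays for the raise.
      have hcr : s₂.mem.credit n + 1 ≤ s.mem.credit n := by
        refine credit_update hcode ?_ ?_
        · have h₁ := weight_eq hKn.le
          have h₂ := (Nat.le_div_iff_mul_le (by positivity)).2 (hI.lists.card _ hlev u hu)
          have h₃ := hI.pairs.ptr_le u hu v hv
          simp only [State.mem_llen, State.mem_ptr, State.mem_D, hK] at h₂ h₃
          rw [hm']
          simp [hK]
          omega
        · intro c hc
          rw [hm']
          simp [Function.update_of_ne hc]
      have hun : s₂.mem.unseparated n = s.mem.unseparated n := by
        rw [hm']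
        rfl
      have hed : s₂.mem.edges n = s.mem.edges n := by
        rw [hm']
        rfl
      have hbl' : s₂.mem.blen = blen₂ := by
        rw [hm']
      have hdd : s₂.mem.dlen = Function.update (s.arr 6) (u * n + v) 0 := by
        rw [hm']
        rfl
      unfold Mem.potential
      rw [hun, hed, hbl', hdd, hsum₂]
      simp
      omega

theorem Inv.runs_step {s : State} (hI : Inv n K s) (h5 : s.reg 5 = K) (hK₁ : 1 ≤ K) (hKn : K < n)
    (hb : s.arr 8 K ≠ 0) (hpot : s.mem.potential n < stride n) :
    Runs (wordBound n) stepCmd s fun t s' => Inv n K s' ∧ s'.reg 5 = K ∧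
      s'.arr 0 = s.arr 0 ∧ t + 20 + s'.mem.potential n ≤ s.mem.potential n := by
  have hA := hI.ambient
  have h2 := hA.reg2
  have h3 := hA.reg3
  have h4 := hA.reg4
  have hlev := lev_le hKn.le
  have hsize := size_le n
  obtain ⟨c, hc⟩ : ∃ c, s.arr 7 (K * stride n + (s.arr 8 K - 1)) = c := ⟨_, rfl⟩
  have hBk : s.mem.Bk n K c := ⟨s.arr 8 K - 1, by simp; omega, hc⟩
  obtain ⟨u, v, hu, hv, rfl⟩ := exists_code (hI.pairs.bk_lt K c hBk)
  have hcode := code_lt hu hv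
  have hdiv : (u * n + v) / n = u := code_div hv
  have hsub : u * n + v - u * n = v := by omega
  obtain ⟨w, hw⟩ : ∃ w, s.arr 3 (u * n + v) = w := ⟨_, rfl⟩
  have hwn : w < n := hw ▸ hI.pairs.wit_lt u hu v hv
  have hx : lev n K * n + u < (n + 1) * n := code_lt (by omega) hu
  have hx' : (n + 1) * n = n * n + n := by ring
  have hsz : s.arr 12 ((K - 1) / (Nat.size n * 2)) = lev n K :=
    hA.size _ ((Nat.div_le_self _ _).trans (by omega))
  refine Runs.seq (hA.runs_assign (u * n + v) rfl (by norm_num) (by simp [h5, h3, hc])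
    (le_cellBound (by omega)) fun hA => ?_)
  refine Runs.seq (hA.runs_assign u rfl (by norm_num) (by simp [h2, hdiv])
    (le_cellBound (by omega)) fun hA => ?_)
  refine Runs.seq (hA.runs_assign v rfl (by norm_num) (by simp [h2])
    (le_cellBound (by omega)) fun hA => ?_)
  refine Runs.seq (hA.runs_assign w rfl (by norm_num) (by simp [hw])
    (le_cellBound (by omega)) fun hA => ?_)
  refine Runs.seq (hA.runs_assign (lev n K * n + u) rfl (by norm_num) (by simp [h5, h2, h4, hsz])
    (le_cellBound (by omega)) fun hA => ?_)
  generalize hs₁ : State.setReg _ 10 _ = s₁ at hA ⊢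
  have harr : s₁.arr = s.arr := by rw [← hs₁]; rfl
  have h_arr : s₁.arr 0 = s.arr 0 := by rw [harr]
  have hm : s₁.mem = s.mem := by rw [← hs₁]; rfl
  have r5 : s₁.reg 5 = K := by simp [← hs₁, h5]
  have r6 : s₁.reg 6 = u * n + v := by simp [← hs₁]
  have r7 : s₁.reg 7 = u := by simp [← hs₁]
  have r8 : s₁.reg 8 = v := by simp [← hs₁]
  have r9 : s₁.reg 9 = w := by simp [← hs₁]
  have r10 : s₁.reg 10 = lev n K * n + u := by simp [← hs₁]
  have r2 := hA.reg2
  have hI₁ : Inv n K s₁ := ⟨hA, hm ▸ hI.lists, hm ▸ hI.pairs, hm ▸ hI.support⟩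
  rw [← hm] at hpot hBk ⊢
  have hb₁ : s₁.arr 8 K ≠ 0 := by rwa [harr]
  have hc₁ : s₁.arr 7 (K * stride n + (s₁.arr 8 K - 1)) = u * n + v := by rwa [harr]
  have hw₁ : s₁.arr 3 (u * n + v) = w := by rwa [harr]
  refine hA.runs_ite (s₁.arr 1 (u * n + v) = K) rfl (by simp [r6, r5]) ?_ ?_
  · intro hK
    have hat : AtPair n K u v s₁ :=
      ⟨hI₁, hK₁, hKn, hu, hv, hK, hpot, r5, r6, r7, r8, r10⟩
    refine hA.runs_ite (s₁.mem.Valid n u v) rfl ?_ ?_ ?_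
    · simp only [Expr.val_add, Expr.val_load, Expr.val_mul, Expr.val_less, Expr.val_reg, r2, r5,
        r6, r7, r8, r9, Expr.val_zero, Expr.val_one, Mem.Valid, Mem.Good, State.mem_adj,
        State.mem_D, State.mem_wit, hw₁, hK, Nat.lt_succ_iff]
      split_ifs <;> simp_all
    · intro hval
      refine (hI₁.runs_pop r5 hKn hb₁ hpot ?_).mono ?_
      · intro a ha b hb hab _
        rw [hc₁, code_inj hv hb] at hab
        rwa [← hab.1, ← hab.2]
      · rintro t s' ⟨h₁, h₂, h₀, h₃⟩
        refine ⟨h₁, h₂, h₀.trans h_arr, ?_⟩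
        simp
        omega
    · intro hval
      refine hA.runs_ite (s₁.arr 4 (u * n + v) < s₁.arr 10 (lev n K * n + u)) rfl
        (by simp [r6, r10]) ?_ ?_
      · intro hptr
        refine (hat.runs_advance hval hBk hptr).mono ?_
        rintro t s' ⟨h₁, h₂, h₀, h₃⟩
        refine ⟨h₁, h₂, h₀.trans h_arr, ?_⟩
        simp
        omega
      · intro hptr
        refine hA.runs_ite (s₁.arr 11 ((lev n K * n + u) * n + v) = 0) rfl
          (by simp [r2, r8, r10]) ?_ ?_
        · intro hrem
          refine (hA.runs_grow hI₁.lists hI₁.pairs hu hv hKn.le hK r5 r8 r10 hrem).mono ?_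
          rintro t s' ⟨hA', h5', hL', hP', hm', ht, hlt⟩
          refine ⟨⟨hA', hL', hP', ?_⟩, h5', (congrArg Mem.adj hm').trans h_arr, ?_⟩
          · rw [hm']
            exact { hI₁.support with }
          · have e₁ : s'.mem.credit n = s₁.mem.credit n := by rw [hm']; rfl
            have e₂ : s'.mem.edges n = s₁.mem.edges n := by rw [hm']; rfl
            have e₃ : s'.mem.blen = s₁.mem.blen := by rw [hm']
            have e₄ : s'.mem.dlen = s₁.mem.dlen := by rw [hm']
            unfold Mem.potential
            rw [e₁, e₂, e₃, e₄]
            -- Half of the drop in the number of unflagged vertices pays for the search. The other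
            -- half is at least `200 * (n + 1)` and covers the constant overhead of the step.
            have h₁ := Nat.mul_le_mul_left (200 * (n + 1)) (Nat.succ_le_of_lt hlt)
            rw [Nat.succ_eq_add_one, Nat.mul_add] at h₁
            have h₂ : 400 * (n + 1) * s'.mem.unseparated n =
              2 * (200 * (n + 1) * s'.mem.unseparated n) := by ring
            have h₃ : 400 * (n + 1) * s₁.mem.unseparated n =
              2 * (200 * (n + 1) * s₁.mem.unseparated n) := by ring
            rw [h₂, h₃]
            simp
            omega
        · intro hrem
          refine (hat.runs_bump hval (not_lt.1 hptr) hrem).mono ?_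
          rintro t s' ⟨h₁, h₂, h₀, h₃⟩
          refine ⟨h₁, h₂, h₀.trans h_arr, ?_⟩
          simp
          omega
  · intro hK
    refine (hI₁.runs_pop r5 hKn hb₁ hpot ?_).mono ?_
    · intro a ha b hb hab hK'
      rw [hc₁, code_inj hv hb] at hab
      rw [← hab.1, ← hab.2] at hK'
      exact absurd hK' hK
    · rintro t s' ⟨h₁, h₂, h₀, h₃⟩
      refine ⟨h₁, h₂, h₀.trans h_arr, ?_⟩
      simp
      omega

theorem Pairs.settled {m : Mem} (h : Pairs n K m) (hK : n ≤ K) : Pairs n n m :=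
  { h with
    valid := fun u hu v hv huv hn => (h.valid u hu v hv huv hn).imp_right fun h' => by omega }

/-- The potential pays for all examinations of pairs. Only the passage through the values `K` is
charged separately, with `200` units each. Bucket `n` is never examined, since the value `n` means
infinity. -/
theorem Inv.runs_settle {s : State} (hI : Inv n 1 s) (h5 : s.reg 5 = 1)
    (hpot : s.mem.potential n < stride n) :
    Runs (wordBound n) settleCmd s fun t s' => Inv n n s' ∧
      s'.arr 0 = s.arr 0 ∧ s'.mem.potential n ≤ s.mem.potential n ∧
      t + s'.mem.potential n ≤ s.mem.potential n + 200 * n + 10 := by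
  refine Runs.while (fits n) rfl (fun τ s' => ∃ K, 1 ≤ K ∧ Inv n K s' ∧ s'.reg 5 = K ∧ s'.arr 0 =
      s.arr 0 ∧
      s'.mem.potential n ≤ s.mem.potential n ∧
      τ + s'.mem.potential n + 200 * (n - K) ≤ s.mem.potential n + 200 * n)
    (fun s' => s'.mem.potential n + (n - s'.reg 5)) ?_ ?_
  · exact ⟨1, le_rfl, hI, h5, rfl, le_rfl, by omega⟩
  · rintro τ s' ⟨K, hK₁, hI, h5, ha, hp, hτ⟩
    have h2 := hI.ambient.reg2
    refine ⟨hI.ambient.bounded, fun h0 => ?_, fun h0 => ?_⟩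
    · have hK : n ≤ K := by simpa [h5, h2] using h0
      refine ⟨⟨hI.ambient, hI.lists, hI.pairs.settled hK, hI.support⟩, ha, hp, ?_⟩
      simp [Expr.less, Expr.cost]
      omega
    · have hK : K < n := by simpa [h5, h2] using h0
      refine hI.ambient.runs_ite (s'.arr 8 K = 0) rfl (by simp [h5]) ?_ ?_
      · intro hb
        refine hI.ambient.runs_assign (K + 1) rfl (by norm_num) (by simp [h5])
          (le_cellBound (by omega)) fun hA => ?_
        refine ⟨⟨K + 1, by omega, ⟨hA, hI.lists, hI.pairs.succ hb, hI.support⟩, by simp,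
          by simpa, by simpa, ?_⟩, ?_⟩
        · simp
          omega
        · simp [h5]
          omega
      · intro hb
        refine (hI.runs_step h5 hK₁ hK hb (by omega)).mono ?_
        rintro t s'' ⟨hI', h5', ha', ht⟩
        refine ⟨⟨K, hK₁, hI', h5', ha'.trans ha, by omega, ?_⟩, ?_⟩
        · simp
          omega
        · rw [h5, h5']
          omega

end DecAPSP

namespace DecAPSP

/-! ### Initialization and deletion -/

/-- Compute the constants and the tables. -/
def tablesCmd : Cmd :=
  .assign 2 (.reg 0) ;;
  .assign 3 (.reg 2 + 2) ;;
  .assign 3 (.reg 3 * .reg 3) ;;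
  .assign 3 (.reg 3 * .reg 3) ;;
  .assign 3 (.reg 3 * .reg 3) ;;
  .assign 3 (.reg 3 * .reg 3) ;;
  .assign 3 (.reg 3 * .reg 3) ;;
  .store 13 0 1 ;;
  .assign 5 1 ;;
  .while (Expr.less (.reg 5) (.reg 2 + 1)) (
    .store 12 (.reg 5) (.load 12 (.reg 5 / 2) + 1) ;;
    .store 13 (.reg 5) (.load 13 (.reg 5 / 2) * 2) ;;
    .assign 5 (.reg 5 + 1)) ;;
  .assign 4 (.load 12 (.reg 2) * 2)

/-- Set up all pairs as if the graph were complete. -/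
def pairsCmd : Cmd :=
  .assign 6 0 ;;
  .while (Expr.less (.reg 6) (.reg 2 * .reg 2)) (
    .assign 7 (.reg 6 / .reg 2) ;;
    .assign 8 (.reg 6 - .reg 7 * .reg 2) ;;
    .store 9 (.reg 6) (.reg 8) ;;
    .store 11 (.reg 6) 1 ;;
    .store 3 (.reg 6) (.reg 7) ;;
    .store 1 (.reg 6) (1 - Expr.same (.reg 7) (.reg 8)) ;;
    .store 10 (.reg 7) (.reg 2) ;;
    .store 7 (.reg 3 + .reg 6) (.reg 6) ;;
    .assign 6 (.reg 6 + 1)) ;;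
  .store 8 1 (.reg 2 * .reg 2) ;;
  .assign 5 1

/-- The initialization. -/
def initCmd : Cmd := tablesCmd ;; pairsCmd ;; settleCmd

/-- The deletion of an edge. -/
def deleteCmd : Cmd :=
  .assign 6 (.reg 0 * .reg 2 + .reg 1) ;;
  .store 0 (.reg 6) 0 ;;
  .assign 15 1 ;;
  pushCmd 7 8 15 6 ;;
  .assign 5 1 ;;
  settleCmd

theorem size_eq_size_half_add_one {i : ℕ} (hi : 1 ≤ i) : Nat.size i = Nat.size (i / 2) + 1 := by
  have h := Nat.size_bit (b := i.bodd) (n := i.div2) (by rw [Nat.bit_bodd_div2]; omega)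
  rwa [Nat.bit_bodd_div2, Nat.div2_val] at h

theorem pow_lt_cellBound {n k : ℕ} (hk : k ≤ 32) : (n + 2) ^ k < cellBound n :=
  lt_of_le_of_lt (Nat.pow_le_pow_right (by omega) hk) (stride_lt_cellBound n)

variable {n : ℕ}

theorem runs_tables {s : State} (hs : Bounded (cellBound n) s) (h0 : s.reg 0 = n)
    (h12 : s.arr 12 0 = 0) :
    Runs (wordBound n) tablesCmd s fun t s' => t ≤ 100 * (n + 1) ∧ Ambient n s' ∧
      ∀ a, a ≠ 12 → a ≠ 13 → s'.arr a = s.arr a := by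
  have hF := fits n
  refine Runs.seq (Runs.assign hF hs (x := n) rfl (by simp [h0]) (le_cellBound (by omega))
    fun hs => ?_)
  refine Runs.seq (Runs.assign hF hs (x := (n + 2) ^ 1) rfl (by simp)
    (pow_lt_cellBound (by norm_num)) fun hs => ?_)
  refine Runs.seq (Runs.assign hF hs (x := (n + 2) ^ 2) rfl (by simp; ring)
    (pow_lt_cellBound (by norm_num)) fun hs => ?_)
  refine Runs.seq (Runs.assign hF hs (x := (n + 2) ^ 4) rfl (by simp; ring)
    (pow_lt_cellBound (by norm_num)) fun hs => ?_)
  refine Runs.seq (Runs.assign hF hs (x := (n + 2) ^ 8) rfl (by simp; ring)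
    (pow_lt_cellBound (by norm_num)) fun hs => ?_)
  refine Runs.seq (Runs.assign hF hs (x := (n + 2) ^ 16) rfl (by simp; ring)
    (pow_lt_cellBound (by norm_num)) fun hs => ?_)
  refine Runs.seq (Runs.assign hF hs (x := stride n) rfl (by simp [stride]; ring)
    (stride_lt_cellBound n) fun hs => ?_)
  refine Runs.seq (Runs.store hF hs (i := 0) (x := 1) rfl rfl (by simp) (by simp)
    (le_cellBound (by omega)) fun hs => ?_)
  refine Runs.seq (Runs.assign hF hs (x := 1) rfl (by simp) (le_cellBound (by omega))
    fun hs => ?_)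
  refine Runs.seq (Runs.while hF rfl (fun τ s' => Bounded (cellBound n) s' ∧ s'.reg 2 = n ∧
    s'.reg 3 = stride n ∧ (∀ a, a ≠ 12 → a ≠ 13 → s'.arr a = s.arr a) ∧
    ∃ i, s'.reg 5 = i ∧ 1 ≤ i ∧ i ≤ n + 1 ∧ τ ≤ 40 * (i - 1) ∧
    (∀ j < i, s'.arr 12 j = Nat.size j ∧ s'.arr 13 j = 2 ^ Nat.size j))
    (fun s' => n + 1 - s'.reg 5) ?_ ?_)
  · refine ⟨hs, by simp, by simp, by simp +contextual, 1, by simp, le_rfl, by omega, by omega,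
      fun j hj => ?_⟩
    have hj0 : j = 0 := by omega
    subst hj0
    simp [h12]
  · rintro τ s₁ ⟨hs, r2, r3, harr, i, r5, hi, hin, hτ, htab⟩
    refine ⟨hs, fun h0 => ?_, fun h0 => ?_⟩
    · have hi' : i = n + 1 := by
        simp [r2, r5] at h0
        omega
      subst hi'
      have h12 : ∀ j ≤ n, s₁.arr 12 j = Nat.size j := fun j hj => (htab j (by omega)).1
      have h13 : ∀ j ≤ n, s₁.arr 13 j = 2 ^ Nat.size j := fun j hj => (htab j (by omega)).2
      have hsize := size_le n
      refine Runs.assign hF hs (x := Nat.size n * 2) rfl (by simp [r2, h12])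
        (le_cellBound (by omega)) fun hs => ?_
      refine ⟨?_, ⟨by simpa, by simpa, by simp, h12, h13, hs⟩, harr⟩
      simp
      omega
    · have hi' : i ≤ n := by
        simp [r2, r5] at h0
        omega
      have h₁ := htab (i / 2) (by omega)
      have h₂ := size_eq_size_half_add_one hi
      have h₃ : Nat.size i ≤ n := (Nat.size_le_size hi').trans (size_le n)
      have h₄ : 2 ^ Nat.size i ≤ 2 * n + 1 :=
        (two_pow_size_le i).trans (by omega)
      refine Runs.seq (Runs.store hF hs (i := i) (x := Nat.size i) rfl rfl (by simp [r5])
        (by simp [r5, h₁.1, h₂]) (le_cellBound (by omega)) fun hs => ?_)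
      refine Runs.seq (Runs.store hF hs (i := i) (x := 2 ^ Nat.size i) rfl rfl (by simp [r5])
        (by simp [r5, h₁.2, h₂, pow_succ]) (le_cellBound (by omega)) fun hs => ?_)
      refine Runs.assign hF hs (x := i + 1) rfl (by simp [r5]) (le_cellBound (by omega))
        fun hs => ?_
      refine ⟨⟨hs, by simpa, by simpa, ?_, i + 1, by simp, by omega, by omega, ?_, ?_⟩, ?_⟩
      · intro a h₁ h₂
        simp [h₁, h₂, harr]
      · simp
        omega
      · intro j hj
        by_cases hji : j = i
        · subst hji
          simp
        · simpa [hji] using htab j (by omega)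
      · simp [r5]
        omega

/-- The memory when all distances between different vertices are set to `1` and all pairs are in
the first bucket. -/
structure Initial (n : ℕ) (m : Mem) : Prop where
  D : ∀ u < n, ∀ v < n, m.D (u * n + v) = if u = v then 0 else 1
  wit : ∀ u < n, ∀ v < n, m.wit (u * n + v) = u
  ptr : ∀ c, m.ptr c = 0
  dlen : ∀ c, m.dlen c = 0
  bk : ∀ c < n * n, m.bk (1 * stride n + c) = c
  blen : m.blen = Function.update (fun _ => 0) 1 (n * n)
  lst : ∀ u < n, ∀ v < n, m.lst (u * n + v) = v
  llen : ∀ u < n, m.llen u = n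
  llen_eq_zero : ∀ u, n ≤ u → m.llen u = 0
  rem : ∀ c < n * n, m.rem c ≠ 0
  rem_eq_zero : ∀ c, n * n ≤ c → m.rem c = 0

theorem le_mul_add {j u n : ℕ} (hj : 1 ≤ j) : n ≤ j * n + u :=
  (Nat.le_mul_of_pos_left n hj).trans (Nat.le_add_right _ _)

/-- On level `0` the lists are complete and everything is flagged; on all other levels nothing is
flagged and the lists are empty, so separation is vacuous. -/
theorem Initial.lists {m : Mem} (h : Initial n m) : Lists n m := by
  have hz : ∀ j, 1 ≤ j → ∀ u v, m.rem ((j * n + u) * n + v) = 0 := fun j hj u v =>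
    h.rem_eq_zero _ ((Nat.mul_le_mul_right n (le_mul_add hj)).trans (Nat.le_add_right _ _))
  have hl : ∀ j, 1 ≤ j → ∀ u, m.llen (j * n + u) = 0 := fun j hj u =>
    h.llen_eq_zero _ (le_mul_add hj)
  have hc : ∀ j, 1 ≤ j → ∀ u w, ¬ m.Cand n (j * n + u) w := by
    rintro j hj u w ⟨i, hi, _⟩
    rw [hl j hj u] at hi
    omega
  refine { lt := ?_, card := ?_, base := ?_, base_rem := ?_, size := ?_, self_rem := ?_, self_cand
           := ?_, sep := ?_ }
  · intro j _ u hu w hw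
    rcases Nat.eq_zero_or_pos j with rfl | hj
    · obtain ⟨i, hi, rfl⟩ := hw
      rw [Nat.zero_mul, Nat.zero_add] at hi ⊢
      rw [h.llen u hu] at hi
      rwa [h.lst u hu i hi]
    · exact absurd hw (hc j hj u w)
  · intro j _ u hu
    rcases Nat.eq_zero_or_pos j with rfl | hj
    · simp [h.llen u hu]
    · simp [hl j hj u]
  · exact fun u hu w hw => ⟨w, by rwa [h.llen u hu], h.lst u hu w hw⟩
  · exact fun u hu v hv => h.rem _ (code_lt hu hv)
  · intro j hj _ u _
    simp [hl j hj u]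
  · exact fun j hj _ u _ => hz j hj u u
  · exact fun j hj _ u _ => hc j hj u u
  · exact fun j hj _ u _ x y _ _ hy => absurd (hz j hj u y) hy

theorem Initial.not_dep {m : Mem} (h : Initial n m) (c e : ℕ) : ¬ m.Dep n c e := by
  rintro ⟨i, hi, _⟩
  rw [h.dlen] at hi
  omega

/-- The values of the complete graph are lower bounds for every graph. No pair needs an explanation,
since all of them wait in bucket `1`; in particular the adjacency matrix plays no role here. -/
theorem Initial.pairs {m : Mem} (h : Initial n m) : Pairs n 1 m := by
  have hle : ∀ u < n, ∀ v < n, m.D (u * n + v) ≤ 1 := by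
    intro u hu v hv
    rw [h.D u hu v hv]
    split_ifs <;> omega
  refine { lower := ?_, diag := ?_, pos := ?_, le := ?_, wit_lt := ?_, valid := ?_, dep := ?_,
           ptr_le := ?_, scanned := ?_, bk_lt := ?_, dep_lt := ?_ }
  · intro k u hu v hv hc
    cases k with
    | zero =>
      cases hc
      simp [h.D u hu u hu]
    | succ k => exact (hle u hu v hv).trans (by omega)
  · exact fun u hu => by simp [h.D u hu u hu]
  · exact fun u hu v hv huv => by simp [h.D u hu v hv, huv]
  · exact fun u hu v hv => (hle u hu v hv).trans (by omega)
  · exact fun u hu v hv => by rwa [h.wit u hu v hv]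
  · intro u hu v hv huv _
    have h₁ : m.D (u * n + v) = 1 := by simp [h.D u hu v hv, huv]
    rw [h₁]
    exact .inr ⟨le_rfl, u * n + v, by simpa [h.blen] using code_lt hu hv, h.bk _ (code_lt hu hv)⟩
  · intro u hu v hv w hw hwu _
    rw [h.wit u hu v hv] at hw
    exact absurd hw.symm hwu
  · intro u _ v _
    rw [h.ptr]
    exact Nat.zero_le _
  · intro u _ v _ i hi
    rw [h.ptr] at hi
    omega
  · rintro k e ⟨i, hi, rfl⟩
    rw [h.blen] at hi
    by_cases hk : k = 1
    · subst hk
      rw [Function.update_self] at hi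
      rwa [h.bk i hi]
    · rw [Function.update_of_ne hk] at hi
      omega
  · exact fun c e hce => absurd hce (h.not_dep c e)

/-- The initial potential. -/
def budget (n : ℕ) : ℕ :=
  3000 * (n * n * weight n 0) + 200 * (n * n) +
    400 * (n + 1) * ((Nat.size n + 1) * n * n) + 400 * (n + 1) * (n * n)

theorem weight_le_weight_zero (n k : ℕ) : weight n k ≤ weight n 0 :=
  Finset.sum_le_sum_of_subset (Finset.Ico_subset_Ico_left (Nat.zero_le k))

theorem Initial.potential_le {m : Mem} (h : Initial n m) : m.potential n ≤ budget n := by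
  have h₁ : m.credit n ≤ n * n * weight n 0 := by
    refine (Finset.sum_le_sum (g := fun _ => weight n 0) fun c _ =>
      (Nat.sub_le _ _).trans (weight_le_weight_zero n _)).trans_eq ?_
    simp
  have h₂ : ∑ k ∈ Finset.range (n + 1), m.blen k ≤ n * n := by
    rw [h.blen]
    by_cases hn : n = 0
    · subst hn
      simp
    · have := sum_range_update_add (N := n + 1) (x := 1) (by omega) (fun _ => 0) (n * n)
      simpa using this.le
  have h₃ : ∑ c ∈ Finset.range (n * n), m.dlen c = 0 :=
    Finset.sum_eq_zero fun c _ => h.dlen c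
  have h₄ : m.unseparated n ≤ (Nat.size n + 1) * n * n :=
    (Finset.card_filter_le _ _).trans (by simp)
  have h₅ : m.edges n ≤ n * n := (Finset.card_filter_le _ _).trans (by simp)
  unfold Mem.potential budget
  rw [h₃]
  have := Nat.mul_le_mul_left (400 * (n + 1)) h₄
  have := Nat.mul_le_mul_left (400 * (n + 1)) h₅
  omega

theorem weight_zero_le (n : ℕ) : weight n 0 ≤ (n + 1) * (n + 1) := by
  refine (Finset.sum_le_sum (g := fun _ => n + 1) fun k _ =>
    Nat.add_le_add_right (Nat.div_le_self _ _) 1).trans_eq ?_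
  simp

/-- The potential bounds the length of every stack, so stacks never run into each other. The
exponent `32` of the stride leaves a factor of at least `2 ^ 28` for the constants. -/
theorem budget_lt_stride (n : ℕ) : budget n < stride n := by
  have h₁ := weight_zero_le n
  have h₂ := size_le n
  have h₃ : budget n ≤ 4400 * (n + 2) ^ 4 := by
    have e₁ : n * n * weight n 0 ≤ (n + 2) ^ 4 := by
      calc n * n * weight n 0 ≤ n * n * ((n + 1) * (n + 1)) := Nat.mul_le_mul_left _ h₁
        _ ≤ (n + 2) * (n + 2) * ((n + 2) * (n + 2)) := by gcongr <;> omega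
        _ = _ := by ring
    have e₂ : (n + 1) * ((Nat.size n + 1) * n * n) ≤ (n + 2) ^ 4 := by
      calc _ ≤ (n + 2) * ((n + 2) * (n + 2) * (n + 2)) := by gcongr <;> omega
        _ = _ := by ring
    have e₃ : (n + 1) * (n * n) ≤ (n + 2) ^ 4 := by
      calc _ ≤ (n + 2) * ((n + 2) * (n + 2)) * 1 := by rw [Nat.mul_one]; gcongr <;> omega
        _ ≤ (n + 2) * ((n + 2) * (n + 2)) * (n + 2) := Nat.mul_le_mul_left _ (by omega)
        _ = _ := by ring
    have e₄ : n * n ≤ (n + 2) ^ 4 := by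
      calc n * n ≤ (n + 1) * (n * n) := Nat.le_mul_of_pos_left _ (by omega)
        _ ≤ _ := e₃
    unfold budget
    rw [Nat.mul_assoc 400, Nat.mul_assoc 400]
    omega
  have h₄ : 2 ^ 28 ≤ (n + 2) ^ 28 := Nat.pow_le_pow_left (by omega) _
  have h₅ : stride n = (n + 2) ^ 28 * (n + 2) ^ 4 := pow_add (n + 2) 28 4
  have h₆ : 0 < (n + 2) ^ 4 := Nat.pow_pos (Nat.succ_pos _)
  rw [h₅]
  refine lt_of_le_of_lt h₃ (lt_of_lt_of_le ?_ (Nat.mul_le_mul_right _ h₄))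
  exact Nat.mul_lt_mul_of_pos_right (by norm_num) h₆

theorem update_ite_lt (f : ℕ → ℕ) (c : ℕ) :
    Function.update (fun x => if x < c then f x else 0) c (f c) =
      fun x => if x < c + 1 then f x else 0 := by
  funext x
  rw [Function.update_apply]
  by_cases hx : x = c
  · subst hx; simp
  · simp only [hx, if_false]
    exact if_congr (by omega) rfl rfl

theorem Ambient.runs_pairs {s : State} (hA : Ambient n s)
    (hzero : ∀ a, a ≠ 0 → a ≠ 12 → a ≠ 13 → ∀ i, s.arr a i = 0) :
    Runs (wordBound n) pairsCmd s fun t s' => t ≤ 100 * (n * n + 1) ∧ Ambient n s' ∧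
      s'.reg 5 = 1 ∧ Initial n s'.mem ∧ s'.arr 0 = s.arr 0 := by
  have hz : ∀ a, a ≠ 0 → a ≠ 12 → a ≠ 13 → s.arr a = fun _ => 0 :=
    fun a h₁ h₂ h₃ => funext (hzero a h₁ h₂ h₃)
  refine Runs.seq (hA.runs_assign 0 rfl (by norm_num) (by simp) (le_cellBound (by omega))
    fun hA => ?_)
  refine Runs.seq (Runs.while (fits n) rfl (fun τ s' => Ambient n s' ∧ s'.arr 0 = s.arr 0 ∧
    s'.arr 4 = s.arr 4 ∧ s'.arr 6 = s.arr 6 ∧ s'.arr 8 = s.arr 8 ∧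
    ∃ c, s'.reg 6 = c ∧ c ≤ n * n ∧ τ ≤ 80 * c ∧
    (s'.arr 9 = fun x => if x < c then x % n else 0) ∧
    (s'.arr 11 = fun x => if x < c then 1 else 0) ∧
    (s'.arr 3 = fun x => if x < c then x / n else 0) ∧
    (s'.arr 1 = fun x => if x < c then 1 - (if x / n = x % n then 1 else 0) else 0) ∧
    (∀ x < c, s'.arr 10 (x / n) = n) ∧ (∀ x, n ≤ x → s'.arr 10 x = 0) ∧
    (∀ x < c, s'.arr 7 (stride n + x) = x))
    (fun s' => n * n - s'.reg 6) ?_ ?_)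
  · refine ⟨hA, rfl, rfl, rfl, rfl, 0, by simp, Nat.zero_le _, Nat.zero_le _, ?_⟩
    simp [hz]
  · rintro τ s₁ ⟨hA, a0, a4, a6, a8, c, r6, hc, hτ, a9, a11, a3, a1, a10, a10', a7⟩
    have r2 := hA.reg2
    have r3 := hA.reg3
    have hS := stride_lt_cellBound n
    have hS' := sq_add_lt_stride n
    refine ⟨hA.bounded, fun h0 => ?_, fun h0 => ?_⟩
    · have hc' : c = n * n := by
        simp [r2, r6] at h0
        omega
      subst hc'
      refine Runs.seq (hA.runs_store 1 (n * n) rfl (by norm_num) (by simp) (by simp [r2])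
        (le_cellBound (by omega)) fun hA => ?_)
      refine hA.runs_assign 1 rfl (by norm_num) (by simp) (le_cellBound (by omega)) fun hA => ?_
      refine ⟨by simp; omega, hA, by simp, ?_, by simpa⟩
      refine { D := ?_, wit := ?_, ptr := ?_, dlen := ?_, bk := ?_, blen := ?_, lst := ?_, llen :=
               ?_, llen_eq_zero := ?_, rem := ?_, rem_eq_zero := ?_ }
      · intro u hu v hv
        simp [a1, code_lt hu hv, code_div hv, code_mod hv]
        split_ifs <;> rfl
      · intro u hu v hv
        simp [a3, code_lt hu hv, code_div hv]
      · simp [a4, hz]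
      · simp [a6, hz]
      · intro x hx
        simp [a7 x hx]
      · simp [a8, hz]
      · intro u hu v hv
        simp [a9, code_lt hu hv, code_mod hv]
      · intro u hu
        have := a10 (u * n + u) (code_lt hu hu)
        rw [code_div hu] at this
        simpa using this
      · intro u hu
        simpa using a10' u hu
      · intro x hx
        simp [a11, hx]
      · intro x hx
        simp [a11, hx]
    · have hc' : c < n * n := by
        simp [r2, r6] at h0
        omega
      obtain ⟨u, v, hu, hv, rfl⟩ := exists_code hc'
      have hdiv := code_div (u := u) hv
      have hmod := code_mod (u := u) hv
      refine Runs.seq (hA.runs_assign u rfl (by norm_num) (by simp [r2, r6, hdiv])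
        (le_cellBound (by omega)) fun hA => ?_)
      refine Runs.seq (hA.runs_assign v rfl (by norm_num) (by simp [r2, r6])
        (le_cellBound (by omega)) fun hA => ?_)
      refine Runs.seq (hA.runs_store (u * n + v) v rfl (by norm_num) (by simp [r6]) (by simp)
        (le_cellBound (by omega)) fun hA => ?_)
      refine Runs.seq (hA.runs_store (u * n + v) 1 rfl (by norm_num) (by simp [r6]) (by simp)
        (le_cellBound (by omega)) fun hA => ?_)
      refine Runs.seq (hA.runs_store (u * n + v) u rfl (by norm_num) (by simp [r6]) (by simp)
        (le_cellBound (by omega)) fun hA => ?_)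
      refine Runs.seq (hA.runs_store (u * n + v) (1 - if u = v then 1 else 0) rfl (by norm_num)
        (by simp [r6]) (by simp) (le_cellBound (by omega)) fun hA => ?_)
      refine Runs.seq (hA.runs_store u n rfl (by norm_num) (by simp) (by simp [r2])
        (le_cellBound (by omega)) fun hA => ?_)
      refine Runs.seq (hA.runs_store (stride n + (u * n + v)) (u * n + v) rfl (by norm_num)
        (by simp [r3, r6]) (by simp [r6]) (le_cellBound (by omega)) fun hA => ?_)
      refine hA.runs_assign (u * n + v + 1) rfl (by norm_num) (by simp [r6])
        (le_cellBound (by omega)) fun hA => ?_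
      refine ⟨⟨hA, by simpa, by simpa, by simpa, by simpa, u * n + v + 1, by simp, hc',
        by simp; omega, ?_, ?_, ?_, ?_, ?_, ?_, ?_⟩, by simp [r6]; omega⟩
      · rw [← update_ite_lt, hmod]
        simp [a9]
      · rw [← update_ite_lt fun _ => 1]
        simp [a11]
      · rw [← update_ite_lt, hdiv]
        simp [a3]
      · rw [← update_ite_lt fun x => 1 - if x / n = x % n then 1 else 0, hdiv, hmod]
        simp [a1]
      · intro x hx
        rcases Nat.lt_succ_iff_lt_or_eq.1 hx with h₁ | rfl
        · simp [Function.update_apply, a10 x h₁]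
        · simp [hdiv]
      · intro x hx
        simp [show x ≠ u by omega, a10' x hx]
      · intro x hx
        rcases Nat.lt_succ_iff_lt_or_eq.1 hx with h₁ | rfl
        · simp [Function.update_apply, a7 x h₁, eq_comm]
        · simp

theorem Initial.inv {s : State} (hA : Ambient n s) (h : Initial n s.mem) : Inv n 1 s := by
  refine ⟨hA, h.lists, h.pairs, ?_, fun c _ => h.dlen c⟩
  intro k hk
  have h₁ := h.blen
  by_cases hn : n = 0
  · subst hn
    rw [h₁, Function.update_apply]
    split_ifs <;> simp
  · rw [h₁, Function.update_of_ne (by omega)]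

theorem runs_init {s : State} (hs : Bounded (cellBound n) s) (h0 : s.reg 0 = n)
    (hzero : ∀ a, a ≠ 0 → ∀ i, s.arr a i = 0) :
    Runs (wordBound n) initCmd s fun t s' => Inv n n s' ∧ s'.mem.potential n < stride n ∧
      s'.arr 0 = s.arr 0 ∧
      t + s'.mem.potential n ≤ budget n + 100 * (n * n) + 300 * n + 210 := by
  refine Runs.seq ((runs_tables hs h0 (hzero 12 (by norm_num) 0)).mono ?_)
  rintro t₁ s₁ ⟨ht₁, hA₁, harr₁⟩
  refine Runs.seq ((hA₁.runs_pairs fun a h₁ h₂ h₃ i => ?_).mono ?_)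
  · rw [harr₁ a h₂ h₃]
    exact hzero a h₁ i
  rintro t₂ s₂ ⟨ht₂, hA₂, h5, hinit, ha₂⟩
  have hle := hinit.potential_le
  have hlt := budget_lt_stride n
  refine ((hinit.inv hA₂).runs_settle h5 (by omega)).mono ?_
  rintro t₃ s₃ ⟨hI, ha₃, hp₃, ht₃⟩
  refine ⟨hI, by omega, ?_, by omega⟩
  rw [ha₃, ha₂, harr₁ 0 (by norm_num) (by norm_num)]

theorem Inv.runs_delete {s : State} (hI : Inv n n s) (hpot : s.mem.potential n < stride n)
    {u v : ℕ} (hu : u < n) (hv : v < n) (h0 : s.reg 0 = u) (h1 : s.reg 1 = v)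
    (hadj : s.arr 0 (u * n + v) ≠ 0) :
    Runs (wordBound n) deleteCmd s fun t s' => Inv n n s' ∧
      t + s'.mem.potential n ≤ s.mem.potential n ∧
      s'.arr 0 = Function.update (s.arr 0) (u * n + v) 0 := by
  have hA := hI.ambient
  have h2 := hA.reg2
  have hcode := code_lt hu hv
  have hS := stride_lt_cellBound n
  have hS' := sq_add_lt_stride n
  have hblen : ∀ k, s.arr 8 k + 1 < stride n := by
    intro k
    have := hI.support.blen_le k
    simp only [Mem.potential, State.mem_blen] at hpot this
    omega
  have hb₁ := hblen 1
  have hss := sum_range_update_add (N := n + 1) (x := 1) (by omega) (s.arr 8) (s.arr 8 1 + 1)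
  refine Runs.seq (hA.runs_assign (u * n + v) rfl (by norm_num) (by simp [h0, h1, h2])
    (le_cellBound (by omega)) fun hA => ?_)
  refine Runs.seq (hA.runs_store (u * n + v) 0 rfl (by norm_num) (by simp) (by simp)
    (le_cellBound (by omega)) fun hA => ?_)
  refine Runs.seq (hA.runs_assign 1 rfl (by norm_num) (by simp)
    (le_cellBound (by omega)) fun hA => ?_)
  refine Runs.seq (hA.runs_push (by norm_num) (by norm_num) (by norm_num) 1 (u * n + v)
    (by simp) (by simp) (by simp; omega) fun hA => ?_)
  refine Runs.seq (hA.runs_assign 1 rfl (by norm_num) (by simp)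
    (le_cellBound (by omega)) fun hA => ?_)
  generalize hs₁ : State.setReg _ 5 1 = s₁ at hA ⊢
  set blen₁ := Function.update (s.arr 8) 1 (s.arr 8 1 + 1) with hbl
  set bk₁ := Function.update (s.arr 7) (1 * stride n + s.arr 8 1) (u * n + v) with hbk
  have hm : s₁.mem = { s.mem with
      adj := Function.update s.mem.adj (u * n + v) 0
      bk := bk₁
      blen := blen₁ } := by
    rw [← hs₁]
    ext1 <;> simp [State.mem, hbl, hbk]
  have hI₁ : Inv n 1 s₁ := by
    refine ⟨hA, ?_, ?_, ?_⟩
    · rw [hm]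
      exact hI.lists.delete
    · rw [hm]
      refine hI.pairs.delete hu hv fun k e => ?_
      rw [hbk, hbl, onStack_push (by omega) (by have := hblen k; omega)]
      rfl
    · rw [hm]
      refine { hI.support with blen := fun k hk => ?_ }
      dsimp only
      rw [hbl, Function.update_of_ne (by omega)]
      exact hI.support.blen k hk
  have hedges : s₁.mem.edges n + 1 ≤ s.mem.edges n := by
    rw [hm]
    refine Finset.card_lt_card (Finset.ssubset_iff_subset_ne.2 ⟨fun c hc => ?_, fun heq => ?_⟩)
    · simp only [Finset.mem_filter] at hc ⊢
      refine ⟨hc.1, fun h => hc.2 ?_⟩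
      rw [Function.update_apply]
      split_ifs
      exacts [rfl, h]
    · have : u * n + v ∈ (Finset.range (n * n)).filter fun c => s.mem.adj c ≠ 0 :=
        Finset.mem_filter.2 ⟨Finset.mem_range.2 hcode, hadj⟩
      rw [← heq] at this
      have := (Finset.mem_filter.1 this).2
      simp at this
  -- The deleted edge releases `400 * (n + 1)` units: `200` for the new bucket entry, and the rest
  -- for the following pass over all values.
  have hpot₁ : s₁.mem.potential n + 200 * n + 200 ≤ s.mem.potential n := by
    have e₁ : s₁.mem.credit n = s.mem.credit n := by rw [hm]; rfl
    have e₂ : s₁.mem.unseparated n = s.mem.unseparated n := by rw [hm]; rfl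
    have e₃ : s₁.mem.blen = blen₁ := by rw [hm]
    have e₄ : s₁.mem.dlen = s.mem.dlen := by rw [hm]
    have h₁ := Nat.mul_le_mul_left (400 * (n + 1)) hedges
    rw [Nat.mul_add] at h₁
    unfold Mem.potential
    rw [e₁, e₂, e₃, e₄]
    simp only [State.mem_blen]
    omega
  refine (hI₁.runs_settle (by simp [← hs₁]) (by omega)).mono ?_
  rintro t s' ⟨hI', ha, _, ht⟩
  refine ⟨hI', ?_, ?_⟩
  · simp
    omega
  · rw [ha]
    exact congrArg Mem.adj hm

end DecAPSP

namespace DecAPSP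

/-! ### Queries -/

/-- The distance query. -/
def distCmd : Cmd := .assign 0 (.load 1 (.reg 0 * .reg 2 + .reg 1))

/-- Follow the witnesses: register `7` is the vertex that was reported last, and array `14` is the
stack of the vertices that the rest of the path has to visit. -/
def followCmd : Cmd :=
  .while (.reg 13) (
    .assign 8 (.load 14 (.reg 13 - 1)) ;;
    .ite (Expr.less (.load 1 (.reg 7 * .reg 2 + .reg 8)) 2)
      (.assign 12 (.reg 12 + 1) ;;
        .store 2 (.reg 12) (.reg 8) ;;
        .assign 7 (.reg 8) ;;
        .assign 13 (.reg 13 - 1))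
      (.store 14 (.reg 13) (.load 3 (.reg 7 * .reg 2 + .reg 8)) ;;
        .assign 13 (.reg 13 + 1)))

/-- The shortest path query. -/
def pathCmd : Cmd :=
  .assign 7 (.reg 0) ;;
  .assign 16 (.load 1 (.reg 0 * .reg 2 + .reg 1)) ;;
  .store 2 0 (.reg 7) ;;
  .assign 12 0 ;;
  .store 14 0 (.reg 1) ;;
  .assign 13 (Expr.less 0 (.reg 16) * Expr.less (.reg 16) (.reg 2)) ;;
  followCmd ;;
  .assign 0 (.reg 16)

/-- The vertices on the stack below `k`, visited from `x` on from the top, lead to `v` with total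
distance `d`. -/
def Route (n : ℕ) (D stk : ℕ → ℕ) (v : ℕ) : ℕ → ℕ → ℕ → Prop
  | x, 0, d => x = v ∧ d = 0
  | x, k + 1, d => stk k < n ∧ 1 ≤ D (x * n + stk k) ∧ D (x * n + stk k) < n ∧
      ∃ d', d = D (x * n + stk k) + d' ∧ Route n D stk v (stk k) k d'

theorem Route.congr {n v : ℕ} {D stk stk' : ℕ → ℕ} {x k d : ℕ} (h : Route n D stk v x k d)
    (hstk : ∀ i < k, stk' i = stk i) : Route n D stk' v x k d := by
  induction k generalizing x d with
  | zero => exact h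
  | succ k ih =>
    obtain ⟨h₁, h₂, h₃, d', h₄, h₅⟩ := h
    have h₀ := hstk k (Nat.lt_succ_self k)
    simp only [Route, h₀]
    exact ⟨h₁, h₂, h₃, d', h₄, ih h₅ fun i hi => hstk i (by omega)⟩

theorem Route.le {n v : ℕ} {D stk : ℕ → ℕ} {x k d : ℕ} (h : Route n D stk v x k d) : k ≤ d := by
  induction k generalizing x d with
  | zero => exact Nat.zero_le _
  | succ k ih =>
    obtain ⟨h₁, h₂, h₃, d', h₄, h₅⟩ := h
    have := ih h₅
    omega

variable {n : ℕ}

/-- A value of at least `2` excludes an edge, so the explanation is a witness; it splits the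
distance exactly because both parts are settled. -/
theorem Pairs.witness {m : Mem} (h : Pairs n n m) {x y : ℕ} (hx : x < n) (hy : y < n)
    (hn : m.D (x * n + y) < n) (h2 : 2 ≤ m.D (x * n + y)) :
    1 ≤ m.D (x * n + m.wit (x * n + y)) ∧ 1 ≤ m.D (m.wit (x * n + y) * n + y) ∧
      m.D (x * n + y) = m.D (x * n + m.wit (x * n + y)) + m.D (m.wit (x * n + y) * n + y) := by
  have hxy : x ≠ y := by
    rintro rfl
    rw [h.diag x hx] at h2
    omega
  have hw := h.wit_lt x hx y hy
  rcases h.valid x hx y hy hxy hn with h₁ | h₁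
  · rcases h₁ with h₁ | h₁
    · have := h.lower 1 x hx y hy ⟨y, ⟨hx, hy, h₁⟩, rfl⟩
      omega
    · obtain ⟨h₁, h₂, h₃⟩ := h₁
      have hc := (h.connects hx hw (by omega) (by omega)).trans
        (h.connects hw hy (by omega) (by omega))
      have := h.lower _ x hx y hy hc
      exact ⟨h₁, h₂, by omega⟩
  · omega

theorem Pairs.edge {m : Mem} (h : Pairs n n m) {x y : ℕ} (hx : x < n) (hy : y < n) (hn : 1 < n)
    (h1 : m.D (x * n + y) = 1) : m.E n x y := by
  have hc := h.connects hx hy (by omega) (by omega)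
  rw [h1] at hc
  obtain ⟨w, hw, rfl⟩ := hc
  exact hw

/-- Each leg on the stack is split at its witness until it is an edge. Recursion with an explicit
stack takes linear time because a split produces two legs of positive length. -/
theorem Inv.runs_path {s : State} (hI : Inv n n s) {u v d : ℕ} (hu : u < n) (hv : v < n)
    (h0 : s.reg 0 = u) (h1 : s.reg 1 = v) (hd : s.arr 1 (u * n + v) = d) :
    Runs (wordBound n) pathCmd s fun t s' => Inv n n s' ∧ s'.mem = s.mem ∧ s'.reg 0 = d ∧
      (d < n → t ≤ 200 * (d + 1)) ∧ (n ≤ d → t ≤ 200) ∧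
      (d < n → s'.arr 2 0 = u ∧ s'.arr 2 d = v ∧
        ∀ i < d, s.mem.E n (s'.arr 2 i) (s'.arr 2 (i + 1))) := by
  have hA := hI.ambient
  have hP := hI.pairs
  have h2 := hA.reg2
  have hdn : d ≤ n := hd ▸ hP.le u hu v hv
  obtain ⟨k, hk⟩ : ∃ k, (if 0 < d ∧ d < n then 1 else 0) = k := ⟨_, rfl⟩
  refine Runs.seq (hA.runs_assign u rfl (by norm_num) (by simp [h0])
    (le_cellBound (by omega)) fun hA => ?_)
  refine Runs.seq (hA.runs_assign d rfl (by norm_num) (by simp [h0, h1, h2, hd])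
    (le_cellBound (by omega)) fun hA => ?_)
  refine Runs.seq (hA.runs_store 0 u rfl (by norm_num) (by simp) (by simp)
    (le_cellBound (by omega)) fun hA => ?_)
  refine Runs.seq (hA.runs_assign 0 rfl (by norm_num) (by simp)
    (le_cellBound (by omega)) fun hA => ?_)
  refine Runs.seq (hA.runs_store 0 v rfl (by norm_num) (by simp) (by simp [h1])
    (le_cellBound (by omega)) fun hA => ?_)
  refine Runs.seq (hA.runs_assign k rfl (by norm_num) ?_ ?_ fun hA => ?_)
  · simp only [Expr.val_mul, Expr.val_less, Expr.val_zero, Expr.val_reg, State.setCell_reg]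
    by_cases e₁ : 0 < d <;> by_cases e₂ : d < n <;> simp [h2, e₁, e₂, ← hk]
  · exact le_cellBound (by split_ifs at hk <;> omega)
  generalize hs₁ : State.setReg _ 13 k = s₁ at hA ⊢
  have hm₁ : s₁.mem = s.mem := by
    rw [← hs₁]
    ext1 <;> simp
  have r7 : s₁.reg 7 = u := by simp [← hs₁]
  have r12 : s₁.reg 12 = 0 := by simp [← hs₁]
  have r13 : s₁.reg 13 = k := by simp [← hs₁]
  have r16 : s₁.reg 16 = d := by simp [← hs₁]
  have a2 : s₁.arr 2 0 = u := by simp [← hs₁]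
  have a14 : s₁.arr 14 0 = v := by simp [← hs₁]
  by_cases hk0 : k = 0
  -- An empty initial stack covers both the distance `0`, where the path consists of `u` alone, and
  -- an unreachable target.
  · refine Runs.seq ⟨_, _, .while_false (by simp [Expr.eval, r13, hk0]), ?_⟩
    refine hA.runs_assign d rfl (by norm_num) (by simp [r16]) (le_cellBound (by omega))
      fun hA => ?_
    refine ⟨⟨hA, ?_, ?_, ?_⟩, by simpa, by simp, ?_, ?_, fun hlt => ?_⟩
    · simpa [hm₁] using hI.lists
    · simpa [hm₁] using hI.pairs
    · simpa [hm₁] using hI.support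
    · simp [Expr.cost]
      omega
    · simp [Expr.cost]
    · have hd0 : d = 0 := by
        rw [hk0] at hk
        split_ifs at hk
        omega
      have huv : u = v := by
        by_contra hne
        have := hP.pos u hu v hv hne
        rw [State.mem_D, hd] at this
        omega
      subst hd0
      exact ⟨by simpa, by simpa [← huv], fun i hi => by omega⟩
  have hd' : 0 < d ∧ d < n := by
    by_contra hno
    rw [if_neg hno] at hk
    exact hk0 hk.symm
  have hk1 : k = 1 := by rw [← hk, if_pos hd']
  have hn1 : 1 < n := by omega
  refine Runs.seq (Runs.while (fits n) rfl (fun τ s' => Ambient n s' ∧ s'.mem = s.mem ∧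
      s'.reg 16 = d ∧ ∃ x i sp r, s'.reg 7 = x ∧ s'.reg 12 = i ∧ s'.reg 13 = sp ∧ x < n ∧
      i + r = d ∧ Route n (s.arr 1) (s'.arr 14) v x sp r ∧ s'.arr 2 0 = u ∧ s'.arr 2 i = x ∧
      (∀ j < i, s.mem.E n (s'.arr 2 j) (s'.arr 2 (j + 1))) ∧
      -- With `r` edges left and `sp` vertices on the stack, following an edge decreases both by one
      -- and a split increases `sp` by one. In either case `2 * r - sp` drops by one, and `sp ≤ r`
      -- by `Route.le`.
      τ + 60 * (2 * r - sp) ≤ 120 * d)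
    (fun s' => 2 * (d - s'.reg 12) - s'.reg 13) ?_ ?_)
  · refine ⟨hA, hm₁, r16, u, 0, k, d, r7, r12, r13, hu, by omega, ?_, a2, a2,
      fun j hj => by omega, by omega⟩
    rw [hk1]
    simp only [Route, a14, hd]
    exact ⟨hv, hd'.1, hd'.2, 0, by simp⟩
  · rintro τ s₂ ⟨hA₂, hm, r16, x, i, sp, r, r7, r12, r13, hx, hir, hroute, b0, bi, hwalk, hτ⟩
    have b1 : s₂.arr 1 = s.arr 1 := congrArg Mem.D hm
    have b3 : s₂.arr 3 = s.arr 3 := congrArg Mem.wit hm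
    have r2 := hA₂.reg2
    have hspr := hroute.le
    refine ⟨hA₂.bounded, fun hz => ?_, fun hz => ?_⟩
    · have hsp : sp = 0 := by simpa [r13] using hz
      subst hsp
      obtain ⟨rfl, rfl⟩ := hroute
      have hid : i = d := by omega
      subst hid
      refine hA₂.runs_assign i rfl (by norm_num) (by simp [r16]) (le_cellBound (by omega))
        fun hA => ?_
      refine ⟨⟨hA, ?_, ?_, ?_⟩, by simpa, by simp, fun _ => ?_, fun h => by omega,
        fun _ => ⟨by simpa, by simpa, by simpa⟩⟩
      · simpa [hm] using hI.lists
      · simpa [hm] using hI.pairs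
      · simpa [hm] using hI.support
      · simp
        omega
    · have hsp : sp ≠ 0 := by simpa [r13] using hz
      obtain ⟨sp, rfl⟩ := Nat.exists_eq_succ_of_ne_zero hsp
      obtain ⟨hy, hD1, hDn, r', hr', hroute'⟩ := hroute
      obtain ⟨y, hyy⟩ : ∃ y, s₂.arr 14 sp = y := ⟨_, rfl⟩
      rw [hyy] at hy hD1 hDn hr' hroute'
      have hspr' := hroute'.le
      refine Runs.seq (hA₂.runs_assign y rfl (by norm_num) (by simp [r13, hyy])
        (le_cellBound (by omega)) fun hA => ?_)
      refine hA.runs_ite (s.arr 1 (x * n + y) < 2) rfl (by simp [r7, r2, b1]) ?_ ?_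
      · intro hlt
        have hD : s.arr 1 (x * n + y) = 1 := by omega
        have hE := hP.edge hx hy hn1 hD
        refine Runs.seq (hA.runs_assign (i + 1) rfl (by norm_num) (by simp [r12])
          (le_cellBound (by omega)) fun hA => ?_)
        refine Runs.seq (hA.runs_store (i + 1) y rfl (by norm_num) (by simp) (by simp)
          (le_cellBound (by omega)) fun hA => ?_)
        refine Runs.seq (hA.runs_assign y rfl (by norm_num) (by simp)
          (le_cellBound (by omega)) fun hA => ?_)
        refine hA.runs_assign sp rfl (by norm_num) (by simp [r13])
          (le_cellBound (by omega)) fun hA => ?_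
        refine ⟨⟨hA, ?_, by simpa, y, i + 1, sp, r', by simp, by simp, by simp, hy, by omega,
          by simpa using hroute', ?_, by simp, ?_, ?_⟩, ?_⟩
        · rw [← hm]
          ext1 <;> simp
        · simpa
        · intro j hj
          rcases Nat.lt_succ_iff_lt_or_eq.1 hj with h₁ | rfl
          · have h₂ : j ≠ i + 1 := by omega
            have h₃ : j ≠ i := by omega
            simpa [h₂, h₃] using hwalk j h₁
          · simpa [bi] using hE
        · simp
          omega
        · simp [r12, r13]
          omega
      · intro hge
        obtain ⟨hw₁, hw₂, hw₃⟩ := hP.witness hx hy hDn (by rw [State.mem_D]; omega)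
        have hw := hP.wit_lt x hx y hy
        obtain ⟨w, hww⟩ : ∃ w, s.mem.wit (x * n + y) = w := ⟨_, rfl⟩
        rw [hww] at hw₁ hw₂ hw₃ hw
        simp only [State.mem_D, State.mem_wit] at hw₁ hw₂ hw₃ hww
        refine Runs.seq (hA.runs_store (sp + 1) w rfl (by norm_num) (by simp [r13])
          (by simp [r7, r2, b3, hww]) (le_cellBound (by omega)) fun hA => ?_)
        refine hA.runs_assign (sp + 2) rfl (by norm_num) (by simp [r13])
          (le_cellBound (by omega)) fun hA => ?_
        refine ⟨⟨hA, ?_, by simpa, x, i, sp + 2, r, by simpa, by simpa, by simp, hx, hir,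
          ?_, by simpa, by simpa, by simpa, ?_⟩, ?_⟩
        · rw [← hm]
          ext1 <;> simp
        · simp only [State.setReg_arr, State.setCell_arr, reduceIte, Route, Function.update_self,
            Function.update_of_ne (Nat.ne_of_lt (Nat.lt_succ_self sp)), hyy]
          refine ⟨hw, hw₁, by omega, s.arr 1 (w * n + y) + r', by omega, hy, hw₂, by omega, r',
            rfl, hroute'.congr ?_⟩
          · intro j hj
            rw [Function.update_of_ne (by omega)]
        · simp
          omega
        · simp [r12, r13]
          omega

theorem Inv.runs_dist {s : State} (hI : Inv n n s) {u v d : ℕ} (hd : d ≤ n)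
    (h0 : s.reg 0 = u) (h1 : s.reg 1 = v) (hD : s.arr 1 (u * n + v) = d) :
    Runs (wordBound n) distCmd s fun t s' => Inv n n s' ∧ s'.mem = s.mem ∧ s'.reg 0 = d ∧
      t ≤ 200 := by
  refine hI.ambient.runs_assign d rfl (by norm_num) (by simp [h0, h1, hI.ambient.reg2, hD])
    (le_cellBound (by omega)) fun hA => ?_
  exact ⟨⟨hA, hI.lists, hI.pairs, hI.support⟩, rfl, by simp, by simp⟩

end DecAPSP

namespace DecAPSP

/-! ### Distances and the time bound -/

/-- The memory holds the graph `G`. -/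
def Represents {n : ℕ} (m : Mem) (G : Digraph (Fin n)) : Prop :=
  ∀ u v : Fin n, m.adj ((u : ℕ) * n + v) ≠ 0 ↔ G.Adj u v

variable {n : ℕ} {m : Mem} {G : Digraph (Fin n)}

theorem exists_isWalk_iff (hG : Represents m G) {k : ℕ} {u v : Fin n} :
    (∃ p, IsWalk G u v k p) ↔ Connects (m.E n) k u v := by
  induction k generalizing u with
  | zero =>
    constructor
    · rintro ⟨p, h₀, h₁, _⟩
      exact congrArg Fin.val (h₀.symm.trans h₁)
    · intro h
      exact ⟨fun _ => u, rfl, Fin.ext h, fun i hi => absurd hi (Nat.not_lt_zero i)⟩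
  | succ k ih =>
    constructor
    · rintro ⟨p, h₀, h₁, h₂⟩
      refine ⟨p 1, ⟨u.2, (p 1).2, (hG _ _).2 ?_⟩, ih.1 ⟨fun i => p (i + 1), rfl, h₁, ?_⟩⟩
      · rw [← h₀]
        exact h₂ 0 (Nat.succ_pos k)
      · exact fun i hi => h₂ (i + 1) (by omega)
    · rintro ⟨w, hw, hc⟩
      obtain ⟨p, h₀, h₁, h₂⟩ := (ih (u := ⟨w, hw.2.1⟩)).2 hc
      refine ⟨fun i => Nat.casesOn i u p, rfl, h₁, fun i hi => ?_⟩
      cases i with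
      | zero =>
        show G.Adj u (p 0)
        rw [h₀]
        exact (hG u ⟨w, hw.2.1⟩).1 hw.2.2
      | succ i => exact h₂ i (by omega)

theorem Connects.exists_mid {E : ℕ → ℕ → Prop} {i j u v : ℕ} (h : Connects E (i + j) u v) :
    ∃ x, Connects E i u x ∧ Connects E j x v := by
  induction i generalizing u with
  | zero => exact ⟨u, rfl, by simpa using h⟩
  | succ i ih =>
    rw [Nat.succ_add] at h
    obtain ⟨w, hw, h⟩ := h
    obtain ⟨x, h₁, h₂⟩ := ih h
    exact ⟨x, ⟨w, hw, h₁⟩, h₂⟩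

theorem Connects.lt {k u v : ℕ} (h : Connects (m.E n) k u v) (hu : u < n) : v < n := by
  induction k generalizing u with
  | zero => rwa [← show u = v from h]
  | succ k ih =>
    obtain ⟨w, hw, h⟩ := h
    exact ih h hw.2.1

/-- A shortest walk has fewer edges than there are vertices. -/
theorem Connects.exists_lt {k u v : ℕ} (h : Connects (m.E n) k u v) (hu : u < n) :
    ∃ l < n, Connects (m.E n) l u v := by
  classical
  have hex : ∃ k, Connects (m.E n) k u v := ⟨k, h⟩
  have hl := Nat.find_spec hex
  set l := Nat.find hex
  refine ⟨l, ?_, hl⟩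
  have hmid : ∀ i : ℕ, ∃ x, i ≤ l → Connects (m.E n) i u x ∧ Connects (m.E n) (l - i) x v := by
    intro i
    by_cases hi : i ≤ l
    · rw [← Nat.add_sub_of_le hi] at hl
      obtain ⟨x, hx⟩ := hl.exists_mid
      exact ⟨x, fun _ => hx⟩
    · exact ⟨0, fun h => absurd h hi⟩
  choose f hf using hmid
  -- If a vertex recurred with `j < i`, the part between the two visits could be cut out of the
  -- shortest walk.
  have hmin : ∀ i ≤ l, ∀ j ≤ l, f i = f j → i ≤ j := by
    intro i hi j hj hij
    have h₁ := (hf j hj).1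
    rw [← hij] at h₁
    have := Nat.find_min' hex (h₁.trans (hf i hi).2)
    change l ≤ _ at this
    omega
  have := Finset.card_le_card_of_injOn (s := Finset.range (l + 1)) (t := Finset.range n) f
    (fun i hi => by
      have hi' : i ≤ l := Nat.lt_succ_iff.1 (by simpa using hi)
      simpa using (hf i hi').1.lt hu)
    (fun i hi j hj hij => by
      have hi' : i ≤ l := Nat.lt_succ_iff.1 (by simpa using hi)
      have hj' : j ≤ l := Nat.lt_succ_iff.1 (by simpa using hj)
      exact le_antisymm (hmin i hi' j hj' hij) (hmin j hj' i hi' hij.symm))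
  simpa using this

theorem dist_eq_coe {V : Type*} {G : Digraph V} {u v : V} {d : ℕ} (h : ∃ p, IsWalk G u v d p)
    (hmin : ∀ k, (∃ p, IsWalk G u v k p) → d ≤ k) : dist G u v = d :=
  le_antisymm (iInf₂_le d h) (le_iInf₂ fun k hk => by exact_mod_cast hmin k hk)

/-- Values below `n` are attained by `Pairs.connects` and minimal by `lower`. The value `n` excludes
walks with fewer than `n` edges, hence all walks. -/
theorem Pairs.dist_eq (h : Pairs n n m) (hG : Represents m G) (u v : Fin n) :
    dist G u v = if m.D ((u : ℕ) * n + v) < n then (m.D ((u : ℕ) * n + v) : ℕ∞) else ⊤ := by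
  split_ifs with hd
  · refine dist_eq_coe ((exists_isWalk_iff hG).2 (h.connects u.2 v.2 hd hd)) fun k hk => ?_
    exact h.lower k u u.2 v v.2 ((exists_isWalk_iff hG).1 hk)
  · refine le_antisymm le_top (le_iInf₂ fun k hk => ?_)
    obtain ⟨l, hl, hc⟩ := ((exists_isWalk_iff hG).1 hk).exists_lt u.2
    have := h.lower l u u.2 v v.2 hc
    omega

theorem Pairs.distWord_eq (h : Pairs n n m) (hG : Represents m G) (u v : Fin n) :
    distWord G u v = m.D ((u : ℕ) * n + v) := by
  unfold distWord
  rw [h.dist_eq hG u v]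
  have := h.le u u.2 v v.2
  by_cases hd : m.D ((u : ℕ) * n + v) < n
  · simp [hd]
  · simp [hd]
    omega

theorem Represents.delete (hG : Represents m G) (u v : Fin n) {m' : Mem}
    (hm : m'.adj = Function.update m.adj ((u : ℕ) * n + v) 0) :
    Represents m' (deleteEdge G u v) := by
  intro a b
  rw [hm]
  show _ ↔ G.Adj a b ∧ ¬ (a = u ∧ b = v)
  have hc : (a : ℕ) * n + b = u * n + v ↔ a = u ∧ b = v := by
    rw [code_inj b.2 v.2, Fin.val_inj, Fin.val_inj]
  rw [← hG a b, Function.update_apply]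
  split_ifs with h
  · simp [hc.1 h]
  · exact (and_iff_left fun hh => h (hc.2 hh)).symm

/-- The data structure. -/
def decremental : DataStructure := ⟨initCmd, deleteCmd, distCmd, pathCmd⟩

theorem Inv.call {s : State} (h : Inv n n s) (u v : Fin n) : Inv n n (s.call u v) :=
  ⟨(h.ambient.setReg (.inr (by norm_num)) (le_cellBound (by omega))).setReg
    (.inr (by norm_num)) (le_cellBound (by omega)), h.lists, h.pairs, h.support⟩

theorem Inv.storesDistances {s : State} (h : Inv n n s) (hG : Represents s.mem G) :
    StoresDistances G s := fun u v => (h.pairs.distWord_eq hG u v).symm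

/-- The potential bounds the time of all future deletions, whatever they are. Queries leave `s.mem`,
and thus the potential, unchanged. -/
theorem Inv.serves {s : State} (hI : Inv n n s) (hG : Represents s.mem G)
    (hpot : s.mem.potential n < stride n) {ops : List (Op n)} (hops : Legal G ops) :
    ∃ T, Serves decremental (wordBound n) 1000000 G s ops T ∧ T ≤ s.mem.potential n := by
  induction ops generalizing G s with
  | nil => exact ⟨0, .nil G s, Nat.zero_le _⟩
  | cons op ops ih =>
    cases op with
    | delete u v =>
      have hadj : s.arr 0 ((u : ℕ) * n + v) ≠ 0 := (hG u v).2 hops.1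
      obtain ⟨t, s', hrun, hI', ht, ha⟩ := (hI.call u v).runs_delete hpot u.2 v.2
        (by simp [State.call]) (by simp [State.call]) hadj
      have ht' : t + s'.mem.potential n ≤ s.mem.potential n := ht
      have hG' : Represents s'.mem (deleteEdge G u v) := hG.delete u v ha
      obtain ⟨T, hT, hle⟩ := ih hI' hG' (by omega) hops.2
      exact ⟨t + T, .delete hrun (hI'.storesDistances hG') hT, by omega⟩
    | dist u v =>
      obtain ⟨t, s', hrun, hI', hm, hr, ht⟩ := (hI.call u v).runs_dist
        (hI.pairs.le u u.2 v v.2) (by simp [State.call]) (by simp [State.call]) rfl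
      have hm' : s'.mem = s.mem := hm
      have hG' : Represents s'.mem G := by rwa [hm']
      obtain ⟨T, hT, hle⟩ := ih hI' hG' (by rwa [hm']) hops
      rw [hm'] at hle
      refine ⟨T, .dist hrun (by omega) ?_ (hI'.storesDistances hG') hT, hle⟩
      rw [hr, hI.pairs.distWord_eq hG]
    | path u v =>
      obtain ⟨t, s', hrun, hI', hm, hr, ht, ht', hp⟩ := (hI.call u v).runs_path u.2 v.2
        (by simp [State.call]) (by simp [State.call]) rfl
      have hm' : s'.mem = s.mem := hm
      have hG' : Represents s'.mem G := by rwa [hm']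
      obtain ⟨T, hT, hle⟩ := ih hI' hG' (by rwa [hm']) hops
      rw [hm'] at hle
      have hdist := hI.pairs.dist_eq hG u v
      obtain ⟨d, hd⟩ : ∃ d, s.mem.D ((u : ℕ) * n + v) = d := ⟨_, rfl⟩
      have hd' : (s.call u v).arr 1 ((u : ℕ) * n + v) = d := hd
      rw [hd'] at hr ht ht' hp
      rw [hd] at hdist
      refine ⟨T, .path hrun ?_ ⟨?_, ?_⟩ (hI'.storesDistances hG') hT, hle⟩
      · by_cases hdn : d < n
        · rw [hdist, if_pos hdn, ENat.toNat_natCast]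
          have := ht hdn
          omega
        · have := ht' (by omega)
          omega
      · rw [hr, hI.pairs.distWord_eq hG, hd]
      · intro k hk
        rw [hdist] at hk
        by_cases hdn : d < n
        · rw [if_pos hdn] at hk
          have hdk : d = k := by exact_mod_cast hk
          subst hdk
          obtain ⟨h₀, h₁, h₂⟩ := hp hdn
          have hlt : ∀ i ≤ d, s'.arr 2 i < n := by
            intro i hi
            rcases hi.lt_or_eq with h | rfl
            · exact (h₂ i h).1
            · rw [h₁]
              exact v.2
          refine ⟨fun i => if hi : i ≤ d then ⟨s'.arr 2 i, hlt i hi⟩ else u, ⟨?_, ?_, ?_⟩, ?_⟩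
          · simpa [Fin.ext_iff] using h₀
          · simpa [Fin.ext_iff] using h₁
          · intro i hi
            have h₃ := h₂ i hi
            beta_reduce
            rw [dif_pos (show i ≤ d by omega), dif_pos (show i + 1 ≤ d by omega)]
            exact (hG _ _).1 h₃.2.2
          · intro i hi
            simp [hi]
        · rw [if_neg hdn] at hk
          exact absurd hk (ENat.top_ne_natCast k)

theorem inputState_spec (G : Digraph (Fin n)) :
    Bounded (cellBound n) (inputState G) ∧ Represents (inputState G).mem G := by
  constructor
  · refine ⟨fun r => ?_, fun a i => ?_⟩
    · simp only [inputState]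
      split_ifs <;> exact le_cellBound (by omega)
    · simp only [inputState]
      split_ifs <;> exact le_cellBound (by omega)
  · intro u v
    simp only [inputState, State.mem_adj]
    constructor
    · intro h
      split_ifs at h with hc
      · obtain ⟨_, a, b, hab, hadj⟩ := hc
        rw [code_inj v.2 b.2, Fin.val_inj, Fin.val_inj] at hab
        rwa [hab.1, hab.2]
      · exact absurd rfl h
    · intro h
      rw [if_pos ⟨rfl, u, v, rfl, h⟩]
      exact one_ne_zero

/-! ### The numerical estimate of the budget. -/

/-- The bound for the time of the initialization and all deletions. -/
def totalBound (n : ℕ) : ℕ := budget n + 100 * (n * n) + 300 * n + 210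

/-- By `le_lev` the term for the distance `y` is at most `2 * size n * n / y + 1`, so the sum is
governed by the harmonic number. One logarithm comes from `size n`, the other from that number. -/
theorem weight_zero_le_log (hn : 1 ≤ n) :
    (weight n 0 : ℝ) ≤ 2 * n + 1 + 2 * Nat.size n * n * (1 + Real.log n) := by
  have hterm : ∀ y ∈ Finset.Ico 1 (n + 1),
      ((n / 2 ^ lev n y + 1 : ℕ) : ℝ) ≤ 2 * Nat.size n * n * (y : ℝ)⁻¹ + 1 := by
    intro y hy
    have hy1 : 1 ≤ y := (Finset.mem_Ico.1 hy).1
    have h₁ : n / 2 ^ lev n y * y ≤ 2 * Nat.size n * n := by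
      calc n / 2 ^ lev n y * y ≤ n / 2 ^ lev n y * (2 ^ lev n y * (Nat.size n * 2)) :=
            Nat.mul_le_mul_left _ (le_lev hn)
        _ = n / 2 ^ lev n y * 2 ^ lev n y * (Nat.size n * 2) := (Nat.mul_assoc _ _ _).symm
        _ ≤ n * (Nat.size n * 2) := Nat.mul_le_mul_right _ (Nat.div_mul_le_self _ _)
        _ = _ := by ring
    have hy0 : (0 : ℝ) < y := by exact_mod_cast hy1
    have h₂ : ((n / 2 ^ lev n y : ℕ) : ℝ) * y ≤ 2 * Nat.size n * n := by exact_mod_cast h₁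
    rw [Nat.cast_add, Nat.cast_one, ← div_eq_mul_inv]
    gcongr
    rwa [le_div_iff₀ hy0]
  have hharm : ∑ y ∈ Finset.Ico 1 (n + 1), (y : ℝ)⁻¹ ≤ 1 + Real.log n := by
    have h₁ := harmonic_le_one_add_log n
    rw [harmonic_eq_sum_Icc] at h₁
    push_cast at h₁
    exact h₁
  rw [weight_eq (Nat.zero_le n), weight, Nat.cast_add, Nat.cast_sum]
  have h₀ : ((n / 2 ^ lev n 0 + 1 : ℕ) : ℝ) ≤ n + 1 := by
    exact_mod_cast Nat.add_le_add_right (Nat.div_le_self _ _) 1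
  have h₁ := Finset.sum_le_sum hterm
  rw [Finset.sum_add_distrib, ← Finset.mul_sum] at h₁
  have h₂ : ∑ _y ∈ Finset.Ico 1 (n + 1), (1 : ℝ) = n := by simp
  have h₃ : 2 * (Nat.size n : ℝ) * n * ∑ y ∈ Finset.Ico 1 (n + 1), (y : ℝ)⁻¹ ≤
      2 * Nat.size n * n * (1 + Real.log n) := mul_le_mul_of_nonneg_left hharm (by positivity)
  simp only [Nat.zero_add] at *
  linarith

theorem size_le_log (hn : 1 ≤ n) : (Nat.size n : ℝ) ≤ 1 + 3 / 2 * Real.log n := by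
  obtain ⟨k, hk⟩ : ∃ k, Nat.size n = k + 1 :=
    ⟨Nat.size n - 1, by have := Nat.size_pos.2 hn; omega⟩
  have h₁ : 2 ^ k ≤ n := Nat.lt_size.1 (by omega)
  have h₂ : (k : ℝ) * Real.log 2 ≤ Real.log n := by
    rw [← Real.log_pow]
    exact Real.log_le_log (by positivity) (by exact_mod_cast h₁)
  -- The constant `3 / 2` comes from `log 2 > 2 / 3`.
  have h₃ := Real.log_two_gt_d9
  have h₄ : (0 : ℝ) ≤ k := Nat.cast_nonneg k
  rw [hk]
  push_cast
  nlinarith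

theorem totalBound_le (n : ℕ) :
    (totalBound n : ℝ) ≤ (1000000 : ℕ) * ((n : ℝ) ^ 3 * Real.log n ^ 3 + 1) := by
  by_cases hn : n ≤ 1
  · have hw := weight_zero_le n
    have hs : Nat.size n ≤ n := Nat.size_le.2 Nat.lt_two_pow_self
    have h₂ : totalBound n ≤ 1000000 := by
      unfold totalBound budget
      generalize weight n 0 = w at *
      generalize Nat.size n = k at *
      rcases Nat.le_one_iff_eq_zero_or_eq_one.1 hn with rfl | rfl
      · simp
      · simp only [one_mul, mul_one]
        omega
    have h₃ : (totalBound n : ℝ) ≤ (1000000 : ℕ) := Nat.cast_le.2 h₂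
    have h₄ : (0 : ℝ) ≤ (n : ℝ) ^ 3 * Real.log n ^ 3 :=
      -- For `n ≤ 1` the logarithm vanishes, and the summand `1` of the claimed bound has to carry
      -- everything.
      mul_nonneg (pow_nonneg (Nat.cast_nonneg n) 3) (pow_nonneg (Real.log_natCast_nonneg n) 3)
    have h₅ := mul_nonneg (Nat.cast_nonneg (α := ℝ) 1000000) h₄
    rw [mul_add, mul_one]
    linarith
  · have hn2 : (2 : ℝ) ≤ n := by exact_mod_cast (by omega : 2 ≤ n)
    have hw := weight_zero_le_log (n := n) (by omega)
    have hs := size_le_log (n := n) (by omega)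
    -- This lower bound allows smaller powers of the logarithm to be absorbed into its cube. The
    -- dominant term is in fact only of order `n³ log² n`.
    have hl : (2 / 3 : ℝ) ≤ Real.log n := by
      have h₁ := Real.log_two_gt_d9
      have h₂ := Real.log_le_log (by norm_num) hn2
      linarith
    unfold totalBound budget
    push_cast
    set x : ℝ := (n : ℝ)
    set l := Real.log x
    set L : ℝ := (Nat.size n : ℝ)
    set w : ℝ := (weight n 0 : ℝ)
    have hx3 : 0 ≤ x ^ 3 := by positivity
    have hL3 : L ≤ 3 * l := by linarith
    have hL0 : 0 ≤ L := Nat.cast_nonneg _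
    have hl2 : 1 ≤ 9 / 4 * l ^ 2 := by nlinarith
    have hl3 : l ^ 2 ≤ 3 / 2 * l ^ 3 := by nlinarith [sq_nonneg l]
    have hw' : w ≤ 30 * (x * l ^ 2) := by
      have h₁ : 2 * L * x * (1 + l) ≤ 2 * (3 * l) * x * (5 / 2 * l) := by
        gcongr
        linarith
      nlinarith
    have e₁ : x * x * w ≤ 45 * (x ^ 3 * l ^ 3) := by
      calc x * x * w ≤ x * x * (30 * (x * l ^ 2)) := by gcongr
        _ = 30 * (x ^ 3 * l ^ 2) := by ring
        _ ≤ 30 * (x ^ 3 * (3 / 2 * l ^ 3)) := by gcongr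
        _ = _ := by ring
    have e₀ : x ^ 3 ≤ 4 * (x ^ 3 * l ^ 3) := by nlinarith
    have e₂ : x * x ≤ x ^ 3 := by nlinarith
    have e₃ : x ≤ x ^ 3 := by nlinarith
    have e₄ : (x + 1) * ((L + 1) * x * x) ≤ 20 * (x ^ 3 * l ^ 3) := by
      have h₁ : L + 1 ≤ 9 / 2 * l := by linarith
      have h₂ : l ≤ 9 / 4 * l ^ 3 := by nlinarith
      calc (x + 1) * ((L + 1) * x * x) ≤ (3 / 2 * x) * ((9 / 2 * l) * x * x) := by
            gcongr
            linarith
        _ = 27 / 4 * (x ^ 3 * l) := by ring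
        _ ≤ 27 / 4 * (x ^ 3 * (9 / 4 * l ^ 3)) := by gcongr
        _ ≤ 20 * (x ^ 3 * l ^ 3) := by nlinarith
    have e₅ : (x + 1) * (x * x) ≤ 2 * x ^ 3 := by nlinarith
    nlinarith

end DecAPSP

theorem theorem1 :
    ∃ (A : DecAPSP.DataStructure) (c C : ℕ),
      ∀ (n : ℕ) (G : Digraph (Fin n)),
        ∃ (t₀ : ℕ) (s₀ : DecAPSP.State),
          DecAPSP.Exec ((n + 2) ^ c) A.init (DecAPSP.inputState G) t₀ s₀ ∧
          DecAPSP.StoresDistances G s₀ ∧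
          ∀ ops : List (DecAPSP.Op n), DecAPSP.Legal G ops →
            ∃ T : ℕ,
              DecAPSP.Serves A ((n + 2) ^ c) C G s₀ ops T ∧
              ((t₀ + T : ℕ) : ℝ) ≤ (C : ℝ) * ((n : ℝ) ^ 3 * Real.log n ^ 3 + 1) := by
  refine ⟨DecAPSP.decremental, 960, 1000000, fun n G => ?_⟩
  obtain ⟨hb, hG⟩ := DecAPSP.inputState_spec G
  obtain ⟨t₀, s₀, hrun, hI, hpot, ha, ht⟩ := DecAPSP.runs_init hb (by simp [DecAPSP.inputState])
    fun a ha i => by simp [DecAPSP.inputState, ha]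
  have hG' : DecAPSP.Represents s₀.mem G := by
    unfold DecAPSP.Represents
    rw [DecAPSP.State.mem_adj, ha]
    exact hG
  refine ⟨t₀, s₀, hrun, hI.storesDistances hG', fun ops hops => ?_⟩
  obtain ⟨T, hT, hle⟩ := hI.serves hG' hpot hops
  refine ⟨T, hT, le_trans ?_ (DecAPSP.totalBound_le n)⟩
  have : t₀ + T ≤ DecAPSP.totalBound n := by
    unfold DecAPSP.totalBound
    omega
  exact_mod_cast this
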